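/- Let $\Theta=\{c,h,\mathbf c,\mathbf h,\mathbf f\}$, where $c,h$ are a cheeseburger and a hamburger, and $\mathbf c,\mathbf h,\mathbf f$ are a cheeseburger order, a hamburger order and a flexible order. Each finite word in $\Theta$ is equivalent, modulo the relations $c\mathbf c=h\mathbf h=c\mathbf f=h\mathbf f=\emptyset$, $c\mathbf h=\mathbf h c$, $h\mathbf c=\mathbf c h$, to a unique reduced word, i.e. a word consisting of a list of orders followed by a list of burgers. (Reading the word from left to right, each burger is put on top of a stack, each order removes the topmost burger that can fill it, and the reduced word lists the unfilled orders and then the remaining burgers.) Fix $p\in[0,1]$, and let $(X(n))_{n\in\mathbb Z}$ be i.i.d. with values $c,h,\mathbf c,\mathbf h,\mathbf f$ taken with probabilities $\frac14,\frac14,\frac{1-p}4,\frac{1-p}4,\frac p2$. For $a\le b$ let $X(a,b)$ be the reduced word of $X(a)X(a+1)\cdots X(b)$. Almost surely every flexible order is filled; let $Y(n)=X(n)$ if $X(n)\ne\mathbf f$, and if $X(n)=\mathbf f$ let $Y(n)$ be the order ($\mathbf c$ or $\mathbf h$) for the type of burger that is consumed by the order at time $n$. For $n\ge0$ let $\mathcal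 D_n$ be the number of $i\in\{1,\dots,n\}$ with $Y(i)\in\{h,\mathbf c\}$ minus the number of $i\in\{1,\dots,n\}$ with $Y(i)\in\{c,\mathbf h\}$. Let $J$ be the smallest positive integer such that $X(-J,-1)$ contains a burger; $J$ is almost surely finite. Let $\chi=\chi(p)$ be the expected length of the word $X(-J,-1)$; this expectation is finite, and so is the second moment of each $\mathcal D_n$. If $p\le\frac12$, then $\chi=2$ and $\mathrm{Var}[\mathcal D_n]=(1-2p)\,n+o(n)$ as $n\to\infty$. If $p\ge\frac12$, then $\chi=\frac1p$ and $\mathrm{Var}[\mathcal D_n]=o(n)$ as $n\to\infty$. -/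

import Mathlib

open MeasureTheory

namespace Burger

/-- The alphabet: two kinds of burgers, two kinds of specific orders, and the flexible
("freshest available") order. -/
inductive Symb where
  | cheeseBurger
  | hamBurger
  | cheeseOrder
  | hamOrder
  | flexOrder
  deriving DecidableEq

namespace Symb

/-- Is the symbol a burger (as opposed to an order)? -/
def isBurger : Symb → Bool
  | cheeseBurger => true
  | hamBurger => true
  | _ => false

/-- `fulfils o b`: the order `o` can be filled by the burger `b`. -/
def fulfils : Symb → Symb → Bool
  | cheeseOrder, cheeseBurger => true
  | hamOrder, hamBurger => true
  | flexOrder, cheeseBurger => true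
  | flexOrder, hamBurger => true
  | _, _ => false

/-- Discrepancy of hamburgers over cheeseburgers contributed by one symbol (the flexible order
contributes nothing; it does not occur in the words to which this is applied). -/
def disc : Symb → ℤ
  | hamBurger => 1
  | cheeseOrder => 1
  | cheeseBurger => -1
  | hamOrder => -1
  | flexOrder => 0

end Symb

instance : MeasurableSpace Symb := ⊤

/-- A reduced word: a list of (unfulfilled) orders, read from left to right, followed by a stack
of (unconsumed) burgers. The stack is stored from the top down, so the burger at the head of
`burgers` is the rightmost letter of the word. -/
structure RWord where
  orders : List Symb
  burgers : List Symb

namespace RWord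

/-- The reduced word as a word in the alphabet. -/
def toWord (R : RWord) : List Symb := R.orders ++ R.burgers.reverse

/-- Length of the reduced word. -/
def length (R : RWord) : ℕ := R.toWord.length

/-- Multiply a reduced word on the right by one symbol and reduce: a burger is put on top of the
stack; an order removes the topmost burger that can fill it, and is appended to the right end of
the list of orders if there is no such burger. -/
def push (R : RWord) (s : Symb) : RWord :=
  if s.isBurger then ⟨R.orders, s :: R.burgers⟩
  else if R.burgers.any s.fulfils then ⟨R.orders, R.burgers.eraseP s.fulfils⟩
  else ⟨R.orders ++ [s], R.burgers⟩

end RWord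

/-- The reduced form of a finite word. -/
def reduce (W : List Symb) : RWord := W.foldl RWord.push ⟨[], []⟩

/-- A configuration: a bi-infinite sequence of symbols. -/
abbrev Config : Type := ℤ → Symb

/-- The (unreduced) word `X(a) X(a+1) ⋯ X(b)`; it is empty if `b < a`. -/
def rawWord (X : Config) (a b : ℤ) : List Symb :=
  (List.range (b + 1 - a).toNat).map fun i => X (a + i)

/-- The reduced word `X(a,b)`, the reduced form of `X(a) X(a+1) ⋯ X(b)`. -/
def reducedWord (X : Config) (a b : ℤ) : RWord := reduce (rawWord X a b)

/-- The burger added at time `m` is consumed at time `n`: `X(m)` is a burger and `n` is the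
smallest integer `> m` such that `X(m,n)` contains no burger of the type `X(m)`. -/
def IsMatch (X : Config) (m n : ℤ) : Prop :=
  (X m).isBurger = true ∧ m < n ∧ X m ∉ (reducedWord X m n).burgers ∧
    ∀ k, m < k → k < n → X m ∈ (reducedWord X m k).burgers

open Classical in
/-- `Y(n)`: the symbol `X(n)`, except that a flexible order is replaced by the order for the type
of burger that it actually consumes (it is left alone if it is never filled). -/
noncomputable def resolved (X : Config) (n : ℤ) : Symb :=
  if X n = Symb.flexOrder then
    if ∃ m, IsMatch X m n ∧ X m = Symb.cheeseBurger then Symb.cheeseOrder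
    else if ∃ m, IsMatch X m n ∧ X m = Symb.hamBurger then Symb.hamOrder
    else Symb.flexOrder
  else X n

/-- `D_n` for `n ≥ 0`: the net change of the discrepancy between times `0` and `n`. -/
noncomputable def discrepancy (n : ℕ) (X : Config) : ℤ :=
  ∑ i ∈ Finset.Icc 1 n, (resolved X (i : ℤ)).disc

/-- The positive integers `j` for which the reduced word `X(-j,-1)` contains a burger. -/
def burgerTimes (X : Config) : Set ℕ :=
  {j | 0 < j ∧ (reducedWord X (-(j : ℤ)) (-1)).burgers ≠ []}

/-- `J`: the smallest positive integer `j` for which `X(-j,-1)` contains a burger. -/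
noncomputable def firstBurgerTime (X : Config) : ℕ := sInf (burgerTimes X)

/-- `|X(-J,-1)|`, the length of the reduced word `X(-J,-1)`. -/
noncomputable def lengthAtJ (X : Config) : ℕ :=
  (reducedWord X (-(firstBurgerTime X : ℤ)) (-1)).length

/-- The law of a single symbol: the burgers have probability `1/4` each, the two specific orders
`(1-p)/4` each, and the flexible order `p/2`. -/
noncomputable def symbolLaw (p : ℝ) : Measure Symb :=
  ENNReal.ofReal (1 / 4) • Measure.dirac Symb.cheeseBurger +
  ENNReal.ofReal (1 / 4) • Measure.dirac Symb.hamBurger +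
  ENNReal.ofReal ((1 - p) / 4) • Measure.dirac Symb.cheeseOrder +
  ENNReal.ofReal ((1 - p) / 4) • Measure.dirac Symb.hamOrder +
  ENNReal.ofReal (p / 2) • Measure.dirac Symb.flexOrder

theorem isProbabilityMeasure_symbolLaw {p : ℝ} (h0 : 0 ≤ p) (h1 : p ≤ 1) :
    IsProbabilityMeasure (symbolLaw p) := by
  refine ⟨?_⟩
  have h2 : 0 ≤ (1 - p) / 4 := by linarith
  simp only [symbolLaw, Measure.add_apply, Measure.smul_apply, measure_univ, smul_eq_mul, mul_one]
  rw [← ENNReal.ofReal_add (by norm_num) (by norm_num),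
    ← ENNReal.ofReal_add (by norm_num) h2, ← ENNReal.ofReal_add (by linarith) h2,
    ← ENNReal.ofReal_add (by linarith) (by linarith), ← ENNReal.ofReal_one]
  congr 1
  ring

/-- The measure `μ`, the law of an i.i.d. sequence of symbols indexed by the integers. -/
noncomputable def configLaw (p : ℝ) : Measure Config :=
  Measure.infinitePi fun _ : ℤ => symbolLaw p

/-- `χ(p)`, the expected length of `X(-J,-1)`. -/
noncomputable def chi (p : ℝ) : ℝ := ∫ X, (lengthAtJ X : ℝ) ∂(configLaw p)

/-- `Var[D_n]`. -/
noncomputable def varDisc (p : ℝ) (n : ℕ) : ℝ :=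
  ProbabilityTheory.variance (fun X : Config => (discrepancy n X : ℝ)) (configLaw p)

end Burger

namespace Burger

/-! ### Reduced words -/

/-! Read the sequence backwards from a fixed time. Let `C_n` be burgers minus orders among the last
`n` letters, `D_n` the change of discrepancy over them, and `J` the first length at which the
reduced word contains a burger. Then `C` is a simple random walk, whatever `p` is. While `J > n` the
reduced word consists of orders only, so `|D_n| ≤ -C_n`. At time `J` it is a single burger preceded
by orders which that burger cannot fill. So if the word has length `l`, then `C_J = 2 - l` and `D_J
= ±l`, the sign being that of the burger.

Optional stopping of `C` at `min(J, n)` gives `E[l; J ≤ n] = 2 P(J ≤ n) - E[-C_n; J > n]`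
(`truncLength_eq`). Hence `χ ≤ 2`, and `2 - χ` is the limit of `E[-C_n; J > n]`.

By the symmetry between the two foods `D_n` has mean zero, so its variance is its second moment. The
newest letter is correlated with the earlier ones only when it is a flexible order, and then through
the sign `b` of the top burger. On `J ≤ n` one has `D_n = b l` plus an independent symmetric term,
so `E[b D_n; J ≤ n] = E[l; J ≤ n]`. The second moment thus grows at step `n` by `1 - p E[l; J ≤ n]`,
up to an error of at most `p E[|D_n|; J > n]` (`discMoment_two_succ`). If this error vanishes, then
`Var[D_n] / n → 1 - p χ`.

The error does vanish (`tendsto_nilError`). If `χ = 2`, it is dominated by `E[-C_n; J > n] → 0`. If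
`χ < 2`, cut the past into i.i.d. blocks, each being a first word with a burger. A block has mean
count `2 - χ > 0` and mean discrepancy `0`. By the law of large numbers, `O(√n)` blocks exceed the
range of the walk `C` over `n` steps, and over that many blocks the discrepancy is `o(√n)`. So `D_n`
is `o(√n)` in probability (`abs_pastDisc_le_of_regular`), and in mean square thanks to a fourth
moment bound of order `n²`. Sublinear variance in turn makes the error vanish
(`tendsto_absNil_of_sublinear`).

Consequently `p χ ≤ 1`, because a variance is nonnegative, and either `χ = 2` or `p χ = 1`. This
determines `χ`, and with it the limit of the variance, in both phases. -/

theorem reduce_concat (w : List Symb) (s : Symb) : reduce (w ++ [s]) = (reduce w).push s := by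
  simp [reduce]

theorem push_burger {s : Symb} (h : s.isBurger = true) (R : RWord) :
    R.push s = ⟨R.orders, s :: R.burgers⟩ := by simp [RWord.push, h]

theorem push_order_of_any {s : Symb} (h : s.isBurger = false) {R : RWord}
    (ha : R.burgers.any s.fulfils = true) :
    R.push s = ⟨R.orders, R.burgers.eraseP s.fulfils⟩ := by
  simp only [RWord.push, h, ha]; simp

theorem push_order_of_not_any {s : Symb} (h : s.isBurger = false) {R : RWord}
    (ha : R.burgers.any s.fulfils = false) :
    R.push s = ⟨R.orders ++ [s], R.burgers⟩ := by
  simp only [RWord.push, h, ha]; simp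

theorem any_fulfils_append_false {s : Symb} {B C : List Symb}
    (h : B.any s.fulfils = false) : (B ++ C).any s.fulfils = C.any s.fulfils := by
  rw [List.any_append, h, Bool.false_or]

/-- Multiplying on the right by `w` depends on `w` only through its reduced form. -/
theorem foldl_push (R : RWord) (w : List Symb) :
    w.foldl RWord.push R =
      ⟨((reduce w).orders.foldl RWord.push R).orders,
        (reduce w).burgers ++ ((reduce w).orders.foldl RWord.push R).burgers⟩ := by
  induction w using List.reverseRecOn with
  | nil => simp [reduce]
  | append_singleton w s ih =>
    rw [List.foldl_append, ih, reduce_concat]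
    simp only [List.foldl_cons, List.foldl_nil]
    cases hs : s.isBurger with
    | true => rw [push_burger hs, push_burger hs]; simp
    | false =>
      cases ha : (reduce w).burgers.any s.fulfils with
      | true =>
        rw [push_order_of_any hs ha, push_order_of_any hs (by simp [ha])]
        obtain ⟨b, hb, hb'⟩ := List.any_eq_true.mp ha
        simp [List.eraseP_append_left hb' _ hb]
      | false =>
        rw [push_order_of_not_any hs ha]
        simp only [List.foldl_append, List.foldl_cons, List.foldl_nil]
        set S := (reduce w).orders.foldl RWord.push R
        have hne : ∀ b ∈ (reduce w).burgers, ¬ s.fulfils b = true := by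
          intro b hb h
          have : (reduce w).burgers.any s.fulfils = true := List.any_eq_true.mpr ⟨b, hb, h⟩
          simp [ha] at this
        cases ha' : S.burgers.any s.fulfils with
        | true =>
          rw [push_order_of_any hs (by simp [any_fulfils_append_false ha, ha']),
            push_order_of_any hs ha']
          simp [List.eraseP_append_right _ hne]
        | false =>
          rw [push_order_of_not_any hs (by simp only [any_fulfils_append_false ha, ha']),
            push_order_of_not_any hs ha']

theorem reduce_append (u w : List Symb) :
    reduce (u ++ w) = ⟨((reduce w).orders.foldl RWord.push (reduce u)).orders,
        (reduce w).burgers ++ ((reduce w).orders.foldl RWord.push (reduce u)).burgers⟩ := by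
  rw [reduce, List.foldl_append, foldl_push]; rfl

theorem isBurger_of_mem_burgers (w : List Symb) : ∀ b ∈ (reduce w).burgers, b.isBurger = true := by
  induction w using List.reverseRecOn with
  | nil => simp [reduce]
  | append_singleton w s ih =>
    rw [reduce_concat]
    cases hs : s.isBurger with
    | true => rw [push_burger hs]; simpa [hs] using ih
    | false =>
      cases ha : (reduce w).burgers.any s.fulfils with
      | true =>
        rw [push_order_of_any hs ha]
        intro b hb
        exact ih b (List.mem_of_mem_eraseP hb)
      | false => rw [push_order_of_not_any hs ha]; exact ih

theorem not_isBurger_of_mem_orders (w : List Symb) :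
    ∀ o ∈ (reduce w).orders, o.isBurger = false := by
  induction w using List.reverseRecOn with
  | nil => simp [reduce]
  | append_singleton w s ih =>
    rw [reduce_concat]
    cases hs : s.isBurger with
    | true => rw [push_burger hs]; exact ih
    | false =>
      cases ha : (reduce w).burgers.any s.fulfils with
      | true => rw [push_order_of_any hs ha]; exact ih
      | false =>
        rw [push_order_of_not_any hs ha]
        intro o ho
        rcases List.mem_append.mp ho with h | h
        · exact ih o h
        · simp at h; rw [h, hs]

theorem foldl_push_orders_nil (O A : List Symb) (hO : ∀ o ∈ O, o.isBurger = false) :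
    O.foldl RWord.push ⟨A, []⟩ = ⟨A ++ O, []⟩ := by
  induction O generalizing A with
  | nil => simp
  | cons o O ih =>
    rw [List.foldl_cons, push_order_of_not_any (hO o (by simp)) (by simp),
      ih _ (fun x hx => hO x (by simp [hx]))]
    simp

/-- A lone burger survives a string of orders only if none of them can take it; then every order
stays unfilled. This fixes the shape of the word at time `J`. -/
theorem foldl_push_orders_singleton (O A : List Symb) (b : Symb)
    (hO : ∀ o ∈ O, o.isBurger = false)
    (h : (O.foldl RWord.push ⟨A, [b]⟩).burgers ≠ []) :
    O.foldl RWord.push ⟨A, [b]⟩ = ⟨A ++ O, [b]⟩ ∧ ∀ o ∈ O, o.fulfils b = false := by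
  induction O generalizing A with
  | nil => simp
  | cons o O ih =>
    have hO' : ∀ x ∈ O, x.isBurger = false := fun x hx => hO x (by simp [hx])
    rw [List.foldl_cons] at h ⊢
    cases hb : o.fulfils b with
    | true =>
      rw [push_order_of_any (hO o (by simp)) (by simp [hb])] at h
      simp [hb, foldl_push_orders_nil _ _ hO'] at h
    | false =>
      rw [push_order_of_not_any (hO o (by simp)) (by simp [hb])] at h ⊢
      obtain ⟨h1, h2⟩ := ih _ hO' h
      refine ⟨by rw [h1]; simp, ?_⟩
      intro x hx
      rcases List.mem_cons.mp hx with rfl | hx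
      · exact hb
      · exact h2 x hx

/-- `+1` for a burger, `-1` for an order. -/
def Symb.step (s : Symb) : ℤ := if s.isBurger then 1 else -1

theorem length_burgers_sub_length_orders (w : List Symb) :
    ((reduce w).burgers.length : ℤ) - (reduce w).orders.length = (w.map Symb.step).sum := by
  induction w using List.reverseRecOn with
  | nil => simp [reduce]
  | append_singleton w s ih =>
    rw [reduce_concat, List.map_append, List.sum_append, ← ih]
    cases hs : s.isBurger with
    | true => rw [push_burger hs]; simp [Symb.step, hs]; ring
    | false =>
      cases ha : (reduce w).burgers.any s.fulfils with
      | true =>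
        rw [push_order_of_any hs ha]
        obtain ⟨b, hb, hb'⟩ := List.any_eq_true.mp ha
        have h1 := List.length_eraseP_of_mem hb hb'
        have h2 := List.length_pos_of_mem hb
        have h3 : (((reduce w).burgers.eraseP s.fulfils).length : ℤ)
            = (reduce w).burgers.length - 1 := by rw [h1]; omega
        simp only [h3]
        simp [Symb.step, hs]; ring
      | false => rw [push_order_of_not_any hs ha]; simp [Symb.step, hs]; ring

/-! ### Words read backwards from a fixed time -/

/-- Forget the first `j` letters. -/
def shift (j : ℕ) (Z : ℕ → Symb) : ℕ → Symb := fun i => Z (i + j)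

theorem shift_shift (i j : ℕ) (Z : ℕ → Symb) : shift i (shift j Z) = shift (i + j) Z := by
  funext k; simp [shift, add_assoc]

@[simp] theorem shift_zero (Z : ℕ → Symb) : shift 0 Z = Z := rfl

/-- The word `Z (n-1) ⋯ Z 0`. -/
def pastWord (Z : ℕ → Symb) : ℕ → List Symb
  | 0 => []
  | n + 1 => Z n :: pastWord Z n

theorem pastWord_add (Z : ℕ → Symb) (m n : ℕ) :
    pastWord Z (m + n) = pastWord (shift m Z) n ++ pastWord Z m := by
  induction n with
  | zero => simp [pastWord]
  | succ n ih => rw [← add_assoc, pastWord, ih, pastWord]; simp [shift, add_comm]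

theorem pastWord_succ' (Z : ℕ → Symb) (n : ℕ) :
    pastWord Z (n + 1) = pastWord (shift 1 Z) n ++ [Z 0] := by
  rw [add_comm, pastWord_add]; simp [pastWord]

/-- The reduced word of `Z (n-1) ⋯ Z 0`. -/
def pastRed (Z : ℕ → Symb) (n : ℕ) : RWord := reduce (pastWord Z n)

theorem pastRed_succ' (Z : ℕ → Symb) (n : ℕ) :
    pastRed Z (n + 1) = (pastRed (shift 1 Z) n).push (Z 0) := by
  rw [pastRed, pastWord_succ', reduce_concat]; rfl

/-- Older letters can only add burgers underneath: in `reduce_append` the burgers of the later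
factor stay intact on top. So the event that the last `n` letters leave no burger decreases in `n`,
and the top of the stack is well defined. -/
theorem burgers_prefix (Z : ℕ → Symb) {m n : ℕ} (h : m ≤ n) :
    (pastRed Z m).burgers <+: (pastRed Z n).burgers := by
  obtain ⟨k, rfl⟩ := Nat.exists_eq_add_of_le h
  rw [pastRed, pastRed, pastWord_add, reduce_append]
  exact List.prefix_append _ _

theorem burgers_nil_mono {Z : ℕ → Symb} {m n : ℕ} (h : m ≤ n) (hn : (pastRed Z n).burgers = []) :
    (pastRed Z m).burgers = [] :=
  List.prefix_nil.mp (hn ▸ burgers_prefix Z h)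

/-- The lengths for which the past contains an unconsumed burger. -/
def topTimes (Z : ℕ → Symb) : Set ℕ := {n | 0 < n ∧ (pastRed Z n).burgers ≠ []}

/-- The first length for which the past contains an unconsumed burger. -/
noncomputable def topTime (Z : ℕ → Symb) : ℕ := sInf (topTimes Z)

theorem mem_topTimes {Z : ℕ → Symb} {n : ℕ} : n ∈ topTimes Z ↔ (pastRed Z n).burgers ≠ [] := by
  refine ⟨fun h => h.2, fun h => ⟨?_, h⟩⟩
  rcases Nat.eq_zero_or_pos n with rfl | h'
  · simp [pastRed, pastWord, reduce] at h
  · exact h'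

theorem topTime_pos {Z : ℕ → Symb} (h : (topTimes Z).Nonempty) : 0 < topTime Z := (Nat.sInf_mem h).1

theorem burgers_eq_nil_iff {Z : ℕ → Symb} (h : (topTimes Z).Nonempty) (n : ℕ) :
    (pastRed Z n).burgers = [] ↔ n < topTime Z := by
  constructor
  · intro hn
    by_contra hlt
    exact (Nat.sInf_mem h).2 (burgers_nil_mono (not_lt.mp hlt) hn)
  · intro hlt
    by_contra hn
    exact absurd (Nat.sInf_le (mem_topTimes.mpr hn)) (not_le.mpr hlt)

/-- The letter at the top of the stack. -/
noncomputable def topBurger (Z : ℕ → Symb) : Symb := Z (topTime Z - 1)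

/-- The letter that first creates a burger must be a burger itself, since putting an order in front
of orders only lengthens the list. It survives the later orders, so none of them accepts it. -/
theorem pastRed_of_first {Z : ℕ → Symb} {n : ℕ} (h0 : (pastRed Z n).burgers = [])
    (h1 : (pastRed Z (n + 1)).burgers ≠ []) :
    (Z n).isBurger = true ∧ pastRed Z (n + 1) = ⟨(pastRed Z n).orders, [Z n]⟩ ∧
      ∀ o ∈ (pastRed Z n).orders, o.fulfils (Z n) = false := by
  have hO := not_isBurger_of_mem_orders (pastWord Z n)
  have key : pastRed Z (n + 1) =
      ⟨((pastRed Z n).orders.foldl RWord.push (reduce [Z n])).orders,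
        (pastRed Z n).burgers ++ ((pastRed Z n).orders.foldl RWord.push (reduce [Z n])).burgers⟩ := by
    rw [pastRed, pastWord, ← List.singleton_append, reduce_append]; rfl
  rw [h0, List.nil_append] at key
  cases hb : (Z n).isBurger with
  | false =>
    exfalso
    have : reduce [Z n] = ⟨[Z n], []⟩ := by
      simp only [reduce, List.foldl_cons, List.foldl_nil]
      rw [push_order_of_not_any hb rfl]; rfl
    rw [this, foldl_push_orders_nil (pastRed Z n).orders _ hO] at key
    rw [key] at h1; simp at h1
  | true =>
    have : reduce [Z n] = ⟨[], [Z n]⟩ := by simp [reduce, push_burger hb]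
    rw [this] at key
    have h2 := foldl_push_orders_singleton (pastRed Z n).orders [] (Z n) hO (by
      rw [key] at h1; exact h1)
    rw [h2.1] at key
    exact ⟨rfl, by simpa using key, h2.2⟩

theorem pastRed_topTime {Z : ℕ → Symb} (h : (topTimes Z).Nonempty) :
    (topBurger Z).isBurger = true ∧
      pastRed Z (topTime Z) = ⟨(pastRed Z (topTime Z - 1)).orders, [topBurger Z]⟩ ∧
      ∀ o ∈ (pastRed Z (topTime Z)).orders, o.fulfils (topBurger Z) = false := by
  have hp := topTime_pos h
  have h0 : (pastRed Z (topTime Z - 1)).burgers = [] := (burgers_eq_nil_iff h _).mpr (by omega)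
  have h1 : (pastRed Z (topTime Z - 1 + 1)).burgers ≠ [] := by
    rw [Ne, burgers_eq_nil_iff h]; omega
  obtain ⟨a, b, c⟩ := pastRed_of_first h0 h1
  rw [Nat.sub_add_cancel hp] at b
  exact ⟨a, b, by rw [b]; exact c⟩

theorem head_burgers {Z : ℕ → Symb} {n : ℕ} (hn : (pastRed Z n).burgers ≠ []) :
    ∃ B, (pastRed Z n).burgers = topBurger Z :: B := by
  have h : (topTimes Z).Nonempty := ⟨n, mem_topTimes.mpr hn⟩
  have hle : topTime Z ≤ n := Nat.sInf_le (mem_topTimes.mpr hn)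
  obtain ⟨B, hB⟩ := burgers_prefix Z hle
  rw [(pastRed_topTime h).2.1] at hB
  exact ⟨B, hB.symm⟩

/-- Contribution of the most recent letter to the discrepancy, the flexible order being resolved
by means of the past. -/
noncomputable def incr (Z : ℕ → Symb) : ℤ :=
  if Z 0 = Symb.flexOrder then -(topBurger (shift 1 Z)).disc else (Z 0).disc

theorem abs_disc_le (s : Symb) : |s.disc| ≤ 1 := by cases s <;> simp [Symb.disc]

theorem abs_incr_le (Z : ℕ → Symb) : |incr Z| ≤ 1 := by
  unfold incr; split_ifs
  · rw [abs_neg]; exact abs_disc_le _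
  · exact abs_disc_le _

/-- Change of the discrepancy over the `n` most recent letters. -/
noncomputable def pastDisc (Z : ℕ → Symb) (n : ℕ) : ℤ := ∑ k ∈ Finset.range n, incr (shift k Z)

theorem pastDisc_add (Z : ℕ → Symb) (m n : ℕ) :
    pastDisc Z (m + n) = pastDisc Z m + pastDisc (shift m Z) n := by
  simp only [pastDisc, Finset.sum_range_add, shift_shift, add_comm]

theorem pastDisc_succ' (Z : ℕ → Symb) (n : ℕ) :
    pastDisc Z (n + 1) = incr Z + pastDisc (shift 1 Z) n := by
  rw [add_comm, pastDisc_add]; simp [pastDisc]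

theorem abs_pastDisc_le (Z : ℕ → Symb) (n : ℕ) : |pastDisc Z n| ≤ n := by
  refine (Finset.abs_sum_le_sum_abs _ _).trans ?_
  refine (Finset.sum_le_sum fun k _ => abs_incr_le _).trans ?_
  simp

/-- Number of burgers minus number of orders among the `n` most recent letters. -/
def pastCount (Z : ℕ → Symb) (n : ℕ) : ℤ := ∑ k ∈ Finset.range n, (Z k).step

theorem pastCount_succ (Z : ℕ → Symb) (n : ℕ) :
    pastCount Z (n + 1) = pastCount Z n + (Z n).step := Finset.sum_range_succ _ _

theorem pastCount_add (Z : ℕ → Symb) (m n : ℕ) :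
    pastCount Z (m + n) = pastCount Z m + pastCount (shift m Z) n := by
  simp only [pastCount, Finset.sum_range_add, shift, add_comm]

theorem pastCount_eq_sum (Z : ℕ → Symb) (n : ℕ) :
    pastCount Z n = ((pastWord Z n).map Symb.step).sum := by
  induction n with
  | zero => simp [pastCount, pastWord]
  | succ n ih => rw [pastCount_succ, ih, pastWord]; simp [add_comm]

theorem pastCount_eq (Z : ℕ → Symb) (n : ℕ) :
    pastCount Z n = (pastRed Z n).burgers.length - (pastRed Z n).orders.length := by
  rw [pastCount_eq_sum, ← length_burgers_sub_length_orders]; rfl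

/-! ### Discrepancy of a word compared with that of its reduced form -/

theorem sum_disc_eraseP {s : Symb} {B : List Symb} (hs : s ≠ Symb.flexOrder)
    (ha : B.any s.fulfils = true) :
    ((B.eraseP s.fulfils).map Symb.disc).sum = (B.map Symb.disc).sum + s.disc := by
  obtain ⟨b, hb, hb'⟩ := List.any_eq_true.mp ha
  obtain ⟨a, l₁, l₂, -, h2, h3, h4⟩ := List.exists_of_eraseP hb hb'
  rw [h4, h3]
  have : s.disc = - a.disc := by
    cases s <;> cases a <;> simp_all [Symb.fulfils, Symb.disc]
  simp only [List.map_append, List.map_cons, List.sum_append, List.sum_cons, this]; ring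

theorem isBurger_flex_fulfils {b : Symb} (h : b.isBurger = true) :
    Symb.flexOrder.fulfils b = true := by
  cases b <;> simp_all [Symb.fulfils, Symb.isBurger]

theorem any_flex_iff {Z : ℕ → Symb} {n : ℕ} :
    (pastRed Z n).burgers.any Symb.flexOrder.fulfils = true ↔ (pastRed Z n).burgers ≠ [] := by
  constructor
  · intro h h'; simp [h'] at h
  · intro h
    obtain ⟨b, hb⟩ := List.exists_mem_of_ne_nil _ h
    exact List.any_eq_true.mpr ⟨b, hb, isBurger_flex_fulfils (isBurger_of_mem_burgers _ _ hb)⟩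

/-- The discrepancy changes by the discrepancy of the reduced word, up to the contribution of its
unfilled orders. -/
theorem pastDisc_bounds (Z : ℕ → Symb) (n : ℕ) :
    |pastDisc Z n - ((pastRed Z n).burgers.map Symb.disc).sum| ≤ (pastRed Z n).orders.length ∧
    (Symb.flexOrder ∉ (pastRed Z n).orders → pastDisc Z n =
      ((pastRed Z n).burgers.map Symb.disc).sum + ((pastRed Z n).orders.map Symb.disc).sum) := by
  induction n generalizing Z with
  | zero => simp [pastDisc, pastRed, pastWord, reduce]
  | succ n ih =>
    obtain ⟨ih1, ih2⟩ := ih (shift 1 Z)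
    rw [pastDisc_succ', pastRed_succ']
    set R := pastRed (shift 1 Z) n with hR
    cases hs : (Z 0).isBurger with
    | true =>
      have hf : Z 0 ≠ Symb.flexOrder := by intro h; simp [h, Symb.isBurger] at hs
      rw [push_burger hs]
      simp only [incr, hf, if_false, List.map_cons, List.sum_cons]
      refine ⟨by rwa [add_sub_add_left_eq_sub], fun h => ?_⟩
      rw [ih2 h]; ring
    | false =>
      cases ha : R.burgers.any (Z 0).fulfils with
      | true =>
        rw [push_order_of_any hs ha]
        have key : ((R.burgers.eraseP (Z 0).fulfils).map Symb.disc).sum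
            = (R.burgers.map Symb.disc).sum + incr Z := by
          by_cases hf : Z 0 = Symb.flexOrder
          · rw [hf] at ha ⊢
            have hne := any_flex_iff.mp ha
            obtain ⟨B, hB⟩ := head_burgers hne
            have hb : (topBurger (shift 1 Z)).isBurger = true :=
              isBurger_of_mem_burgers (pastWord (shift 1 Z) n) _ (by
                change _ ∈ (pastRed _ _).burgers
                rw [hB]; simp)
            rw [hR, hB, List.eraseP_cons_of_pos (isBurger_flex_fulfils hb)]
            simp [incr, hf]
          · rw [sum_disc_eraseP hf ha]; simp [incr, hf]
        simp only [key]
        refine ⟨by convert ih1 using 2; ring, fun h => ?_⟩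
        rw [ih2 h]; ring
      | false =>
        rw [push_order_of_not_any hs ha]
        constructor
        -- An unfilled order changes the discrepancy by at most one and lengthens the list of orders
        -- by one. If it is flexible, its sign is decided by letters older than the window.
        · have h1 := abs_le.mp ih1
          have h2 := abs_le.mp (abs_incr_le Z)
          rw [abs_le]
          simp only [List.length_append, List.length_singleton]
          push_cast
          constructor <;> linarith [h1.1, h1.2, h2.1, h2.2]
        · intro h
          simp only [List.mem_append, List.mem_singleton, not_or] at h
          rw [ih2 h.1]
          simp [incr, Ne.symm h.2]; ring

/-- Without burgers only unfilled orders contribute, and their number is minus the count. This is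
how the simple random walk controls the discrepancy throughout. -/
theorem abs_pastDisc_le_of_burgers_nil {Z : ℕ → Symb} {n : ℕ} (h : (pastRed Z n).burgers = []) :
    |pastDisc Z n| ≤ -pastCount Z n := by
  have := (pastDisc_bounds Z n).1
  rw [pastCount_eq, h]
  simpa [h] using this

theorem pastCount_nonpos_of_burgers_nil {Z : ℕ → Symb} {n : ℕ} (h : (pastRed Z n).burgers = []) :
    pastCount Z n ≤ 0 := by
  rw [pastCount_eq, h]; simp

/-- Length of the reduced word at the time of the first burger. -/
noncomputable def topLength (Z : ℕ → Symb) : ℕ := (pastRed Z (topTime Z)).length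

/-- One burger and `topLength - 1` orders. -/
theorem pastCount_topTime {Z : ℕ → Symb} (h : (topTimes Z).Nonempty) :
    pastCount Z (topTime Z) = 2 - topLength Z := by
  rw [pastCount_eq, topLength, RWord.length, RWord.toWord, List.length_append,
    List.length_reverse, (pastRed_topTime h).2.1]
  push_cast; simp; ring

theorem disc_eq_of_not_fulfils {o b : Symb} (ho : o.isBurger = false) (hb : b.isBurger = true)
    (h : o.fulfils b = false) : o ≠ Symb.flexOrder ∧ o.disc = b.disc := by
  cases o <;> cases b <;> simp_all [Symb.fulfils, Symb.isBurger, Symb.disc]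

/-- The unfilled orders are specific and of the type opposite to the burger, so they all have the
same discrepancy as the burger: nothing cancels. -/
theorem pastDisc_topTime {Z : ℕ → Symb} (h : (topTimes Z).Nonempty) :
    pastDisc Z (topTime Z) = (topBurger Z).disc * topLength Z := by
  obtain ⟨h1, h2, h3⟩ := pastRed_topTime h
  have hO := not_isBurger_of_mem_orders (pastWord Z (topTime Z))
  have hd : ∀ o ∈ (pastRed Z (topTime Z)).orders, o ≠ Symb.flexOrder ∧
      o.disc = (topBurger Z).disc := fun o ho => disc_eq_of_not_fulfils (hO o ho) h1 (h3 o ho)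
  rw [(pastDisc_bounds Z _).2 (fun hf => (hd _ hf).1 rfl)]
  have hb : (pastRed Z (topTime Z)).burgers = [topBurger Z] := by rw [h2]
  rw [hb, topLength, RWord.length, RWord.toWord, hb,
    List.map_congr_left (fun o ho => (hd o ho).2)]
  simp; ring

theorem disc_mul_self {b : Symb} (h : b ≠ Symb.flexOrder) : b.disc * b.disc = 1 := by
  cases b <;> simp_all [Symb.disc]

theorem ne_flex_of_isBurger {b : Symb} (h : b.isBurger = true) : b ≠ Symb.flexOrder := by
  rintro rfl; simp [Symb.isBurger] at h

theorem incr_mul_self {Z : ℕ → Symb} (h : (topTimes (shift 1 Z)).Nonempty) :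
    incr Z * incr Z = 1 := by
  unfold incr; split_ifs with h0
  · rw [neg_mul_neg]; exact disc_mul_self (ne_flex_of_isBurger (pastRed_topTime h).1)
  · exact disc_mul_self h0

open ProbabilityTheory

/-! ### The law of the past -/

instance : DiscreteMeasurableSpace Symb := ⟨fun _ => trivial⟩

instance : Fintype Symb :=
  ⟨{.cheeseBurger, .hamBurger, .cheeseOrder, .hamOrder, .flexOrder}, by intro x; cases x <;> simp⟩

instance : MeasurableSpace (List Symb) := ⊤

instance : DiscreteMeasurableSpace (List Symb) := ⟨fun _ => trivial⟩

instance (p : unitInterval) : IsProbabilityMeasure (symbolLaw p) :=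
  isProbabilityMeasure_symbolLaw p.2.1 p.2.2

/-- The law of an i.i.d. sequence of symbols indexed by the natural numbers. -/
noncomputable def pastLaw (p : unitInterval) : Measure (ℕ → Symb) :=
  Measure.infinitePi fun _ => symbolLaw p

instance (p : unitInterval) : IsProbabilityMeasure (pastLaw p) := by
  unfold pastLaw; infer_instance

/-- The weights of the five symbols. -/
noncomputable def wt (p : ℝ) : Symb → ℝ
  | .cheeseBurger => 1 / 4
  | .hamBurger => 1 / 4
  | .cheeseOrder => (1 - p) / 4
  | .hamOrder => (1 - p) / 4
  | .flexOrder => p / 2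

theorem sum_symb (f : Symb → ℝ) : ∑ s, f s =
    f .cheeseBurger + f .hamBurger + f .cheeseOrder + f .hamOrder + f .flexOrder := by
  change Finset.sum {.cheeseBurger, .hamBurger, .cheeseOrder, .hamOrder, .flexOrder} f = _
  simp; ring

theorem wt_nonneg (p : unitInterval) (s : Symb) : 0 ≤ wt p s := by
  have h0 := p.2.1
  have h1 := p.2.2
  cases s <;> simp only [wt] <;> linarith

theorem symbolLaw_real_singleton (p : unitInterval) (s : Symb) :
    (symbolLaw p).real {s} = wt p s := by
  have h0 := p.2.1
  have h1 := p.2.2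
  have h2 : 0 ≤ (1 - (p : ℝ)) / 4 := by linarith
  have h3 : 0 ≤ (p : ℝ) / 2 := by linarith
  have h4 : (0 : ℝ) ≤ 1 / 4 := by norm_num
  cases s <;>
    simp [symbolLaw, wt, measureReal_def, h2, h3]

theorem measurable_shift (j : ℕ) : Measurable (shift j) :=
  measurable_pi_lambda _ fun i => measurable_pi_apply (i + j)

theorem measurePreserving_shift (p : unitInterval) (j : ℕ) :
    MeasurePreserving (shift j) (pastLaw p) (pastLaw p) := by
  refine ⟨measurable_shift j, ?_⟩
  exact Measure.map_infinitePi_infinitePi_of_inj (P := fun _ : ℕ => symbolLaw p)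
    (f := fun i : ℕ => i + j) (add_left_injective j)

/-- The two functions are measurable with respect to disjoint groups of independent coordinates, the
indices `< j` and those `≥ j`. -/
theorem indepFun_prefix_shift (p : unitInterval) (j : ℕ) :
    IndepFun (fun (Z : ℕ → Symb) (i : Fin j) => Z i) (shift j) (pastLaw p) := by
  have h : iIndepFun (fun (i : ℕ) (Z : ℕ → Symb) => Z i) (pastLaw p) :=
    iIndepFun_infinitePi (P := fun _ : ℕ => symbolLaw p) (X := fun _ x => x)
      (fun _ => measurable_id)
  rw [iIndepFun_iff_iIndep] at h
  have h2 := indep_iSup_of_disjoint (fun i => (measurable_pi_apply i).comap_le) h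
    (S := {i | i < j}) (T := {i | j ≤ i}) (by
      rw [Set.disjoint_left]; intro a ha hb; exact absurd (show a < j from ha) (not_lt.mpr hb))
  rw [IndepFun_iff_Indep]
  refine indep_of_indep_of_le_left (indep_of_indep_of_le_right h2 ?_) ?_
  · rw [← measurable_iff_comap_le]
    refine @measurable_pi_lambda _ _ _ (_) _ _ fun i => ?_
    have : Measurable[MeasurableSpace.comap (fun Z : ℕ → Symb => Z (i + j)) inferInstance]
        (fun Z : ℕ → Symb => Z (i + j)) := comap_measurable _
    exact this.mono (le_iSup₂_of_le (i + j) (by simp) le_rfl) le_rfl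
  · rw [← measurable_iff_comap_le]
    refine @measurable_pi_lambda _ _ _ (_) _ _ fun i => ?_
    have : Measurable[MeasurableSpace.comap (fun Z : ℕ → Symb => Z i) inferInstance]
        (fun Z : ℕ → Symb => Z i) := comap_measurable _
    exact this.mono (le_iSup₂_of_le (i : ℕ) i.2 le_rfl) le_rfl

/-- The word spelled by finitely many letters, in reverse order. -/
def finWord : (n : ℕ) → (Fin n → Symb) → List Symb
  | 0, _ => []
  | n + 1, u => u (Fin.last n) :: finWord n (fun i => u i.castSucc)

theorem finWord_restrict (Z : ℕ → Symb) (n : ℕ) : finWord n (fun i => Z i) = pastWord Z n := by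
  induction n with
  | zero => rfl
  | succ n ih => simp [finWord, pastWord, ih]

theorem measurable_pastWord (n : ℕ) : Measurable (fun Z => pastWord Z n) := by
  have h : (fun Z => pastWord Z n) = finWord n ∘ fun (Z : ℕ → Symb) (i : Fin n) => Z i := by
    funext Z; exact (finWord_restrict Z n).symm
  rw [h]
  exact (Measurable.of_discrete).comp (measurable_pi_lambda _ fun i => measurable_pi_apply _)

theorem measurable_of_pastWord {β : Type*} [MeasurableSpace β] (n : ℕ) (F : List Symb → β) :
    Measurable (fun Z => F (pastWord Z n)) :=
  (Measurable.of_discrete (f := F)).comp (measurable_pastWord n)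

theorem indepFun_pastWord_shift (p : unitInterval) (j : ℕ) :
    IndepFun (fun Z => pastWord Z j) (shift j) (pastLaw p) := by
  have h := (indepFun_prefix_shift p j).comp (φ := finWord j) (ψ := id)
    (Measurable.of_discrete) measurable_id
  convert h using 1
  · funext Z; exact (finWord_restrict Z j).symm
  · rfl

theorem exists_bound_pastWord (n : ℕ) (F : List Symb → ℝ) :
    ∃ C, ∀ Z : ℕ → Symb, |F (pastWord Z n)| ≤ C := by
  obtain ⟨C, hC⟩ := (Set.finite_range fun u => |F (finWord n u)|).bddAbove
  exact ⟨C, fun Z => by rw [← finWord_restrict Z n]; exact hC ⟨_, rfl⟩⟩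

theorem integrable_of_abs_le {p : unitInterval} {f : (ℕ → Symb) → ℝ} (hf : Measurable f) (C : ℝ)
    (h : ∀ Z, |f Z| ≤ C) : Integrable f (pastLaw p) :=
  Integrable.of_bound hf.aestronglyMeasurable C (Filter.Eventually.of_forall h)

theorem integrable_pastWord (p : unitInterval) (n : ℕ) (F : List Symb → ℝ) :
    Integrable (fun Z => F (pastWord Z n)) (pastLaw p) := by
  obtain ⟨C, hC⟩ := exists_bound_pastWord n F
  exact integrable_of_abs_le (measurable_of_pastWord n F) C hC

/-- Functions of the `j` most recent letters are independent of the earlier letters. -/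
theorem integral_pastWord_mul_shift (p : unitInterval) (j : ℕ) (F : List Symb → ℝ)
    {g : (ℕ → Symb) → ℝ} (hg : Measurable g) :
    ∫ Z, F (pastWord Z j) * g (shift j Z) ∂(pastLaw p)
      = (∫ Z, F (pastWord Z j) ∂(pastLaw p)) * ∫ Z, g Z ∂(pastLaw p) := by
  have h := (indepFun_pastWord_shift p j).integral_comp_mul_comp (f := F) (g := g)
    (measurable_pastWord j).aemeasurable (measurable_shift j).aemeasurable
    (Measurable.of_discrete).aestronglyMeasurable hg.aestronglyMeasurable
  simp only [Pi.mul_apply, Function.comp_def] at h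
  rw [h]
  congr 1
  have h2 := integral_map (μ := pastLaw p) (φ := shift j) (measurable_shift j).aemeasurable
    (f := g) hg.aestronglyMeasurable
  rw [(measurePreserving_shift p j).map_eq] at h2
  exact h2.symm

theorem integral_shift (p : unitInterval) (j : ℕ) {g : (ℕ → Symb) → ℝ} (hg : Measurable g) :
    ∫ Z, g (shift j Z) ∂(pastLaw p) = ∫ Z, g Z ∂(pastLaw p) := by
  have := integral_pastWord_mul_shift p j (fun _ => 1) hg
  simpa using this

theorem measurableSet_letter (n : ℕ) (s : Symb) : MeasurableSet {Z : ℕ → Symb | Z n = s} :=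
  (measurable_pi_apply n : Measurable fun Z : ℕ → Symb => Z n) (MeasurableSet.singleton s)

theorem integral_letter (p : unitInterval) (s : Symb) (n : ℕ) :
    ∫ Z, (if Z n = s then (1 : ℝ) else 0) ∂(pastLaw p) = wt p s := by
  have h1 := measurableSet_letter n s
  have h2 : (fun Z : ℕ → Symb => if Z n = s then (1 : ℝ) else 0)
      = Set.indicator {Z : ℕ → Symb | Z n = s} 1 := by
    funext Z; simp [Set.indicator]
  rw [h2, integral_indicator_one h1, ← symbolLaw_real_singleton]
  have h3 := measurePreserving_eval_infinitePi (fun _ : ℕ => symbolLaw p) n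
  have h4 := h3.measureReal_preimage (MeasurableSet.singleton s).nullMeasurableSet
  exact h4

/-- Conditioning on the earliest letter of a word. -/
theorem integral_pastWord_succ (p : unitInterval) (n : ℕ) (F : List Symb → ℝ) :
    ∫ Z, F (pastWord Z (n + 1)) ∂(pastLaw p)
      = ∫ Z, ∑ s, wt p s * F (s :: pastWord Z n) ∂(pastLaw p) := by
  have h1 : ∀ Z : ℕ → Symb, F (pastWord Z (n + 1)) =
      ∑ s, F (s :: pastWord Z n) * (fun Y : ℕ → Symb => if Y 0 = s then (1 : ℝ) else 0)
        (shift n Z) := by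
    intro Z; simp [pastWord, shift]
  have hm : ∀ s, Measurable (fun Y : ℕ → Symb => if Y 0 = s then (1 : ℝ) else 0) := fun s =>
    Measurable.ite (measurableSet_letter 0 s) measurable_const
      measurable_const
  simp_rw [h1]
  rw [integral_finsetSum, integral_finsetSum]
  · refine Finset.sum_congr rfl fun s _ => ?_
    rw [integral_pastWord_mul_shift p n (fun w => F (s :: w)) (hm s), integral_letter,
      integral_const_mul, mul_comm]
  · intro s _
    exact (integrable_pastWord p n fun w => F (s :: w)).const_mul _
  · intro s _
    obtain ⟨C, hC⟩ := exists_bound_pastWord n (fun w => F (s :: w))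
    refine integrable_of_abs_le ((measurable_of_pastWord n fun w => F (s :: w)).mul
      ((hm s).comp (measurable_shift n))) C fun Z => ?_
    have := hC Z
    rw [abs_mul]
    split_ifs
    · simpa using this
    · simpa using (abs_nonneg _).trans this

/-- Conditioning on the most recent letter. -/
theorem integral_first_letter (p : unitInterval) (F : Symb → (ℕ → Symb) → ℝ) (C : ℝ)
    (hF : ∀ s, Measurable (F s)) (hC : ∀ s Z, |F s Z| ≤ C) :
    ∫ Z, F (Z 0) (shift 1 Z) ∂(pastLaw p) = ∑ s, wt p s * ∫ Z, F s Z ∂(pastLaw p) := by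
  have h1 : ∀ Z : ℕ → Symb, F (Z 0) (shift 1 Z) =
      ∑ s, (fun w : List Symb => if w = [s] then (1 : ℝ) else 0) (pastWord Z 1)
        * F s (shift 1 Z) := by
    intro Z; simp [pastWord]
  simp_rw [h1]
  rw [integral_finsetSum]
  · refine Finset.sum_congr rfl fun s _ => ?_
    rw [integral_pastWord_mul_shift p 1 (fun w : List Symb => if w = [s] then (1 : ℝ) else 0)
      (hF s), ← integral_letter p s 0]
    simp [pastWord]
  · intro s _
    refine integrable_of_abs_le ((measurable_of_pastWord 1
      fun w : List Symb => if w = [s] then (1 : ℝ) else 0).mul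
      ((hF s).comp (measurable_shift 1))) C fun Z => ?_
    have := hC s (shift 1 Z)
    rw [abs_mul]
    split_ifs
    · simpa using this
    · simpa using (abs_nonneg _).trans this

/-! ### Measurability -/

theorem measurableSet_burgers_nil (n : ℕ) : MeasurableSet {Z | (pastRed Z n).burgers = []} :=
  measurable_pastWord n (MeasurableSet.of_discrete (s := {w | (reduce w).burgers = []}))

/-- Evaluation at a random time is measurable because the time takes countably many values. -/
theorem measurable_apply_nat {β : Type*} [MeasurableSpace β] {f : ℕ → (ℕ → Symb) → β}
    (hf : ∀ n, Measurable (f n)) {N : (ℕ → Symb) → ℕ} (hN : Measurable N) :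
    Measurable (fun Z => f (N Z) Z) := by
  have h : Measurable (fun x : (ℕ → Symb) × ℕ => f x.2 x.1) :=
    measurable_from_prod_countable_left hf
  exact h.comp (measurable_id.prodMk hN)

theorem topTime_eq_succ_iff (Z : ℕ → Symb) (n : ℕ) : topTime Z = n + 1 ↔
    (pastRed Z n).burgers = [] ∧ (pastRed Z (n + 1)).burgers ≠ [] := by
  constructor
  · intro h
    have hne : (topTimes Z).Nonempty := by
      by_contra hne
      rw [Set.not_nonempty_iff_eq_empty] at hne
      simp [topTime, hne] at h
    rw [Ne, burgers_eq_nil_iff hne, burgers_eq_nil_iff hne]; omega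
  · rintro ⟨h0, h1⟩
    have hne : (topTimes Z).Nonempty := ⟨_, mem_topTimes.mpr h1⟩
    rw [burgers_eq_nil_iff hne] at h0
    rw [Ne, burgers_eq_nil_iff hne] at h1
    omega

theorem measurableSet_topTime_eq_succ (n : ℕ) : MeasurableSet {Z | topTime Z = n + 1} := by
  simp_rw [topTime_eq_succ_iff]
  exact (measurableSet_burgers_nil n).inter (measurableSet_burgers_nil (n + 1)).compl

theorem measurable_topTime : Measurable topTime := by
  have hs : ∀ n, MeasurableSet (topTime ⁻¹' {n + 1}) := measurableSet_topTime_eq_succ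
  refine measurable_to_countable' fun n => ?_
  cases n with
  | succ n => exact hs n
  | zero =>
    have : topTime ⁻¹' {0} = (⋃ n, topTime ⁻¹' {n + 1})ᶜ := by
      ext Z
      simp only [Set.mem_preimage, Set.mem_singleton_iff, Set.mem_compl_iff, Set.mem_iUnion,
        not_exists]
      constructor
      · intro h n; omega
      · intro h
        by_contra h0
        exact h (topTime Z - 1) (by omega)
    rw [this]
    exact (MeasurableSet.iUnion hs).compl

theorem measurable_topBurger : Measurable topBurger :=
  measurable_apply_nat (f := fun n Z => Z (n - 1)) (fun n => measurable_pi_apply (n - 1))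
    measurable_topTime

theorem measurable_topLength : Measurable topLength :=
  measurable_apply_nat (f := fun n Z => (pastRed Z n).length)
    (fun n => measurable_of_pastWord n fun w => (reduce w).length) measurable_topTime

theorem measurable_incr : Measurable incr := by
  refine Measurable.ite (measurableSet_letter 0 _) ?_ ?_
  · exact (Measurable.of_discrete (f := fun s : Symb => -s.disc)).comp
      (measurable_topBurger.comp (measurable_shift 1))
  · exact (Measurable.of_discrete (f := Symb.disc)).comp (measurable_pi_apply 0)

theorem measurable_pastDisc (n : ℕ) : Measurable (fun Z => pastDisc Z n) :=
  Finset.measurable_sum _ fun k _ => measurable_incr.comp (measurable_shift k)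

theorem measurable_pastDisc_real (n : ℕ) : Measurable (fun Z => (pastDisc Z n : ℝ)) :=
  (Measurable.of_discrete (f := fun k : ℤ => (k : ℝ))).comp (measurable_pastDisc n)

theorem measurable_pastCount (n : ℕ) : Measurable (fun Z => pastCount Z n) :=
  Finset.measurable_sum _ fun k _ =>
    (Measurable.of_discrete (f := Symb.step)).comp (measurable_pi_apply k)

theorem measurable_pastCount_real (n : ℕ) : Measurable (fun Z => (pastCount Z n : ℝ)) :=
  (Measurable.of_discrete (f := fun k : ℤ => (k : ℝ))).comp (measurable_pastCount n)

/-! ### Symmetry -/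

/-- Exchange of the two kinds of burgers. -/
def Symb.flip : Symb → Symb
  | .cheeseBurger => .hamBurger
  | .hamBurger => .cheeseBurger
  | .cheeseOrder => .hamOrder
  | .hamOrder => .cheeseOrder
  | .flexOrder => .flexOrder

theorem disc_flip (s : Symb) : s.flip.disc = -s.disc := by cases s <;> simp [Symb.flip, Symb.disc]

theorem isBurger_flip (s : Symb) : s.flip.isBurger = s.isBurger := by cases s <;> rfl

theorem fulfils_flip (s b : Symb) : s.flip.fulfils b.flip = s.fulfils b := by
  cases s <;> cases b <;> rfl

theorem eraseP_map_flip (s : Symb) (B : List Symb) :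
    (B.map Symb.flip).eraseP s.flip.fulfils = (B.eraseP s.fulfils).map Symb.flip := by
  rw [List.eraseP_map]
  congr 2
  funext b
  simp [fulfils_flip]

theorem push_flip (R : RWord) (s : Symb) :
    RWord.push ⟨R.orders.map Symb.flip, R.burgers.map Symb.flip⟩ s.flip
      = ⟨(R.push s).orders.map Symb.flip, (R.push s).burgers.map Symb.flip⟩ := by
  have ha : (R.burgers.map Symb.flip).any s.flip.fulfils = R.burgers.any s.fulfils := by
    rw [List.any_map]; congr 1; funext b; simp [fulfils_flip]
  cases hs : s.isBurger with
  | true => rw [push_burger (by rwa [isBurger_flip]), push_burger hs]; simp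
  | false =>
    have hs' : s.flip.isBurger = false := by rwa [isBurger_flip]
    cases h : R.burgers.any s.fulfils with
    | true =>
      rw [push_order_of_any hs' (by rw [ha, h]), push_order_of_any hs h, eraseP_map_flip]
    | false =>
      rw [push_order_of_not_any hs' (by rw [ha, h]), push_order_of_not_any hs h]; simp

theorem reduce_map_flip (w : List Symb) : reduce (w.map Symb.flip) =
    ⟨(reduce w).orders.map Symb.flip, (reduce w).burgers.map Symb.flip⟩ := by
  induction w using List.reverseRecOn with
  | nil => simp [reduce]
  | append_singleton w s ih =>
    rw [List.map_append, List.map_singleton, reduce_concat, ih, push_flip, reduce_concat]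

/-- Exchange of the two kinds of burgers, in a sequence. -/
def flipSeq (Z : ℕ → Symb) : ℕ → Symb := fun i => (Z i).flip

theorem pastWord_flip (Z : ℕ → Symb) (n : ℕ) :
    pastWord (flipSeq Z) n = (pastWord Z n).map Symb.flip := by
  induction n with
  | zero => rfl
  | succ n ih => simp [pastWord, ih, flipSeq]

theorem topTime_flip (Z : ℕ → Symb) : topTime (flipSeq Z) = topTime Z := by
  simp [topTime, topTimes, pastRed, pastWord_flip, reduce_map_flip]

theorem topBurger_flip (Z : ℕ → Symb) : topBurger (flipSeq Z) = (topBurger Z).flip := by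
  rw [topBurger, topTime_flip]; rfl

theorem incr_flip (Z : ℕ → Symb) : incr (flipSeq Z) = -incr Z := by
  have h : flipSeq Z 0 = Symb.flexOrder ↔ Z 0 = Symb.flexOrder := by
    unfold flipSeq; cases Z 0 <;> simp [Symb.flip]
  have h2 : shift 1 (flipSeq Z) = flipSeq (shift 1 Z) := rfl
  unfold incr
  simp only [h, h2, topBurger_flip, disc_flip]
  split_ifs
  · rfl
  · exact disc_flip _

theorem pastDisc_flip (Z : ℕ → Symb) (n : ℕ) : pastDisc (flipSeq Z) n = -pastDisc Z n := by
  unfold pastDisc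
  rw [← Finset.sum_neg_distrib]
  exact Finset.sum_congr rfl fun k _ => incr_flip (shift k Z)

theorem map_flip_symbolLaw (p : unitInterval) : (symbolLaw p).map Symb.flip = symbolLaw p := by
  have h : Measurable Symb.flip := Measurable.of_discrete
  simp only [symbolLaw, Measure.map_add _ _ h, Measure.map_smul, Measure.map_dirac' h, Symb.flip]
  abel

theorem measurable_flipSeq : Measurable flipSeq :=
  measurable_pi_lambda _ fun i => (Measurable.of_discrete (f := Symb.flip)).comp
    (measurable_pi_apply i)

theorem map_flipSeq (p : unitInterval) : (pastLaw p).map flipSeq = pastLaw p := by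
  have h := Measure.infinitePi_map_pi (μ := fun _ : ℕ => symbolLaw p) (f := fun _ => Symb.flip)
    (fun _ => Measurable.of_discrete)
  simp only [map_flip_symbolLaw] at h
  exact h

/-- The law of the past is invariant under exchanging the foods, so odd functionals have mean zero.
-/
theorem integral_eq_zero_of_flip (p : unitInterval) {f : (ℕ → Symb) → ℝ} (hf : Measurable f)
    (h : ∀ Z, f (flipSeq Z) = -f Z) : ∫ Z, f Z ∂(pastLaw p) = 0 := by
  have h2 := integral_map (μ := pastLaw p) measurable_flipSeq.aemeasurable
    (f := f) hf.aestronglyMeasurable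
  rw [map_flipSeq] at h2
  simp_rw [h, integral_neg] at h2
  linarith

open ProbabilityTheory Filter Topology

/-! ### Moments of the killed random walk -/

/-- Number of burgers minus number of orders of a word. -/
def wordCount (w : List Symb) : ℤ := (w.map Symb.step).sum

theorem wordCount_cons (s : Symb) (w : List Symb) : wordCount (s :: w) = s.step + wordCount w := by
  simp [wordCount]

theorem wordCount_pastWord (Z : ℕ → Symb) (n : ℕ) : wordCount (pastWord Z n) = pastCount Z n :=
  (pastCount_eq_sum Z n).symm

theorem sum_wt_step (p : ℝ) (f : ℤ → ℝ) :
    ∑ s, wt p s * f s.step = (f 1 + f (-1)) / 2 := by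
  rw [sum_symb]; simp only [wt, Symb.step, Symb.isBurger]; simp; ring

/-- An alive walk is at most `0`, hence at most `1` after one step, where `f ≥ 0`: killing can only
decrease the expectation, and without killing the step averages `f` over its two neighbours. -/
theorem integral_killed_succ_le (p : unitInterval) {alive : List Symb → Prop} [DecidablePred alive]
    (hmono : ∀ s w, alive (s :: w) → alive w) (hneg : ∀ w, alive w → wordCount w ≤ 0)
    {f : ℤ → ℝ} (hf : ∀ x ≤ 1, 0 ≤ f x) (n : ℕ) :
    ∫ Z, (if alive (pastWord Z (n + 1)) then f (wordCount (pastWord Z (n + 1))) else 0)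
        ∂(pastLaw p) ≤
      ∫ Z, (if alive (pastWord Z n) then (f (wordCount (pastWord Z n) + 1)
        + f (wordCount (pastWord Z n) - 1)) / 2 else 0) ∂(pastLaw p) := by
  rw [integral_pastWord_succ p n (fun w => if alive w then f (wordCount w) else 0)]
  refine integral_mono (integrable_pastWord p n fun w => ∑ s, wt p s *
      (if alive (s :: w) then f (wordCount (s :: w)) else 0))
    (integrable_pastWord p n fun w => if alive w then (f (wordCount w + 1)
        + f (wordCount w - 1)) / 2 else 0) fun Z => ?_
  dsimp only
  generalize pastWord Z n = w
  by_cases hw : alive w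
  · rw [if_pos hw]
    have h := sum_wt_step p (fun x => f (x + wordCount w))
    rw [show wordCount w + 1 = 1 + wordCount w by ring,
      show wordCount w - 1 = -1 + wordCount w by ring, ← h]
    refine Finset.sum_le_sum fun s _ => mul_le_mul_of_nonneg_left ?_ (wt_nonneg p s)
    rw [wordCount_cons]
    split_ifs
    · exact le_rfl
    · apply hf
      have := hneg w hw
      unfold Symb.step; split_ifs <;> linarith
  · rw [if_neg hw]
    refine (Finset.sum_eq_zero fun s _ => ?_).le
    rw [if_neg fun h => hw (hmono s w h), mul_zero]

/-- The function `1 - x` is harmonic for the walk and nonnegative up to `1`, so the killed process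
is a supermartingale started at most at `1`. -/
theorem integral_killed_one_le (p : unitInterval) {alive : List Symb → Prop} [DecidablePred alive]
    (hmono : ∀ s w, alive (s :: w) → alive w) (hneg : ∀ w, alive w → wordCount w ≤ 0) (n : ℕ) :
    ∫ Z, (if alive (pastWord Z n) then (1 - wordCount (pastWord Z n) : ℝ) else 0)
        ∂(pastLaw p) ≤ 1 := by
  induction n with
  | zero =>
    by_cases h : alive [] <;> simp [pastWord, wordCount, h]
  | succ n ih =>
    refine le_trans ?_ ih
    refine (integral_killed_succ_le p hmono hneg (f := fun x => 1 - (x : ℝ)) ?_ n).trans ?_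
    · intro x hx
      have : (x : ℝ) ≤ 1 := by exact_mod_cast hx
      linarith
    · refine le_of_eq (integral_congr_ae (Eventually.of_forall fun Z => ?_))
      dsimp only
      split_ifs
      · push_cast; ring
      · rfl

/-- Averaging `y ^ 3` over `y ± 1` gives `y ^ 3 + 3 y`; the extra term has expectation at most `3`
by `integral_killed_one_le`. -/
theorem integral_killed_cube_le (p : unitInterval) {alive : List Symb → Prop} [DecidablePred alive]
    (hmono : ∀ s w, alive (s :: w) → alive w) (hneg : ∀ w, alive w → wordCount w ≤ 0) (n : ℕ) :
    ∫ Z, (if alive (pastWord Z n) then (1 - wordCount (pastWord Z n) : ℝ) ^ 3 else 0)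
        ∂(pastLaw p) ≤ 1 + 3 * n := by
  induction n with
  | zero =>
    by_cases h : alive [] <;> simp [pastWord, wordCount, h]
  | succ n ih =>
    refine (integral_killed_succ_le p hmono hneg (f := fun x => (1 - (x : ℝ)) ^ 3) ?_ n).trans ?_
    · intro x hx
      have : (x : ℝ) ≤ 1 := by exact_mod_cast hx
      have : 0 ≤ 1 - (x : ℝ) := by linarith
      positivity
    · have h1 := integral_killed_one_le p hmono hneg n
      have h2 : ∫ Z, (if alive (pastWord Z n) then ((fun x : ℤ => (1 - (x : ℝ)) ^ 3)
            (wordCount (pastWord Z n) + 1) + (fun x : ℤ => (1 - (x : ℝ)) ^ 3)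
            (wordCount (pastWord Z n) - 1)) / 2 else 0) ∂(pastLaw p)
          = ∫ Z, ((if alive (pastWord Z n) then (1 - wordCount (pastWord Z n) : ℝ) ^ 3 else 0)
            + 3 * (if alive (pastWord Z n) then (1 - wordCount (pastWord Z n) : ℝ) else 0))
            ∂(pastLaw p) := by
        refine integral_congr_ae (Eventually.of_forall fun Z => ?_)
        dsimp only
        split_ifs
        · push_cast; ring
        · simp
      rw [h2, integral_add (integrable_pastWord p n fun w => if alive w then
          (1 - wordCount w : ℝ) ^ 3 else 0) ((integrable_pastWord p n fun w => if alive w then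
          (1 - wordCount w : ℝ) else 0).const_mul 3), integral_const_mul]
      push_cast
      linarith

/-- Interpolation between the first and third moments: `x ^ 2 ≤ r x / 2 + x ^ 3 / (2 r)` for `x ≥
0`, with `r = √n`. Killing is what reduces the order from `n` to `√n`. -/
theorem integral_killed_sq_le (p : unitInterval) {alive : List Symb → Prop} [DecidablePred alive]
    (hmono : ∀ s w, alive (s :: w) → alive w) (hneg : ∀ w, alive w → wordCount w ≤ 0)
    {n : ℕ} (hn : 0 < n) :
    ∫ Z, (if alive (pastWord Z n) then (1 - wordCount (pastWord Z n) : ℝ) ^ 2 else 0)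
        ∂(pastLaw p) ≤ 5 / 2 * Real.sqrt n := by
  have hr : 0 < Real.sqrt n := Real.sqrt_pos.mpr (by exact_mod_cast hn)
  have hrr : Real.sqrt n * Real.sqrt n = n := Real.mul_self_sqrt (by positivity)
  set r := Real.sqrt n
  have h1 := integral_killed_one_le p hmono hneg n
  have h3 := integral_killed_cube_le p hmono hneg n
  have h2 : ∫ Z, (if alive (pastWord Z n) then (1 - wordCount (pastWord Z n) : ℝ) ^ 2 else 0)
        ∂(pastLaw p) ≤ ∫ Z, (r / 2 * (if alive (pastWord Z n) then
          (1 - wordCount (pastWord Z n) : ℝ) else 0) + 1 / (2 * r) *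
          (if alive (pastWord Z n) then (1 - wordCount (pastWord Z n) : ℝ) ^ 3 else 0))
          ∂(pastLaw p) := by
    refine integral_mono (integrable_pastWord p n fun w => if alive w then
        (1 - wordCount w : ℝ) ^ 2 else 0)
      (((integrable_pastWord p n fun w => if alive w then (1 - wordCount w : ℝ) else 0).const_mul
        _).add ((integrable_pastWord p n fun w => if alive w then
        (1 - wordCount w : ℝ) ^ 3 else 0).const_mul _)) fun Z => ?_
    dsimp only
    split_ifs with h
    · have hx : 0 ≤ (1 - wordCount (pastWord Z n) : ℝ) := by
        have : (wordCount (pastWord Z n) : ℝ) ≤ 0 := by exact_mod_cast hneg _ h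
        linarith
      set x := (1 - wordCount (pastWord Z n) : ℝ)
      have h4 : r / 2 * x + 1 / (2 * r) * x ^ 3 - x ^ 2 = x * (x - r) ^ 2 / (2 * r) := by
        field_simp; ring
      have h5 : 0 ≤ x * (x - r) ^ 2 / (2 * r) := by positivity
      linarith
    · simp
  rw [integral_add ((integrable_pastWord p n fun w => if alive w then
      (1 - wordCount w : ℝ) else 0).const_mul _) ((integrable_pastWord p n fun w => if alive w then
        (1 - wordCount w : ℝ) ^ 3 else 0).const_mul _), integral_const_mul,
    integral_const_mul] at h2
  have hn1 : (1 : ℝ) ≤ n := by exact_mod_cast hn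
  have h6 : 1 / (2 * r) * (1 + 3 * n) ≤ 2 * r := by
    rw [div_mul_eq_mul_div, div_le_iff₀ (by positivity)]; nlinarith
  have h7 := mul_le_mul_of_nonneg_left h3 (by positivity : 0 ≤ 1 / (2 * r))
  have h8 := mul_le_mul_of_nonneg_left h1 (by positivity : 0 ≤ r / 2)
  linarith

/-- The counts of all suffixes of the word are nonpositive. -/
def SuffixNonpos : List Symb → Prop
  | [] => True
  | s :: w => SuffixNonpos w ∧ wordCount (s :: w) ≤ 0

theorem SuffixNonpos.count {w : List Symb} (h : SuffixNonpos w) : wordCount w ≤ 0 := by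
  cases w with
  | nil => simp [wordCount]
  | cons s w => exact h.2

/-- If the word leaves no burger, neither does any suffix, so the walk has stayed nonpositive all
along. The latter event depends on the walk alone. -/
theorem suffixNonpos_of_burgers_nil {w : List Symb} (h : (reduce w).burgers = []) :
    SuffixNonpos w := by
  induction w with
  | nil => trivial
  | cons s w ih =>
    have h' := reduce_append [s] w
    refine ⟨ih ?_, ?_⟩
    · rw [← List.singleton_append, h'] at h
      exact (List.append_eq_nil_iff.mp h).1
    · rw [wordCount, ← length_burgers_sub_length_orders, h]; simp

-- This event kills the walk exactly when it reaches `1`, where `x ^ 2 - 1` vanishes. Hence killing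
-- costs nothing for that function, and `H n + 1 - P n` is the sum of the `P k` with `k < n`. As `P`
-- decreases, this sum is at least `n * P n`, whereas `H n` is of order `√n` by
-- `integral_killed_sq_le`.
open Classical in
theorem integral_suffixNonpos_le (p : unitInterval) {n : ℕ} (hn : 0 < n) :
    ∫ Z, (if SuffixNonpos (pastWord Z n) then (1 : ℝ) else 0) ∂(pastLaw p)
      ≤ 4 / Real.sqrt n := by
  set P : ℕ → ℝ := fun n => ∫ Z, (if SuffixNonpos (pastWord Z n) then (1 : ℝ) else 0) ∂(pastLaw p)
    with hP
  set H : ℕ → ℝ := fun n => ∫ Z, (if SuffixNonpos (pastWord Z n) then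
    (wordCount (pastWord Z n) : ℝ) ^ 2 else 0) ∂(pastLaw p) with hH
  have hmono : ∀ s w, SuffixNonpos (s :: w) → SuffixNonpos w := fun s w h => h.1
  have hI : ∀ (n : ℕ) (f : List Symb → ℝ), Integrable (fun Z =>
      if SuffixNonpos (pastWord Z n) then f (pastWord Z n) else 0) (pastLaw p) := fun n f =>
    integrable_pastWord p n fun w => if SuffixNonpos w then f w else 0
  have hstep : ∀ n, H (n + 1) + P n - P (n + 1) = H n + P n := by
    intro n
    have e1 : H (n + 1) - P (n + 1) = ∫ Z, ∑ s, wt p s * (if SuffixNonpos (s :: pastWord Z n) then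
        (wordCount (s :: pastWord Z n) : ℝ) ^ 2 - 1 else 0) ∂(pastLaw p) := by
      rw [← integral_pastWord_succ p n
        (fun w => if SuffixNonpos w then (wordCount w : ℝ) ^ 2 - 1 else 0), hH, hP]
      dsimp only
      rw [← integral_sub (hI (n + 1) fun w => (wordCount w : ℝ) ^ 2) (hI (n + 1) fun _ => 1)]
      refine integral_congr_ae (Eventually.of_forall fun Z => ?_)
      dsimp only
      split_ifs <;> simp
    have e2 : ∀ w : List Symb, ∑ s, wt p s * (if SuffixNonpos (s :: w) then
        (wordCount (s :: w) : ℝ) ^ 2 - 1 else 0)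
        = if SuffixNonpos w then (wordCount w : ℝ) ^ 2 else 0 := by
      intro w
      by_cases hw : SuffixNonpos w
      · have h := sum_wt_step p (fun x => ((x : ℝ) + wordCount w) ^ 2 - 1)
        rw [if_pos hw]
        have e3 : ∑ s, wt p s * (if SuffixNonpos (s :: w) then
            (wordCount (s :: w) : ℝ) ^ 2 - 1 else 0)
            = ∑ s, wt p s * (((s.step : ℝ) + wordCount w) ^ 2 - 1) := by
          refine Finset.sum_congr rfl fun s _ => ?_
          congr 1
          split_ifs with h1
          · rw [wordCount_cons]; push_cast; ring
          · have h2 : ¬ wordCount (s :: w) ≤ 0 := fun h2 => h1 ⟨hw, h2⟩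
            have h3 := hw.count
            rw [wordCount_cons] at h2
            have h4 : s.step + wordCount w = 1 := by
              unfold Symb.step at h2 ⊢; split_ifs at h2 ⊢ <;> omega
            have h5 : (s.step : ℝ) + wordCount w = 1 := by exact_mod_cast h4
            rw [h5]; ring
        rw [e3, h]; push_cast; ring
      · rw [if_neg hw]
        refine Finset.sum_eq_zero fun s _ => ?_
        rw [if_neg fun h => hw h.1, mul_zero]
    have e4 : H (n + 1) - P (n + 1) = H n := by
      rw [e1]; exact integral_congr_ae (Eventually.of_forall fun Z => e2 _)
    linarith
  have h0 : H 0 = 0 ∧ P 0 = 1 := by simp [hH, hP, pastWord, SuffixNonpos, wordCount]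
  have hsum : ∀ n, H n + 1 - P n = ∑ k ∈ Finset.range n, P k := by
    intro n
    induction n with
    | zero => simp [h0]
    | succ n ih => rw [Finset.sum_range_succ, ← ih]; linarith [hstep n]
  have hanti : ∀ n, P (n + 1) ≤ P n := by
    intro n
    refine integral_mono (hI (n + 1) fun _ => 1) (hI n fun _ => 1) fun Z => ?_
    dsimp only
    have : SuffixNonpos (pastWord Z (n + 1)) → SuffixNonpos (pastWord Z n) := fun h => h.1
    split_ifs with h1 h2
    · exact le_rfl
    · exact absurd (this h1) h2
    · exact zero_le_one
    · exact le_rfl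
  have hanti' : Antitone P := antitone_nat_of_succ_le hanti
  have hlow : (n : ℝ) * P n ≤ H n + 1 - P n := by
    rw [hsum]
    have : ∑ _k ∈ Finset.range n, P n ≤ ∑ k ∈ Finset.range n, P k :=
      Finset.sum_le_sum fun k hk => hanti' (Finset.mem_range.mp hk).le
    simpa using this
  have hHle : H n ≤ 5 / 2 * Real.sqrt n := by
    refine le_trans ?_ (integral_killed_sq_le p hmono (fun w h => h.count) hn)
    refine integral_mono (hI n fun w => (wordCount w : ℝ) ^ 2)
      (hI n fun w => (1 - wordCount w : ℝ) ^ 2) fun Z => ?_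
    dsimp only
    split_ifs with h
    · have : (wordCount (pastWord Z n) : ℝ) ≤ 0 := by exact_mod_cast h.count
      nlinarith
    · exact le_rfl
  have hPn : 0 ≤ P n := integral_nonneg fun Z => by dsimp only; split_ifs <;> norm_num
  have hn1 : (1 : ℝ) ≤ n := by exact_mod_cast hn
  have hr1 : 1 ≤ Real.sqrt n := Real.one_le_sqrt.mpr hn1
  have hrr : Real.sqrt n * Real.sqrt n = n := Real.mul_self_sqrt (by positivity)
  change P n ≤ _
  rw [le_div_iff₀ (by linarith)]
  have : Real.sqrt n * (P n * Real.sqrt n) ≤ Real.sqrt n * 4 := by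
    calc Real.sqrt n * (P n * Real.sqrt n) = Real.sqrt n * Real.sqrt n * P n := by ring
      _ = n * P n := by rw [hrr]
      _ ≤ _ := by linarith
  exact le_of_mul_le_mul_left this (by linarith)

/-! ### Moments on the event that the past contains no burger -/

theorem burgers_nil_of_cons {s : Symb} {w : List Symb} (h : (reduce (s :: w)).burgers = []) :
    (reduce w).burgers = [] := by
  rw [← List.singleton_append, reduce_append] at h
  exact (List.append_eq_nil_iff.mp h).1

theorem wordCount_nonpos_of_burgers_nil {w : List Symb} (h : (reduce w).burgers = []) :
    wordCount w ≤ 0 := by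
  rw [wordCount, ← length_burgers_sub_length_orders, h]; simp

theorem integrable_ite_burgers_nil (p : unitInterval) (n : ℕ) (f : List Symb → ℝ) :
    Integrable (fun Z => if (pastRed Z n).burgers = [] then f (pastWord Z n) else 0)
      (pastLaw p) :=
  integrable_pastWord p n fun w => if (reduce w).burgers = [] then f w else 0

/-- The probability that the `n` most recent letters leave no burger. -/
noncomputable def probNil (p : unitInterval) (n : ℕ) : ℝ :=
  ∫ Z, (if (pastRed Z n).burgers = [] then (1 : ℝ) else 0) ∂(pastLaw p)

theorem probNil_nonneg (p : unitInterval) (n : ℕ) : 0 ≤ probNil p n :=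
  integral_nonneg fun Z => by dsimp only; split_ifs <;> norm_num

theorem probNil_le (p : unitInterval) {n : ℕ} (hn : 0 < n) : probNil p n ≤ 4 / Real.sqrt n := by
  classical
  refine le_trans ?_ (integral_suffixNonpos_le p hn)
  refine integral_mono (integrable_ite_burgers_nil p n fun _ => 1)
    (integrable_pastWord p n fun w => if SuffixNonpos w then 1 else 0) fun Z => ?_
  dsimp only
  split_ifs with h1 h2
  · exact le_rfl
  · exact absurd (suffixNonpos_of_burgers_nil h1) h2
  · exact zero_le_one
  · exact le_rfl

/-- The expected number of orders on the event that the `n` most recent letters leave no burger. -/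
noncomputable def meanNil (p : unitInterval) (n : ℕ) : ℝ :=
  ∫ Z, (if (pastRed Z n).burgers = [] then -(pastCount Z n : ℝ) else 0) ∂(pastLaw p)

theorem integrable_meanNil (p : unitInterval) (n : ℕ) :
    Integrable (fun Z => if (pastRed Z n).burgers = [] then -(pastCount Z n : ℝ) else 0)
      (pastLaw p) := by
  simp_rw [← wordCount_pastWord]
  exact integrable_ite_burgers_nil p n fun w => -(wordCount w : ℝ)

theorem meanNil_nonneg (p : unitInterval) (n : ℕ) : 0 ≤ meanNil p n := by
  refine integral_nonneg fun Z => ?_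
  dsimp only
  split_ifs with h
  · have : (pastCount Z n : ℝ) ≤ 0 := by exact_mod_cast pastCount_nonpos_of_burgers_nil h
    simpa using this
  · exact le_rfl

theorem probNil_add_meanNil_le (p : unitInterval) (n : ℕ) : probNil p n + meanNil p n ≤ 1 := by
  classical
  have h := integral_killed_one_le p (alive := fun w => (reduce w).burgers = [])
    (fun s w => burgers_nil_of_cons) (fun w => wordCount_nonpos_of_burgers_nil) n
  rw [probNil, meanNil, ← integral_add (integrable_ite_burgers_nil p n fun _ => 1)
    (integrable_meanNil p n)]
  refine le_trans (le_of_eq (integral_congr_ae (Eventually.of_forall fun Z => ?_))) h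
  by_cases h : (pastRed Z n).burgers = []
  · have h' : (reduce (pastWord Z n)).burgers = [] := h
    simp only [if_pos h, if_pos h', wordCount_pastWord]; ring
  · have h' : ¬ (reduce (pastWord Z n)).burgers = [] := h
    simp only [if_neg h, if_neg h']; ring

theorem integral_sq_nil_le (p : unitInterval) {n : ℕ} (hn : 0 < n) :
    ∫ Z, (if (pastRed Z n).burgers = [] then (pastCount Z n : ℝ) ^ 2 else 0) ∂(pastLaw p)
      ≤ 5 / 2 * Real.sqrt n := by
  classical
  have h := integral_killed_sq_le p (alive := fun w => (reduce w).burgers = [])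
    (fun s w => burgers_nil_of_cons) (fun w => wordCount_nonpos_of_burgers_nil) hn
  refine le_trans ?_ h
  simp_rw [← wordCount_pastWord]
  refine integral_mono (integrable_ite_burgers_nil p n fun w => (wordCount w : ℝ) ^ 2)
      (integrable_pastWord p n fun w => if (reduce w).burgers = [] then
        (1 - wordCount w : ℝ) ^ 2 else 0) fun Z => ?_
  by_cases h : (pastRed Z n).burgers = []
  · have h' : (reduce (pastWord Z n)).burgers = [] := h
    have : (wordCount (pastWord Z n) : ℝ) ≤ 0 := by
      exact_mod_cast wordCount_nonpos_of_burgers_nil h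
    simp only [if_pos h, if_pos h']
    nlinarith
  · have h' : ¬ (reduce (pastWord Z n)).burgers = [] := h
    simp only [if_neg h, if_neg h']; exact le_rfl

theorem integral_cube_nil_le (p : unitInterval) (n : ℕ) :
    ∫ Z, (if (pastRed Z n).burgers = [] then (-(pastCount Z n : ℝ)) ^ 3 else 0) ∂(pastLaw p)
      ≤ 1 + 3 * n := by
  classical
  have h := integral_killed_cube_le p (alive := fun w => (reduce w).burgers = [])
    (fun s w => burgers_nil_of_cons) (fun w => wordCount_nonpos_of_burgers_nil) n
  refine le_trans ?_ h
  simp_rw [← wordCount_pastWord]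
  refine integral_mono (integrable_ite_burgers_nil p n fun w => (-(wordCount w : ℝ)) ^ 3)
      (integrable_pastWord p n fun w => if (reduce w).burgers = [] then
        (1 - wordCount w : ℝ) ^ 3 else 0) fun Z => ?_
  by_cases h : (pastRed Z n).burgers = []
  · have h' : (reduce (pastWord Z n)).burgers = [] := h
    have : (wordCount (pastWord Z n) : ℝ) ≤ 0 := by
      exact_mod_cast wordCount_nonpos_of_burgers_nil h
    simp only [if_pos h, if_pos h']
    exact pow_le_pow_left₀ (by linarith) (by linarith) 3
  · have h' : ¬ (reduce (pastWord Z n)).burgers = [] := h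
    simp only [if_neg h, if_neg h']; exact le_rfl

theorem tendsto_four_div_sqrt : Tendsto (fun n : ℕ => 4 / Real.sqrt n) atTop (𝓝 0) :=
  Tendsto.div_atTop tendsto_const_nhds
    (Real.tendsto_sqrt_atTop.comp tendsto_natCast_atTop_atTop)

theorem tendsto_probNil (p : unitInterval) : Tendsto (probNil p) atTop (𝓝 0) := by
  refine tendsto_of_tendsto_of_tendsto_of_le_of_le' tendsto_const_nhds tendsto_four_div_sqrt
    (Eventually.of_forall (probNil_nonneg p)) ?_
  filter_upwards [eventually_gt_atTop 0] with n hn using probNil_le p hn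

theorem probNil_eq_measureReal (p : unitInterval) (n : ℕ) :
    probNil p n = (pastLaw p).real {Z | (pastRed Z n).burgers = []} := by
  rw [← integral_indicator_one (measurableSet_burgers_nil n)]
  refine integral_congr_ae (Eventually.of_forall fun Z => ?_)
  simp [Set.indicator]

/-- Almost surely the past contains a burger. -/
theorem ae_topTimes_nonempty (p : unitInterval) : ∀ᵐ Z ∂(pastLaw p), (topTimes Z).Nonempty := by
  rw [ae_iff]
  have hle : ∀ n, (pastLaw p).real {Z | ¬ (topTimes Z).Nonempty} ≤ probNil p n := by
    intro n
    rw [probNil_eq_measureReal]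
    refine measureReal_mono ?_
    intro Z hZ
    by_contra h
    exact hZ ⟨n, mem_topTimes.mpr h⟩
  have h0 : (pastLaw p).real {Z | ¬ (topTimes Z).Nonempty} ≤ 0 :=
    ge_of_tendsto' (tendsto_probNil p) hle
  exact (measureReal_eq_zero_iff).mp (le_antisymm h0 measureReal_nonneg)

/-- Almost surely every past contains a burger. -/
theorem ae_forall_topTimes_nonempty (p : unitInterval) :
    ∀ᵐ Z ∂(pastLaw p), ∀ k, (topTimes (shift k Z)).Nonempty :=
  ae_all_iff.mpr fun k =>
    (measurePreserving_shift p k).quasiMeasurePreserving.ae (ae_topTimes_nonempty p)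

/-! ### The expected length of the first word with a burger -/

/-- The contribution to the expected length of the event that a burger is found by time `n`. -/
noncomputable def truncLength (p : unitInterval) (n : ℕ) : ℝ :=
  ∫ Z, (if (pastRed Z n).burgers = [] then 0 else (topLength Z : ℝ)) ∂(pastLaw p)

theorem topTime_eq_of_first {Z : ℕ → Symb} {n : ℕ} (h0 : (pastRed Z n).burgers = [])
    (h1 : (pastRed Z (n + 1)).burgers ≠ []) : topTime Z = n + 1 :=
  (topTime_eq_succ_iff Z n).mpr ⟨h0, h1⟩

/-- Only the event `J = n + 1` is added, where the length equals `2 - C_{n+1}`; its indicator is the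
difference of those of `J > n` and `J > n + 1`. -/
theorem truncLength_integrand_succ (Z : ℕ → Symb) (n : ℕ) :
    (if (pastRed Z (n + 1)).burgers = [] then 0 else (topLength Z : ℝ))
      = (if (pastRed Z n).burgers = [] then 0 else (topLength Z : ℝ)) +
        ((if (pastRed Z n).burgers = [] then 2 - (pastCount Z (n + 1) : ℝ) else 0) -
        (if (pastRed Z (n + 1)).burgers = [] then 2 - (pastCount Z (n + 1) : ℝ) else 0)) := by
  by_cases h1 : (pastRed Z (n + 1)).burgers = []
  · have h0 := burgers_nil_mono (Nat.le_succ n) h1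
    simp [h0, h1]
  · by_cases h0 : (pastRed Z n).burgers = []
    · have hT := topTime_eq_of_first h0 h1
      have h2 := pastCount_topTime (Z := Z) ⟨n + 1, mem_topTimes.mpr h1⟩
      rw [hT] at h2
      have h3 : (pastCount Z (n + 1) : ℝ) = 2 - topLength Z := by exact_mod_cast h2
      simp [h0, h1, h3]
    · simp [h0, h1]

theorem integrable_ite_count_succ (p : unitInterval) (n : ℕ) :
    Integrable (fun Z => if (pastRed Z n).burgers = [] then 2 - (pastCount Z (n + 1) : ℝ) else 0)
      (pastLaw p) := by
  refine integrable_of_abs_le (Measurable.ite (measurableSet_burgers_nil n)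
    (measurable_const.sub (measurable_pastCount_real _)) measurable_const) (3 + n) fun Z => ?_
  have h : |(pastCount Z (n + 1) : ℝ)| ≤ n + 1 := by
    have : |pastCount Z (n + 1)| ≤ ((n + 1 : ℕ) : ℤ) := by
      refine (Finset.abs_sum_le_sum_abs _ _).trans ?_
      refine (Finset.sum_le_sum (g := fun _ => (1 : ℤ)) fun k _ => ?_).trans (by simp)
      unfold Symb.step; split_ifs <;> simp
    exact_mod_cast this
  have := abs_le.mp h
  split_ifs
  · rw [abs_le]; constructor <;> linarith [this.1, this.2]
  · simp; positivity

theorem integrable_truncLength (p : unitInterval) (n : ℕ) :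
    Integrable (fun Z => if (pastRed Z n).burgers = [] then 0 else (topLength Z : ℝ))
      (pastLaw p) := by
  induction n with
  | zero => simp [pastRed, pastWord, reduce]
  | succ n ih =>
    simp_rw [truncLength_integrand_succ _ n]
    refine ih.add ((integrable_ite_count_succ p n).sub ?_)
    simp_rw [← wordCount_pastWord]
    exact integrable_ite_burgers_nil p (n + 1) fun w => 2 - (wordCount w : ℝ)

/-- Optional stopping of the walk at `min(J, n)`: mean zero means that `2 - l` integrated over `J ≤
n` compensates `C_n` integrated over `J > n`. -/
theorem truncLength_eq (p : unitInterval) (n : ℕ) :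
    truncLength p n = 2 * (1 - probNil p n) - meanNil p n := by
  induction n with
  | zero => simp [truncLength, probNil, meanNil, pastRed, pastWord, reduce, pastCount]
  | succ n ih =>
    have hI : ∀ n, Integrable (fun Z => if (pastRed Z n).burgers = [] then
        2 - (pastCount Z n : ℝ) else 0) (pastLaw p) := by
      intro n
      simp_rw [← wordCount_pastWord]
      exact integrable_ite_burgers_nil p n fun w => 2 - (wordCount w : ℝ)
    have hm : ∀ n, ∫ Z, (if (pastRed Z n).burgers = [] then
        2 - (pastCount Z n : ℝ) else 0) ∂(pastLaw p) = 2 * probNil p n + meanNil p n := by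
      intro n
      rw [probNil, meanNil, ← integral_const_mul, ← integral_add
        ((integrable_ite_burgers_nil p n fun _ => 1).const_mul 2) (integrable_meanNil p n)]
      refine integral_congr_ae (Eventually.of_forall fun Z => ?_)
      dsimp only
      split_ifs
      · ring
      · ring
    have hs : ∫ Z, (if (pastRed Z n).burgers = [] then 2 - (pastCount Z (n + 1) : ℝ) else 0)
        ∂(pastLaw p) = 2 * probNil p n + meanNil p n := by
      rw [← hm n]
      -- Words list the earliest letter first, so `w.tail` forgets the new letter: the condition is
      -- `J > n`, while the count already includes step `n + 1`, whose mean is zero.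
      have e := integral_pastWord_succ p n
        (fun w => if (reduce w.tail).burgers = [] then 2 - (wordCount w : ℝ) else 0)
      simp only [wordCount_pastWord] at e
      simp only [pastWord, List.tail_cons] at e
      refine e.trans (integral_congr_ae (Eventually.of_forall fun Z => ?_))
      by_cases h : (pastRed Z n).burgers = []
      · have h' : (reduce (pastWord Z n)).burgers = [] := h
        simp only [if_pos h, if_pos h', wordCount_cons, wordCount_pastWord]
        rw [sum_wt_step p (fun x => 2 - (((x + pastCount Z n : ℤ)) : ℝ))]
        push_cast; ring
      · have h' : ¬ (reduce (pastWord Z n)).burgers = [] := h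
        exact (Finset.sum_eq_zero fun s _ =>
          mul_eq_zero_of_right _ (if_neg h')).trans (if_neg h).symm
    have h1 : truncLength p (n + 1) = truncLength p n + ((2 * probNil p n + meanNil p n) -
        (2 * probNil p (n + 1) + meanNil p (n + 1))) := by
      rw [truncLength, truncLength]
      simp_rw [truncLength_integrand_succ _ n]
      have e1 := integral_sub (integrable_ite_count_succ p n) (hI (n + 1))
      have e2 := integral_add (integrable_truncLength p n) ((integrable_ite_count_succ p n).sub
        (hI (n + 1)))
      simp only [Pi.sub_apply] at e2
      rw [e2, e1, hs, hm]
    rw [h1, ih]; ring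

theorem truncLength_le (p : unitInterval) (n : ℕ) : truncLength p n ≤ 2 := by
  rw [truncLength_eq]; linarith [probNil_nonneg p n, meanNil_nonneg p n]

theorem ae_tendsto_truncLength (p : unitInterval) : ∀ᵐ Z ∂(pastLaw p),
    Tendsto (fun n => if (pastRed Z n).burgers = [] then 0 else (topLength Z : ℝ)) atTop
      (𝓝 (topLength Z : ℝ)) := by
  filter_upwards [ae_topTimes_nonempty p] with Z hZ
  refine tendsto_const_nhds.congr' ?_
  filter_upwards [eventually_ge_atTop (topTime Z)] with n hn
  rw [if_neg]
  rw [burgers_eq_nil_iff hZ]; omega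

theorem measurable_topLength_real : Measurable (fun Z => (topLength Z : ℝ)) :=
  (Measurable.of_discrete (f := fun k : ℕ => (k : ℝ))).comp measurable_topLength

/-- Fatou's lemma: the truncated lengths converge almost surely and have means at most `2`. -/
theorem integrable_topLength (p : unitInterval) :
    Integrable (fun Z => (topLength Z : ℝ)) (pastLaw p) := by
  refine ⟨measurable_topLength_real.aestronglyMeasurable, ?_⟩
  rw [hasFiniteIntegral_iff_ofReal (Eventually.of_forall fun Z => by positivity)]
  have hF := lintegral_liminf_le (μ := pastLaw p) (u := atTop)
    (f := fun n Z => ENNReal.ofReal (if (pastRed Z n).burgers = [] then 0 else (topLength Z : ℝ)))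
    (fun n => (Measurable.ite (measurableSet_burgers_nil n) measurable_const
      measurable_topLength_real).ennreal_ofReal)
  have h1 : ∫⁻ Z, ENNReal.ofReal (topLength Z : ℝ) ∂(pastLaw p) ≤ ∫⁻ Z, liminf (fun n =>
      ENNReal.ofReal (if (pastRed Z n).burgers = [] then 0 else (topLength Z : ℝ))) atTop
      ∂(pastLaw p) := by
    refine lintegral_mono_ae ?_
    filter_upwards [ae_tendsto_truncLength p] with Z hZ
    exact ((ENNReal.continuous_ofReal.tendsto _).comp hZ).liminf_eq.ge
  refine (h1.trans hF).trans_lt ?_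
  refine lt_of_le_of_lt (b := ENNReal.ofReal 2) ?_ ENNReal.ofReal_lt_top
  refine liminf_le_of_le (by isBoundedDefault) fun b hb => ?_
  obtain ⟨n, hn⟩ := hb.exists
  refine hn.trans ?_
  rw [← ofReal_integral_eq_lintegral_ofReal (integrable_truncLength p n)
    (Eventually.of_forall fun Z => by dsimp only; split_ifs <;> simp)]
  exact ENNReal.ofReal_le_ofReal (truncLength_le p n)

/-- The expected length of the first word with a burger. -/
noncomputable def meanLength (p : unitInterval) : ℝ := ∫ Z, (topLength Z : ℝ) ∂(pastLaw p)

theorem tendsto_truncLength (p : unitInterval) :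
    Tendsto (truncLength p) atTop (𝓝 (meanLength p)) := by
  refine tendsto_integral_of_dominated_convergence (fun Z => (topLength Z : ℝ))
    (fun n => (integrable_truncLength p n).aestronglyMeasurable) (integrable_topLength p)
    (fun n => Eventually.of_forall fun Z => ?_) (ae_tendsto_truncLength p)
  split_ifs <;> simp

/-- The defect `2 - χ` is the part of the martingale's mass that escapes on `J > n`. It vanishes
exactly in the case `χ = 2`. -/
theorem tendsto_meanNil (p : unitInterval) :
    Tendsto (meanNil p) atTop (𝓝 (2 - meanLength p)) := by
  have h : meanNil p = fun n => 2 * (1 - probNil p n) - truncLength p n := by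
    funext n; rw [truncLength_eq]; ring
  rw [h]
  have := (((tendsto_probNil p).const_sub 1).const_mul 2).sub (tendsto_truncLength p)
  simpa using this

theorem meanLength_le_two (p : unitInterval) : meanLength p ≤ 2 :=
  le_of_tendsto' (tendsto_truncLength p) (truncLength_le p)

/-! ### The maximum of the random walk -/

/-- The largest count of a suffix. -/
def wordMax : List Symb → ℤ
  | [] => 0
  | s :: w => max (wordMax w) (wordCount (s :: w))

theorem pastCount_le_wordMax (Z : ℕ → Symb) {j n : ℕ} (h : j ≤ n) :
    pastCount Z j ≤ wordMax (pastWord Z n) := by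
  induction n with
  | zero => obtain rfl : j = 0 := by omega
            simp [pastCount, pastWord, wordMax]
  | succ n ih =>
    rw [pastWord, wordMax]
    rcases Nat.lt_or_ge j (n + 1) with h1 | h1
    · exact (ih (by omega)).trans (le_max_left _ _)
    · obtain rfl : j = n + 1 := by omega
      rw [← wordCount_pastWord]
      exact le_max_right _ _

theorem wordCount_le_wordMax (w : List Symb) : wordCount w ≤ wordMax w := by
  cases w with
  | nil => simp [wordCount, wordMax]
  | cons s w => exact le_max_right _ _

theorem integral_count_sq (p : unitInterval) (n : ℕ) :
    ∫ Z, (wordCount (pastWord Z n) : ℝ) ^ 2 ∂(pastLaw p) = n := by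
  induction n with
  | zero => simp [pastWord, wordCount]
  | succ n ih =>
    rw [integral_pastWord_succ p n (fun w => (wordCount w : ℝ) ^ 2)]
    have h : ∀ Z : ℕ → Symb, ∑ s, wt p s * (wordCount (s :: pastWord Z n) : ℝ) ^ 2
        = (wordCount (pastWord Z n) : ℝ) ^ 2 + 1 := by
      intro Z
      simp only [wordCount_cons]
      rw [sum_wt_step p (fun x => (((x + wordCount (pastWord Z n) : ℤ)) : ℝ) ^ 2)]
      push_cast; ring
    simp_rw [h]
    rw [integral_add (integrable_pastWord p n fun w => (wordCount w : ℝ) ^ 2)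
      (integrable_const _), ih]
    simp

/-- Maximum minus position is a reflected walk: away from `0` its mean square grows by `1` per step,
and at `0` by only `1 / 2`, because a new record leaves the difference at `0`. -/
theorem integral_max_sub_count_sq_le (p : unitInterval) (n : ℕ) :
    ∫ Z, ((wordMax (pastWord Z n) : ℝ) - wordCount (pastWord Z n)) ^ 2 ∂(pastLaw p) ≤ n := by
  induction n with
  | zero => simp [pastWord, wordCount, wordMax]
  | succ n ih =>
    rw [integral_pastWord_succ p n (fun w => ((wordMax w : ℝ) - wordCount w) ^ 2)]
    have h : ∀ Z : ℕ → Symb, ∑ s, wt p s * ((wordMax (s :: pastWord Z n) : ℝ) -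
        wordCount (s :: pastWord Z n)) ^ 2
        ≤ ((wordMax (pastWord Z n) : ℝ) - wordCount (pastWord Z n)) ^ 2 + 1 := by
      intro Z
      generalize pastWord Z n = w
      simp only [wordCount_cons, wordMax]
      rw [sum_wt_step p (fun x => (((max (wordMax w) (x + wordCount w) : ℤ) : ℝ) -
        ((x + wordCount w : ℤ) : ℝ)) ^ 2)]
      have h1 := wordCount_le_wordMax w
      have h2 : max (wordMax w) (-1 + wordCount w) = wordMax w := max_eq_left (by omega)
      rw [h2]
      rcases le_or_gt (1 + wordCount w) (wordMax w) with h3 | h3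
      · rw [max_eq_left h3]; push_cast; nlinarith
      · have h4 : wordMax w = wordCount w := by omega
        rw [max_eq_right h3.le, h4]; push_cast; nlinarith
    refine (integral_mono (integrable_pastWord p n fun w => ∑ s, wt p s *
        ((wordMax (s :: w) : ℝ) - wordCount (s :: w)) ^ 2)
      ((integrable_pastWord p n fun w => ((wordMax w : ℝ) - wordCount w) ^ 2).add
        (integrable_const 1)) h).trans ?_
    simp only [Pi.add_apply]
    rw [integral_add (integrable_pastWord p n fun w => ((wordMax w : ℝ) - wordCount w) ^ 2)
      (integrable_const _)]
    simp; linarith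

theorem integral_max_sq_le (p : unitInterval) (n : ℕ) :
    ∫ Z, (wordMax (pastWord Z n) : ℝ) ^ 2 ∂(pastLaw p) ≤ 4 * n := by
  have h1 := integral_count_sq p n
  have h2 := integral_max_sub_count_sq_le p n
  have i1 := integrable_pastWord p n fun w => ((wordMax w : ℝ) - wordCount w) ^ 2
  have i2 := integrable_pastWord p n fun w => (wordCount w : ℝ) ^ 2
  have h3 := integral_mono (μ := pastLaw p)
    (integrable_pastWord p n fun w => (wordMax w : ℝ) ^ 2)
    ((i1.const_mul 2).add (i2.const_mul 2)) fun Z => by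
      simp only [Pi.add_apply]
      -- With `M` the maximum and `C` the count, `2 (M - C) ^ 2 + 2 C ^ 2 - M ^ 2 = (M - 2 C) ^ 2`.
      nlinarith [sq_nonneg ((wordMax (pastWord Z n) : ℝ) - 2 * wordCount (pastWord Z n))]
  simp only [Pi.add_apply] at h3
  rw [integral_add (i1.const_mul 2) (i2.const_mul 2), integral_const_mul, integral_const_mul] at h3
  linarith

theorem measure_sq_le (p : unitInterval) {f : (ℕ → Symb) → ℝ}
    (hi : Integrable (fun Z => f Z ^ 2) (pastLaw p)) {a c : ℝ} (ha : 0 < a)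
    (hc : ∫ Z, f Z ^ 2 ∂(pastLaw p) ≤ c) : (pastLaw p).real {Z | a ≤ |f Z|} ≤ c / a ^ 2 := by
  have h := mul_meas_ge_le_integral_of_nonneg (μ := pastLaw p) (f := fun Z => f Z ^ 2)
    (Eventually.of_forall fun Z => sq_nonneg _) hi (a ^ 2)
  have h2 : {Z | a ≤ |f Z|} = {Z | a ^ 2 ≤ f Z ^ 2} := by
    ext Z
    change a ≤ |f Z| ↔ a ^ 2 ≤ f Z ^ 2
    rw [← sq_abs (f Z)]
    exact (pow_le_pow_iff_left₀ ha.le (abs_nonneg _) two_ne_zero).symm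
  rw [h2, le_div_iff₀ (by positivity), mul_comm]
  exact h.trans hc

theorem measure_max_ge_le (p : unitInterval) (n : ℕ) {a : ℝ} (ha : 0 < a) :
    (pastLaw p).real {Z | ∃ j ≤ n, a ≤ pastCount Z j} ≤ 4 * n / a ^ 2 := by
  refine (measureReal_mono ?_).trans (measure_sq_le p
    (integrable_pastWord p n fun w => (wordMax w : ℝ) ^ 2) ha (integral_max_sq_le p n))
  rintro Z ⟨j, hj, h⟩
  have : (pastCount Z j : ℝ) ≤ wordMax (pastWord Z n) := by
    exact_mod_cast pastCount_le_wordMax Z hj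
  exact (h.trans this).trans (le_abs_self _)

theorem measure_count_ge_le (p : unitInterval) (n : ℕ) {a : ℝ} (ha : 0 < a) :
    (pastLaw p).real {Z | a ≤ |(pastCount Z n : ℝ)|} ≤ n / a ^ 2 := by
  simp_rw [← wordCount_pastWord]
  exact measure_sq_le p (integrable_pastWord p n fun w => (wordCount w : ℝ) ^ 2) ha
    (integral_count_sq p n).le

/-! ### Decomposition according to the position of the top of the stack -/

theorem ite_burgers_nil_eq_sum (Z : ℕ → Symb) (n : ℕ) (x : ℝ) :
    (if (pastRed Z n).burgers = [] then 0 else x)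
      = ∑ j ∈ Finset.range n, if topTime Z = j + 1 then x else 0 := by
  split_ifs with h
  · refine (Finset.sum_eq_zero fun j hj => ?_).symm
    rw [if_neg]
    intro hT
    have := ((topTime_eq_succ_iff Z j).mp hT).2
    exact this (burgers_nil_mono (by have := Finset.mem_range.mp hj; omega) h)
  · have hne : (topTimes Z).Nonempty := ⟨n, mem_topTimes.mpr h⟩
    have hpos := topTime_pos hne
    rw [burgers_eq_nil_iff hne] at h
    rw [Finset.sum_eq_single (topTime Z - 1)]
    · rw [if_pos (by omega)]
    · intro b _ hb
      rw [if_neg (by omega)]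
    · intro hb
      exact absurd (Finset.mem_range.mpr (by omega)) hb

/-- The event `J = j + 1` is decided by the last `j + 1` letters; `w.tail` is that word without its
earliest letter. -/
theorem ite_topTime_eq (j : ℕ) (F : List Symb → ℝ) (Z : ℕ → Symb) :
    (if topTime Z = j + 1 then F (pastWord Z (j + 1)) else 0) =
      (fun w : List Symb => if (reduce w.tail).burgers = [] ∧ (reduce w).burgers ≠ [] then F w
        else 0) (pastWord Z (j + 1)) := by
  simp only [topTime_eq_succ_iff]
  rfl

/-- The earlier letters are independent of the first word with a burger. -/
theorem integral_topTime_mul_shift (p : unitInterval) (j : ℕ) (F : List Symb → ℝ)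
    {g : (ℕ → Symb) → ℝ} (hg : Measurable g) :
    ∫ Z, (if topTime Z = j + 1 then F (pastWord Z (j + 1)) else 0) * g (shift (j + 1) Z)
        ∂(pastLaw p)
      = (∫ Z, (if topTime Z = j + 1 then F (pastWord Z (j + 1)) else 0) ∂(pastLaw p))
        * ∫ Z, g Z ∂(pastLaw p) := by
  simp_rw [ite_topTime_eq]
  exact integral_pastWord_mul_shift p (j + 1) (fun w : List Symb =>
    if (reduce w.tail).burgers = [] ∧ (reduce w).burgers ≠ [] then F w else 0) hg

/-! ### Moments of the discrepancy -/

theorem abs_pastDisc_real_le (Z : ℕ → Symb) (n : ℕ) : |(pastDisc Z n : ℝ)| ≤ n := by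
  exact_mod_cast abs_pastDisc_le Z n

theorem abs_disc_real_le (s : Symb) : |(s.disc : ℝ)| ≤ 1 := by exact_mod_cast abs_disc_le s

theorem measurable_disc_topBurger : Measurable (fun Z => ((topBurger Z).disc : ℝ)) :=
  (Measurable.of_discrete (f := fun s : Symb => (s.disc : ℝ))).comp measurable_topBurger

theorem integrable_pastDisc_pow (p : unitInterval) (n k : ℕ) :
    Integrable (fun Z => (pastDisc Z n : ℝ) ^ k) (pastLaw p) := by
  refine integrable_of_abs_le ((measurable_pastDisc_real n).pow_const k) ((n : ℝ) ^ k) fun Z => ?_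
  rw [abs_pow]
  exact pow_le_pow_left₀ (abs_nonneg _) (abs_pastDisc_real_le Z n) k

theorem integrable_top_mul_pastDisc_pow (p : unitInterval) (n k : ℕ) :
    Integrable (fun Z => ((topBurger Z).disc : ℝ) * (pastDisc Z n : ℝ) ^ k) (pastLaw p) :=
  (integrable_pastDisc_pow p n k).bdd_mul (c := 1)
    measurable_disc_topBurger.aestronglyMeasurable
    (Eventually.of_forall fun _ => abs_disc_real_le _)

theorem integral_pastDisc_pow_odd (p : unitInterval) (n : ℕ) {k : ℕ} (hk : Odd k) :
    ∫ Z, (pastDisc Z n : ℝ) ^ k ∂(pastLaw p) = 0 := by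
  refine integral_eq_zero_of_flip p ((measurable_pastDisc_real n).pow_const k) fun Z => ?_
  rw [pastDisc_flip]; push_cast; exact hk.neg_pow _

/-- The most recent letter is correlated with the earlier ones only through flexible orders. -/
theorem integral_incr_mul (p : unitInterval) (n k : ℕ) :
    ∫ Z, (incr Z : ℝ) * (pastDisc (shift 1 Z) n : ℝ) ^ k ∂(pastLaw p)
      = -(p / 2) * ∫ Z, ((topBurger Z).disc : ℝ) * (pastDisc Z n : ℝ) ^ k ∂(pastLaw p) := by
  have h := integral_first_letter p (fun s Z => ((if s = Symb.flexOrder then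
      -(topBurger Z).disc else s.disc : ℤ) : ℝ) * (pastDisc Z n : ℝ) ^ k) ((n : ℝ) ^ k)
    (fun s => by
      refine Measurable.mul ?_ ((measurable_pastDisc_real n).pow_const k)
      by_cases hs : s = Symb.flexOrder
      · simp only [hs, if_true, Int.cast_neg]; exact measurable_disc_topBurger.neg
      · simp only [hs, if_false]; exact measurable_const)
    (fun s Z => by
      rw [abs_mul, abs_pow]
      have h1 : |((if s = Symb.flexOrder then -(topBurger Z).disc else s.disc : ℤ) : ℝ)| ≤ 1 := by
        split_ifs
        · push_cast; rw [abs_neg]; exact abs_disc_real_le _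
        · exact abs_disc_real_le _
      have h2 := pow_le_pow_left₀ (abs_nonneg _) (abs_pastDisc_real_le Z n) k
      calc _ ≤ 1 * (n : ℝ) ^ k := mul_le_mul h1 h2 (by positivity) zero_le_one
        _ = _ := one_mul _)
  refine Eq.trans ?_ (h.trans ?_)
  · rfl
  · rw [sum_symb]
    simp only [wt, Symb.disc]
    simp [integral_neg]

theorem integrable_ite {p : unitInterval} {P : (ℕ → Symb) → Prop} [DecidablePred P]
    (hP : MeasurableSet {Z | P Z}) {f : (ℕ → Symb) → ℝ} (hf : Integrable f (pastLaw p)) :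
    Integrable (fun Z => if P Z then f Z else 0) (pastLaw p) := by
  refine (hf.indicator hP).congr (Eventually.of_forall fun Z => ?_)
  by_cases hZ : P Z <;> simp [Set.indicator, hZ]

/-- The correlation of the top of the stack with the discrepancy, on the event that the `n` most
recent letters leave no burger. -/
noncomputable def nilError (p : unitInterval) (n k : ℕ) : ℝ :=
  ∫ Z, (if (pastRed Z n).burgers = [] then
    -((topBurger Z).disc * (pastDisc Z n : ℝ) ^ k) else 0) ∂(pastLaw p)

theorem integrable_nilError (p : unitInterval) (n k : ℕ) :
    Integrable (fun Z => if (pastRed Z n).burgers = [] then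
      -((topBurger Z).disc * (pastDisc Z n : ℝ) ^ k) else 0) (pastLaw p) :=
  integrable_ite (measurableSet_burgers_nil n) (integrable_top_mul_pastDisc_pow p n k).neg

theorem integrable_notNil (p : unitInterval) (n k : ℕ) :
    Integrable (fun Z => if (pastRed Z n).burgers = [] then 0 else
      (topBurger Z).disc * (pastDisc Z n : ℝ) ^ k) (pastLaw p) := by
  have h := (integrable_top_mul_pastDisc_pow p n k).indicator (measurableSet_burgers_nil n).compl
  refine h.congr (Eventually.of_forall fun Z => ?_)
  by_cases hZ : (pastRed Z n).burgers = [] <;> simp [Set.indicator, hZ]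

/-- `nilError` carries a minus sign so that it enters the moment recursions with the positive
coefficient coming from `-(p / 2)`. -/
theorem integral_top_mul_eq (p : unitInterval) (n k : ℕ) :
    ∫ Z, ((topBurger Z).disc : ℝ) * (pastDisc Z n : ℝ) ^ k ∂(pastLaw p)
      = ∫ Z, (if (pastRed Z n).burgers = [] then 0 else
          (topBurger Z).disc * (pastDisc Z n : ℝ) ^ k) ∂(pastLaw p) - nilError p n k := by
  rw [nilError, ← integral_sub (integrable_notNil p n k) (integrable_nilError p n k)]
  refine integral_congr_ae (Eventually.of_forall fun Z => ?_)
  dsimp only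
  split_ifs <;> ring

theorem integrable_ite_topTime {p : unitInterval} {f : (ℕ → Symb) → ℝ}
    (hf : Integrable f (pastLaw p)) (j : ℕ) :
    Integrable (fun Z => if topTime Z = j + 1 then f Z else 0) (pastLaw p) :=
  integrable_ite (measurableSet_topTime_eq_succ j) hf

theorem pastDisc_of_topTime {Z : ℕ → Symb} {j n : ℕ} (hj : j < n) (hT : topTime Z = j + 1) :
    (pastDisc Z n : ℝ) = (topBurger Z).disc * topLength Z + pastDisc (shift (j + 1) Z) (n - (j + 1))
      ∧ ((topBurger Z).disc : ℝ) * (topBurger Z).disc = 1 := by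
  have hne : (topTimes Z).Nonempty :=
    ⟨j + 1, mem_topTimes.mpr ((topTime_eq_succ_iff Z j).mp hT).2⟩
  have h1 := pastDisc_topTime hne
  have h2 := pastDisc_add Z (j + 1) (n - (j + 1))
  rw [Nat.add_sub_cancel' (by omega : j + 1 ≤ n), ← hT, h1, hT] at h2
  have h3 := disc_mul_self (ne_flex_of_isBurger (pastRed_topTime hne).1)
  exact ⟨by exact_mod_cast h2, by exact_mod_cast h3⟩

theorem topBurger_of_topTime {Z : ℕ → Symb} {j : ℕ} (hT : topTime Z = j + 1) :
    topBurger Z = (pastWord Z (j + 1)).headD Symb.flexOrder := by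
  rw [topBurger, hT]; simp [pastWord]

theorem topLength_of_topTime {Z : ℕ → Symb} {j : ℕ} (hT : topTime Z = j + 1) :
    topLength Z = (reduce (pastWord Z (j + 1))).length := by
  rw [topLength, hT]; rfl

/-- An odd power of the discrepancy before the top of the stack has mean zero. -/
theorem integral_topTime_mul_odd (p : unitInterval) (j m a : ℕ) {k : ℕ} (hk : Odd k) :
    ∫ Z, (if topTime Z = j + 1 then ((topBurger Z).disc : ℝ) * (topLength Z : ℝ) ^ a *
      (pastDisc (shift (j + 1) Z) m : ℝ) ^ k else 0) ∂(pastLaw p) = 0 := by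
  have h := integral_topTime_mul_shift p j
    (fun w => ((w.headD Symb.flexOrder).disc : ℝ) * ((reduce w).length : ℝ) ^ a)
    ((measurable_pastDisc_real m).pow_const k)
  rw [integral_pastDisc_pow_odd p m hk, mul_zero] at h
  refine Eq.trans ?_ h
  refine integral_congr_ae (Eventually.of_forall fun Z => ?_)
  dsimp only
  split_ifs with hT
  · rw [topBurger_of_topTime hT, topLength_of_topTime hT]
  · simp

/-- On `J = j + 1` write `D_n = b l + D'` with `b = ±1` and `D'` a function of older letters. Then
`b D_n = l + b D'`, and `b D'` integrates to zero by independence and symmetry. -/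
theorem integral_ite_topTime_one (p : unitInterval) {j n : ℕ} (hj : j < n) :
    ∫ Z, (if topTime Z = j + 1 then ((topBurger Z).disc : ℝ) * (pastDisc Z n : ℝ) ^ 1 else 0)
        ∂(pastLaw p)
      = ∫ Z, (if topTime Z = j + 1 then (topLength Z : ℝ) else 0) ∂(pastLaw p) := by
  have h0 := integral_topTime_mul_odd p j (n - (j + 1)) 0 (k := 1) odd_one
  have i1 := integrable_ite_topTime (integrable_top_mul_pastDisc_pow p n 1) j
  have i2 := integrable_ite_topTime (integrable_topLength p) j
  rw [← sub_eq_zero, ← integral_sub i1 i2, ← h0]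
  refine integral_congr_ae (Eventually.of_forall fun Z => ?_)
  dsimp only
  split_ifs with hT
  · obtain ⟨h1, h2⟩ := pastDisc_of_topTime hj hT
    rw [h1]
    linear_combination (topLength Z : ℝ) * h2
  · simp

theorem integral_notNil_one (p : unitInterval) (n : ℕ) :
    ∫ Z, (if (pastRed Z n).burgers = [] then 0 else
          (topBurger Z).disc * (pastDisc Z n : ℝ) ^ 1) ∂(pastLaw p) = truncLength p n := by
  rw [truncLength]
  simp_rw [ite_burgers_nil_eq_sum]
  rw [integral_finsetSum _ fun j _ =>
      integrable_ite_topTime (integrable_top_mul_pastDisc_pow p n 1) j,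
    integral_finsetSum _ fun j _ => integrable_ite_topTime (integrable_topLength p) j]
  exact Finset.sum_congr rfl fun j hj => integral_ite_topTime_one p (Finset.mem_range.mp hj)

theorem integrable_topTime_mul (p : unitInterval) (j m a k : ℕ) :
    Integrable (fun Z => if topTime Z = j + 1 then ((topBurger Z).disc : ℝ) *
      (topLength Z : ℝ) ^ a * (pastDisc (shift (j + 1) Z) m : ℝ) ^ k else 0) (pastLaw p) := by
  have h1 := integrable_pastWord p (j + 1) (fun w => if (reduce w.tail).burgers = [] ∧
    (reduce w).burgers ≠ [] then
    ((w.headD Symb.flexOrder).disc : ℝ) * ((reduce w).length : ℝ) ^ a else 0)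
  have h2 := h1.bdd_mul (c := (m : ℝ) ^ k)
    (f := fun Z => (pastDisc (shift (j + 1) Z) m : ℝ) ^ k)
    (((measurable_pastDisc_real m).comp (measurable_shift (j + 1))).pow_const
      k).aestronglyMeasurable
    (Eventually.of_forall fun Z => by
      rw [Real.norm_eq_abs, abs_pow]
      exact pow_le_pow_left₀ (abs_nonneg _) (abs_pastDisc_real_le _ _) k)
  refine h2.congr (Eventually.of_forall fun Z => ?_)
  have h3 := ite_topTime_eq j
    (fun w => ((w.headD Symb.flexOrder).disc : ℝ) * ((reduce w).length : ℝ) ^ a) Z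
  dsimp only at h3 ⊢
  rw [← h3]
  split_ifs with hT
  · rw [topBurger_of_topTime hT, topLength_of_topTime hT]; ring
  · simp

/-- With `D_n = b l + D'` and `b ^ 2 = 1`, `b D_n ^ 3 = l ^ 3 + 3 b l ^ 2 D' + 3 l D' ^ 2 + b D' ^
3`. The terms odd in `D'` integrate to zero and the other two are nonnegative. A sign suffices,
since this quantity enters the fourth moment with a negative coefficient. -/
theorem integral_ite_topTime_three (p : unitInterval) {j n : ℕ} (hj : j < n) :
    0 ≤ ∫ Z, (if topTime Z = j + 1 then ((topBurger Z).disc : ℝ) * (pastDisc Z n : ℝ) ^ 3 else 0)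
        ∂(pastLaw p) := by
  have h1 := integral_topTime_mul_odd p j (n - (j + 1)) 2 (k := 1) odd_one
  have h3 := integral_topTime_mul_odd p j (n - (j + 1)) 0 (k := 3) (by decide)
  have i1 := integrable_topTime_mul p j (n - (j + 1)) 2 1
  have i3 := integrable_topTime_mul p j (n - (j + 1)) 0 3
  have i0 := integrable_ite_topTime (integrable_top_mul_pastDisc_pow p n 3) j
  have h := integral_mono ((i1.const_mul 3).add i3) i0 (fun Z => by
    simp only [Pi.add_apply]
    split_ifs with hT
    · obtain ⟨e1, e2⟩ := pastDisc_of_topTime hj hT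
      rw [e1]
      set b := ((topBurger Z).disc : ℝ)
      set l := (topLength Z : ℝ) with hl
      set D := (pastDisc (shift (j + 1) Z) (n - (j + 1)) : ℝ)
      have hl0 : 0 ≤ l := Nat.cast_nonneg _
      have e3 : b * (b * l + D) ^ 3 = l ^ 3 + 3 * (b * l ^ 2 * D) + 3 * l * D ^ 2 + b * D ^ 3 := by
        linear_combination (l ^ 3 * (b * b + 1) + 3 * l ^ 2 * D * b + 3 * l * D ^ 2) * e2
      have : 0 ≤ l ^ 3 + 3 * l * D ^ 2 := by positivity
      rw [e3, pow_one, pow_zero, mul_one]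
      linarith
    · simp)
  simp only [Pi.add_apply] at h
  rw [integral_add (i1.const_mul 3) i3, integral_const_mul, h1, h3] at h
  linarith

theorem integral_notNil_three (p : unitInterval) (n : ℕ) :
    0 ≤ ∫ Z, (if (pastRed Z n).burgers = [] then 0 else
          (topBurger Z).disc * (pastDisc Z n : ℝ) ^ 3) ∂(pastLaw p) := by
  simp_rw [ite_burgers_nil_eq_sum]
  rw [integral_finsetSum _ fun j _ =>
      integrable_ite_topTime (integrable_top_mul_pastDisc_pow p n 3) j]
  exact Finset.sum_nonneg fun j hj => integral_ite_topTime_three p (Finset.mem_range.mp hj)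

/-- The mean absolute discrepancy on the event that the `n` most recent letters leave no
burger. -/
noncomputable def absNil (p : unitInterval) (n : ℕ) : ℝ :=
  ∫ Z, (if (pastRed Z n).burgers = [] then |(pastDisc Z n : ℝ)| else 0) ∂(pastLaw p)

theorem integrable_absNil (p : unitInterval) (n : ℕ) :
    Integrable (fun Z => if (pastRed Z n).burgers = [] then |(pastDisc Z n : ℝ)| else 0)
      (pastLaw p) := by
  have h := (integrable_pastDisc_pow p n 1).abs
  simp only [pow_one] at h
  exact integrable_ite (measurableSet_burgers_nil n) h

theorem absNil_nonneg (p : unitInterval) (n : ℕ) : 0 ≤ absNil p n :=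
  integral_nonneg fun Z => by dsimp only; split_ifs <;> positivity

theorem abs_pastDisc_real_le_of_nil {Z : ℕ → Symb} {n : ℕ} (h : (pastRed Z n).burgers = []) :
    |(pastDisc Z n : ℝ)| ≤ -(pastCount Z n : ℝ) := by
  exact_mod_cast abs_pastDisc_le_of_burgers_nil h

theorem absNil_le_meanNil (p : unitInterval) (n : ℕ) : absNil p n ≤ meanNil p n := by
  refine integral_mono (integrable_absNil p n) (integrable_meanNil p n) fun Z => ?_
  dsimp only
  split_ifs with h
  · exact abs_pastDisc_real_le_of_nil h
  · exact le_rfl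

theorem abs_nilError_one_le (p : unitInterval) (n : ℕ) : |nilError p n 1| ≤ absNil p n := by
  refine (abs_integral_le_integral_abs).trans (integral_mono (integrable_nilError p n 1).abs
    (integrable_absNil p n) fun Z => ?_)
  dsimp only
  split_ifs
  · rw [abs_neg, abs_mul, pow_one]
    exact mul_le_of_le_one_left (abs_nonneg _) (abs_disc_real_le _)
  · simp

theorem nilError_three_le (p : unitInterval) (n : ℕ) : nilError p n 3 ≤ 1 + 3 * n := by
  refine le_trans ?_ (integral_cube_nil_le p n)
  refine integral_mono (integrable_nilError p n 3) ?_ fun Z => ?_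
  · simp_rw [← wordCount_pastWord]
    exact integrable_ite_burgers_nil p n fun w => (-(wordCount w : ℝ)) ^ 3
  · dsimp only
    split_ifs with h
    · refine (neg_le_abs _).trans ?_
      rw [abs_mul, abs_pow]
      refine (mul_le_of_le_one_left (by positivity) (abs_disc_real_le _)).trans ?_
      exact pow_le_pow_left₀ (abs_nonneg _) (abs_pastDisc_real_le_of_nil h) 3
    · exact le_rfl

/-- The moments of the discrepancy. -/
noncomputable def discMoment (p : unitInterval) (k n : ℕ) : ℝ :=
  ∫ Z, (pastDisc Z n : ℝ) ^ k ∂(pastLaw p)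

theorem integral_shift_pow (p : unitInterval) (k n : ℕ) :
    ∫ Z, (pastDisc (shift 1 Z) n : ℝ) ^ k ∂(pastLaw p) = discMoment p k n :=
  integral_shift p 1 ((measurable_pastDisc_real n).pow_const k)

theorem integrable_shift_pow (p : unitInterval) (n k : ℕ) :
    Integrable (fun Z => (pastDisc (shift 1 Z) n : ℝ) ^ k) (pastLaw p) :=
  (measurePreserving_shift p 1).integrable_comp_of_integrable (integrable_pastDisc_pow p n k)

theorem integrable_incr_mul (p : unitInterval) (n k : ℕ) :
    Integrable (fun Z => (incr Z : ℝ) * (pastDisc (shift 1 Z) n : ℝ) ^ k) (pastLaw p) :=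
  (integrable_shift_pow p n k).bdd_mul (c := 1)
    ((Measurable.of_discrete (f := fun k : ℤ => (k : ℝ))).comp
      measurable_incr).aestronglyMeasurable
    (Eventually.of_forall fun Z => by
      rw [Real.norm_eq_abs]; exact_mod_cast abs_incr_le Z)

theorem ae_incr_sq (p : unitInterval) : ∀ᵐ Z ∂(pastLaw p), (incr Z : ℝ) * incr Z = 1 := by
  filter_upwards [ae_forall_topTimes_nonempty p] with Z hZ
  exact_mod_cast incr_mul_self (hZ 1)

/-- Expand the square of newest increment plus older discrepancy: the increment squares to `1`, and
the cross term is `-(p / 2)` times the correlation of the older discrepancy with its top burger. -/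
theorem discMoment_two_succ (p : unitInterval) (n : ℕ) :
    discMoment p 2 (n + 1) = discMoment p 2 n + 1 - p * truncLength p n + p * nilError p n 1 := by
  have h1 : discMoment p 2 (n + 1) = ∫ Z, ((pastDisc (shift 1 Z) n : ℝ) ^ 2 +
      2 * ((incr Z : ℝ) * (pastDisc (shift 1 Z) n : ℝ) ^ 1) + 1) ∂(pastLaw p) := by
    refine integral_congr_ae ?_
    filter_upwards [ae_incr_sq p] with Z hZ
    rw [pastDisc_succ']; push_cast
    linear_combination hZ
  have i1 : Integrable (fun Z => (pastDisc (shift 1 Z) n : ℝ) ^ 2 +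
      2 * ((incr Z : ℝ) * (pastDisc (shift 1 Z) n : ℝ) ^ 1)) (pastLaw p) :=
    (integrable_shift_pow p n 2).add ((integrable_incr_mul p n 1).const_mul 2)
  rw [h1, integral_add i1 (integrable_const _),
    integral_add (integrable_shift_pow p n 2) ((integrable_incr_mul p n 1).const_mul 2),
    integral_const_mul, integral_incr_mul, integral_top_mul_eq, integral_notNil_one,
    integral_shift_pow]
  simp; ring

/-- In the binomial expansion both odd cross terms are negative up to the contribution of `J > n`,
so no control of the correlations on `J ≤ n` is needed. -/
theorem discMoment_four_succ_le (p : unitInterval) (n : ℕ) :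
    discMoment p 4 (n + 1) ≤ discMoment p 4 n + 6 * discMoment p 2 n + 1 +
      2 * p * nilError p n 1 + 2 * p * nilError p n 3 := by
  have h1 : discMoment p 4 (n + 1) = ∫ Z, ((pastDisc (shift 1 Z) n : ℝ) ^ 4 +
      (6 * (pastDisc (shift 1 Z) n : ℝ) ^ 2 +
      (4 * ((incr Z : ℝ) * (pastDisc (shift 1 Z) n : ℝ) ^ 1) +
      (4 * ((incr Z : ℝ) * (pastDisc (shift 1 Z) n : ℝ) ^ 3) + 1)))) ∂(pastLaw p) := by
    refine integral_congr_ae ?_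
    filter_upwards [ae_incr_sq p] with Z hZ
    rw [pastDisc_succ']; push_cast
    set d := (incr Z : ℝ)
    set D := (pastDisc (shift 1 Z) n : ℝ)
    linear_combination (d * d + 1 + 4 * d * D + 6 * D ^ 2) * hZ
  have i1 := integrable_shift_pow p n 4
  have i2 := (integrable_shift_pow p n 2).const_mul 6
  have i3 := (integrable_incr_mul p n 1).const_mul 4
  have i4 := (integrable_incr_mul p n 3).const_mul 4
  have i5 : Integrable (fun _ : ℕ → Symb => (1 : ℝ)) (pastLaw p) := integrable_const _
  have i45 : Integrable (fun Z => 4 * ((incr Z : ℝ) * (pastDisc (shift 1 Z) n : ℝ) ^ 3) + 1)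
    (pastLaw p) := i4.add i5
  have i345 : Integrable (fun Z => 4 * ((incr Z : ℝ) * (pastDisc (shift 1 Z) n : ℝ) ^ 1) +
    (4 * ((incr Z : ℝ) * (pastDisc (shift 1 Z) n : ℝ) ^ 3) + 1)) (pastLaw p) := i3.add i45
  have i2345 : Integrable (fun Z => 6 * (pastDisc (shift 1 Z) n : ℝ) ^ 2 +
    (4 * ((incr Z : ℝ) * (pastDisc (shift 1 Z) n : ℝ) ^ 1) +
    (4 * ((incr Z : ℝ) * (pastDisc (shift 1 Z) n : ℝ) ^ 3) + 1))) (pastLaw p) := i2.add i345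
  have h2 := integral_notNil_three p n
  have h3 : 0 ≤ truncLength p n := integral_nonneg fun Z => by dsimp only; split_ifs <;> simp
  have hp := p.2.1
  rw [h1, integral_add i1 i2345, integral_add i2 i345,
    integral_add i3 i45, integral_add i4 i5,
    integral_const_mul, integral_const_mul, integral_const_mul, integral_incr_mul,
    integral_incr_mul, integral_top_mul_eq, integral_top_mul_eq, integral_notNil_one,
    integral_shift_pow, integral_shift_pow]
  have h4 := mul_nonneg hp h2
  have h5 := mul_nonneg hp h3
  simp only [integral_const, probReal_univ, smul_eq_mul, mul_one]
  linarith

theorem nilError_one_le_one (p : unitInterval) (n : ℕ) : nilError p n 1 ≤ 1 := by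
  have h1 := le_of_abs_le (abs_nilError_one_le p n)
  have h2 := absNil_le_meanNil p n
  have h3 := probNil_add_meanNil_le p n
  have h4 := probNil_nonneg p n
  linarith

theorem discMoment_two_le (p : unitInterval) (n : ℕ) : discMoment p 2 n ≤ 2 * n := by
  induction n with
  | zero => simp [discMoment, pastDisc]
  | succ n ih =>
    have h3 : 0 ≤ truncLength p n := integral_nonneg fun Z => by dsimp only; split_ifs <;> simp
    rw [discMoment_two_succ]
    have h1 := nilError_one_le_one p n
    have h0 := p.2.1
    have h2 := p.2.2
    have h4 := mul_nonneg h0 h3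
    push_cast
    nlinarith

theorem discMoment_four_le (p : unitInterval) (n : ℕ) : discMoment p 4 n ≤ 9 * (n : ℝ) ^ 2 := by
  induction n with
  | zero => simp [discMoment, pastDisc]
  | succ n ih =>
    have h := discMoment_four_succ_le p n
    have h1 := nilError_one_le_one p n
    have h3 := nilError_three_le p n
    have h2 := discMoment_two_le p n
    have hp0 := p.2.1
    have hp1 := p.2.2
    have h4 : (p : ℝ) * nilError p n 1 ≤ 1 := by nlinarith
    have h5 : (p : ℝ) * nilError p n 3 ≤ 1 + 3 * n := by
      have : (0 : ℝ) ≤ 1 + 3 * n := by positivity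
      nlinarith
    -- The increment is at most `6 * (2 n) + 1 + 2 + 2 (1 + 3 n) = 18 n + 5`, below `9 (n + 1) ^ 2 -
    -- 9 n ^ 2 = 18 n + 9`.
    push_cast
    nlinarith

/-! ### Decomposition of the past into independent blocks -/

/-- Remove the first word that contains a burger. -/
noncomputable def blockShift (Z : ℕ → Symb) : ℕ → Symb := shift (topTime Z) Z

/-- The first word that contains a burger. -/
noncomputable def blockWord (Z : ℕ → Symb) : List Symb := pastWord Z (topTime Z)

theorem measurable_blockShift : Measurable blockShift :=
  measurable_apply_nat measurable_shift measurable_topTime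

theorem measurable_blockWord : Measurable blockWord :=
  measurable_apply_nat measurable_pastWord measurable_topTime

theorem measure_eq_tsum_topTime (p : unitInterval) {E : Set (ℕ → Symb)} (hE : MeasurableSet E) :
    pastLaw p E = ∑' j : ℕ, pastLaw p (E ∩ {Z | topTime Z = j + 1}) := by
  rw [← measure_iUnion]
  · refine measure_congr ?_
    filter_upwards [ae_topTimes_nonempty p] with Z hZ
    have hpos := topTime_pos hZ
    refine propext ⟨fun h => ?_, fun h => ?_⟩
    · exact Set.mem_iUnion.mpr ⟨topTime Z - 1, h, by change topTime Z = _; omega⟩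
    · obtain ⟨j, hj, -⟩ := Set.mem_iUnion.mp h
      exact hj
  · intro i j hij
    rw [Function.onFun, Set.disjoint_left]
    rintro Z ⟨-, h1⟩ ⟨-, h2⟩
    have h1' : topTime Z = i + 1 := h1
    have h2' : topTime Z = j + 1 := h2
    omega
  · intro j
    exact hE.inter (measurableSet_topTime_eq_succ j)

/-- Strong Markov property at `J`: on `J = j + 1` the block is a function of the last `j + 1`
letters and the rest is a deterministic shift, so independence can be summed over `j`. -/
theorem measure_blockWord_inter (p : unitInterval) (A : Set (List Symb)) {B : Set (ℕ → Symb)}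
    (hB : MeasurableSet B) :
    pastLaw p (blockWord ⁻¹' A ∩ blockShift ⁻¹' B) = pastLaw p (blockWord ⁻¹' A) * pastLaw p B := by
  have hA : MeasurableSet (blockWord ⁻¹' A) := measurable_blockWord (MeasurableSet.of_discrete)
  rw [measure_eq_tsum_topTime p (hA.inter (measurable_blockShift hB)),
    measure_eq_tsum_topTime p hA, ← ENNReal.tsum_mul_right]
  refine tsum_congr fun j => ?_
  set S : Set (List Symb) := {w | w ∈ A ∧ (reduce w.tail).burgers = [] ∧ (reduce w).burgers ≠ []}
  have h1 : blockWord ⁻¹' A ∩ {Z | topTime Z = j + 1} = (fun Z => pastWord Z (j + 1)) ⁻¹' S := by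
    ext Z
    constructor
    · rintro ⟨h1, h2⟩
      have h2' : topTime Z = j + 1 := h2
      have h3 := (topTime_eq_succ_iff Z j).mp h2'
      refine ⟨?_, h3⟩
      have : blockWord Z ∈ A := h1
      rwa [blockWord, h2'] at this
    · rintro ⟨h1, h2⟩
      have h3 : topTime Z = j + 1 := (topTime_eq_succ_iff Z j).mpr h2
      refine ⟨?_, h3⟩
      change blockWord Z ∈ A
      rwa [blockWord, h3]
  have h2 : blockWord ⁻¹' A ∩ blockShift ⁻¹' B ∩ {Z | topTime Z = j + 1}
      = (fun Z => pastWord Z (j + 1)) ⁻¹' S ∩ shift (j + 1) ⁻¹' B := by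
    rw [← h1]
    ext Z
    constructor
    · rintro ⟨⟨a, b⟩, c⟩
      have c' : topTime Z = j + 1 := c
      have b' : blockShift Z ∈ B := b
      rw [blockShift, c'] at b'
      exact ⟨⟨a, c⟩, b'⟩
    · rintro ⟨⟨a, c⟩, b⟩
      have c' : topTime Z = j + 1 := c
      refine ⟨⟨a, ?_⟩, c⟩
      change blockShift Z ∈ B
      rw [blockShift, c']
      exact b
  rw [h2, h1, (indepFun_pastWord_shift p (j + 1)).measure_inter_preimage_eq_mul _ _
    MeasurableSet.of_discrete hB, (measurePreserving_shift p (j + 1)).measure_preimage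
    hB.nullMeasurableSet]

theorem measurePreserving_blockShift (p : unitInterval) :
    MeasurePreserving blockShift (pastLaw p) (pastLaw p) := by
  refine ⟨measurable_blockShift, ?_⟩
  ext B hB
  rw [Measure.map_apply measurable_blockShift hB]
  have := measure_blockWord_inter p Set.univ hB
  simpa using this

theorem indepFun_blockWord_blockShift (p : unitInterval) :
    IndepFun blockWord blockShift (pastLaw p) := by
  rw [indepFun_iff_measure_inter_preimage_eq_mul]
  intro A B _ hB
  rw [measure_blockWord_inter p A hB,
    (measurePreserving_blockShift p).measure_preimage hB.nullMeasurableSet]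

theorem measurePreserving_iterate_blockShift (p : unitInterval) (k : ℕ) :
    MeasurePreserving blockShift^[k] (pastLaw p) (pastLaw p) :=
  (measurePreserving_blockShift p).iterate k

theorem indepFun_comp_measurePreserving {p : unitInterval} {f g : (ℕ → Symb) → ℝ}
    {T : (ℕ → Symb) → (ℕ → Symb)} (hf : Measurable f) (hg : Measurable g)
    (hT : MeasurePreserving T (pastLaw p) (pastLaw p)) (h : IndepFun f g (pastLaw p)) :
    IndepFun (f ∘ T) (g ∘ T) (pastLaw p) := by
  rw [indepFun_iff_measure_inter_preimage_eq_mul] at h ⊢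
  intro A B hA hB
  have e := h A B hA hB
  rw [Set.preimage_comp, Set.preimage_comp, ← Set.preimage_inter,
    hT.measure_preimage ((hf hA).inter (hg hB)).nullMeasurableSet,
    hT.measure_preimage (hf hA).nullMeasurableSet, hT.measure_preimage (hg hB).nullMeasurableSet, e]

/-- A block is independent of everything older, and `blockShift` preserves the law, so the claim for
`i` follows from that for `0`. Pairwise independence is all the strong law used below requires. -/
theorem indepFun_blocks (p : unitInterval) (φ : List Symb → ℝ) {i j : ℕ} (hij : i < j) :
    IndepFun (fun Z => φ (blockWord (blockShift^[i] Z))) (fun Z => φ (blockWord (blockShift^[j] Z)))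
      (pastLaw p) := by
  obtain ⟨k, rfl⟩ := Nat.exists_eq_add_of_lt hij
  have hφ : Measurable φ := Measurable.of_discrete
  have hk : Measurable (fun Z => φ (blockWord (blockShift^[k] Z))) :=
    hφ.comp (measurable_blockWord.comp (measurable_blockShift.iterate k))
  have h1 := (indepFun_blockWord_blockShift p).comp (φ := φ) hφ hk
  have h2 := indepFun_comp_measurePreserving (hφ.comp measurable_blockWord)
    (hk.comp measurable_blockShift) (measurePreserving_iterate_blockShift p i) h1
  have e : (fun Z => φ (blockWord (blockShift^[i + k + 1] Z)))
      = ((fun Z => φ (blockWord (blockShift^[k] Z))) ∘ blockShift) ∘ blockShift^[i] := by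
    funext Z
    have : blockShift^[i + k + 1] Z = blockShift^[k] (blockShift (blockShift^[i] Z)) := by
      rw [← Function.iterate_succ_apply, ← Function.iterate_add_apply]
      congr 1; omega
    rw [this]; rfl
  rw [e]
  exact h2

/-- Law of large numbers for the blocks. -/
theorem ae_tendsto_block_average (p : unitInterval) (φ : List Symb → ℝ)
    (hi : Integrable (fun Z => φ (blockWord Z)) (pastLaw p)) :
    ∀ᵐ Z ∂(pastLaw p), Tendsto (fun n : ℕ =>
      (∑ i ∈ Finset.range n, φ (blockWord (blockShift^[i] Z))) / n) atTop
      (𝓝 (∫ Z, φ (blockWord Z) ∂(pastLaw p))) := by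
  have hφ : Measurable (fun Z => φ (blockWord Z)) :=
    (Measurable.of_discrete (f := φ)).comp measurable_blockWord
  refine strong_law_ae_real (fun i Z => φ (blockWord (blockShift^[i] Z))) hi ?_ ?_
  · intro i j hij
    rcases lt_or_gt_of_ne hij with h | h
    · exact indepFun_blocks p φ h
    · exact (indepFun_blocks p φ h).symm
  · intro i
    refine ⟨(hφ.comp (measurable_blockShift.iterate i)).aemeasurable, hφ.aemeasurable, ?_⟩
    have h := (measurePreserving_iterate_blockShift p i).map_eq
    change Measure.map ((fun Z => φ (blockWord Z)) ∘ blockShift^[i]) _ = Measure.map _ _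
    rw [← Measure.map_map hφ (measurable_blockShift.iterate i), h]
    rfl

/-- The end of the `k`-th block. -/
noncomputable def blockEnd (Z : ℕ → Symb) : ℕ → ℕ
  | 0 => 0
  | k + 1 => blockEnd Z k + topTime (shift (blockEnd Z k) Z)

theorem iterate_blockShift (Z : ℕ → Symb) (k : ℕ) :
    blockShift^[k] Z = shift (blockEnd Z k) Z := by
  induction k with
  | zero => rfl
  | succ k ih =>
    rw [Function.iterate_succ_apply', ih, blockShift, shift_shift, blockEnd, add_comm]

theorem measurable_blockEnd (k : ℕ) : Measurable (fun Z => blockEnd Z k) := by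
  induction k with
  | zero => exact measurable_const
  | succ k ih =>
    exact ih.add (measurable_topTime.comp (measurable_apply_nat measurable_shift ih))

/-- The change of the discrepancy over a block. -/
def blockDisc (w : List Symb) : ℝ := (w.headD Symb.flexOrder).disc * (reduce w).length

theorem blockDisc_blockWord {Z : ℕ → Symb} (h : (topTimes Z).Nonempty) :
    blockDisc (blockWord Z) = (topBurger Z).disc * topLength Z := by
  obtain ⟨j, hj⟩ := Nat.exists_eq_add_of_lt (topTime_pos h)
  rw [zero_add] at hj
  rw [blockDisc, blockWord, hj, ← topBurger_of_topTime hj, ← topLength_of_topTime hj]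

theorem sum_blockDisc {Z : ℕ → Symb} (h : ∀ k, (topTimes (shift k Z)).Nonempty) (k : ℕ) :
    ∑ i ∈ Finset.range k, blockDisc (blockWord (blockShift^[i] Z)) = pastDisc Z (blockEnd Z k) := by
  induction k with
  | zero => simp [blockEnd, pastDisc]
  | succ k ih =>
    rw [Finset.sum_range_succ, ih, blockEnd, pastDisc_add, pastDisc_topTime (h _),
      iterate_blockShift, blockDisc_blockWord (h _)]
    push_cast; ring

theorem sum_blockLength {Z : ℕ → Symb} (h : ∀ k, (topTimes (shift k Z)).Nonempty) (k : ℕ) :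
    ∑ i ∈ Finset.range k, (2 - ((reduce (blockWord (blockShift^[i] Z))).length : ℝ))
      = pastCount Z (blockEnd Z k) := by
  induction k with
  | zero => simp [blockEnd, pastCount]
  | succ k ih =>
    rw [Finset.sum_range_succ, ih, blockEnd, pastCount_add, pastCount_topTime (h _),
      iterate_blockShift]
    push_cast; rfl

theorem integrable_blockDisc (p : unitInterval) :
    Integrable (fun Z => blockDisc (blockWord Z)) (pastLaw p) := by
  refine (integrable_topLength p).mono
    ((Measurable.of_discrete (f := blockDisc)).comp measurable_blockWord).aestronglyMeasurable
    (Eventually.of_forall fun Z => ?_)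
  rw [blockDisc, norm_mul, Real.norm_eq_abs]
  exact mul_le_of_le_one_left (norm_nonneg _) (abs_disc_real_le _)

/-- Flipping the foods preserves the length of the block and reverses the sign of its burger. The
default letter of `headD` is harmless, being fixed by the flip. -/
theorem integral_blockDisc (p : unitInterval) :
    ∫ Z, blockDisc (blockWord Z) ∂(pastLaw p) = 0 := by
  refine integral_eq_zero_of_flip p
    ((Measurable.of_discrete (f := blockDisc)).comp measurable_blockWord) fun Z => ?_
  rw [blockWord, topTime_flip, pastWord_flip, ← blockWord]
  rw [blockDisc, blockDisc, reduce_map_flip]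
  have h1 : (((blockWord Z).map Symb.flip).headD Symb.flexOrder)
      = ((blockWord Z).headD Symb.flexOrder).flip := by
    cases blockWord Z <;> simp [Symb.flip]
  rw [h1, disc_flip]
  simp [RWord.length, RWord.toWord]

theorem ae_tendsto_count_blockEnd (p : unitInterval) : ∀ᵐ Z ∂(pastLaw p),
    Tendsto (fun n : ℕ => (pastCount Z (blockEnd Z n) : ℝ) / n) atTop (𝓝 (2 - meanLength p)) := by
  have hi : Integrable (fun Z => 2 - ((reduce (blockWord Z)).length : ℝ)) (pastLaw p) :=
    (integrable_const 2).sub (integrable_topLength p)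
  have h := ae_tendsto_block_average p (fun w => 2 - ((reduce w).length : ℝ)) hi
  have hm : ∫ Z, (2 - ((reduce (blockWord Z)).length : ℝ)) ∂(pastLaw p) = 2 - meanLength p := by
    refine (integral_sub (integrable_const 2) (integrable_topLength p)).trans ?_
    simp [meanLength]
  rw [hm] at h
  filter_upwards [h, ae_forall_topTimes_nonempty p] with Z hZ hZ'
  simp_rw [sum_blockLength hZ'] at hZ
  exact hZ

theorem ae_tendsto_disc_blockEnd (p : unitInterval) : ∀ᵐ Z ∂(pastLaw p),
    Tendsto (fun n : ℕ => (pastDisc Z (blockEnd Z n) : ℝ) / n) atTop (𝓝 0) := by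
  have h := ae_tendsto_block_average p blockDisc (integrable_blockDisc p)
  rw [integral_blockDisc] at h
  filter_upwards [h, ae_forall_topTimes_nonempty p] with Z hZ hZ'
  simp_rw [sum_blockDisc hZ'] at hZ
  exact hZ

/-- Makes the linear asymptotics uniform over all `k ≤ N` with error `ε * N`: the finitely many `k`
before convergence sets in have bounded error. -/
theorem eventually_forall_abs_sub_le {a : ℕ → ℝ} {l : ℝ}
    (h : Tendsto (fun n : ℕ => a n / n) atTop (𝓝 l)) {ε : ℝ} (hε : 0 < ε) :
    ∀ᶠ N : ℕ in atTop, ∀ k ≤ N, |a k - l * k| ≤ ε * N := by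
  obtain ⟨k₀, hk₀⟩ := Metric.tendsto_atTop.mp h ε hε
  set M := ∑ k ∈ Finset.range (k₀ + 1), |a k - l * k|
  obtain ⟨N₀, hN₀⟩ := exists_nat_ge (M / ε)
  filter_upwards [eventually_ge_atTop N₀] with N hN k hk
  have hkN : (k : ℝ) ≤ N := by exact_mod_cast hk
  rcases Nat.lt_or_ge k (k₀ + 1) with h1 | h1
  · have h2 : |a k - l * k| ≤ M :=
      Finset.single_le_sum (f := fun k : ℕ => |a k - l * k|) (fun i _ => abs_nonneg _)
        (Finset.mem_range.mpr h1)
    have h3 : (N₀ : ℝ) ≤ N := by exact_mod_cast hN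
    have h4 : M ≤ ε * N := by
      rw [div_le_iff₀ hε] at hN₀; nlinarith
    exact h2.trans h4
  · have hk0 : (0 : ℝ) < k := by exact_mod_cast (by omega : 0 < k)
    have h2 := hk₀ k (by omega)
    rw [Real.dist_eq] at h2
    have h3 : |a k - l * k| = |a k / k - l| * k := by
      rw [← abs_of_pos hk0, ← abs_mul, abs_of_pos hk0]
      congr 1; field_simp
    rw [h3]
    have := mul_le_mul_of_nonneg_right h2.le hk0.le
    nlinarith

/-- The first `N` blocks obey the law of large numbers up to `ε N`. -/
def Regular (p : unitInterval) (ε : ℝ) (N : ℕ) (Z : ℕ → Symb) : Prop :=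
  ∀ k ≤ N, |(pastCount Z (blockEnd Z k) : ℝ) - (2 - meanLength p) * k| ≤ ε * N ∧
    |(pastDisc Z (blockEnd Z k) : ℝ)| ≤ ε * N

theorem measurableSet_regular (p : unitInterval) (ε : ℝ) (N : ℕ) :
    MeasurableSet {Z | Regular p ε N Z} := by
  have h1 : ∀ k, Measurable (fun Z => (pastCount Z (blockEnd Z k) : ℝ)) := fun k =>
    measurable_apply_nat measurable_pastCount_real (measurable_blockEnd k)
  have h2 : ∀ k, Measurable (fun Z => (pastDisc Z (blockEnd Z k) : ℝ)) := fun k =>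
    measurable_apply_nat measurable_pastDisc_real (measurable_blockEnd k)
  have : {Z | Regular p ε N Z} = ⋂ k, ⋂ (_ : k ≤ N),
      ({Z | |(pastCount Z (blockEnd Z k) : ℝ) - (2 - meanLength p) * k| ≤ ε * N} ∩
        {Z | |(pastDisc Z (blockEnd Z k) : ℝ)| ≤ ε * N}) := by
    ext Z; simp [Regular]
  rw [this]
  refine MeasurableSet.iInter fun k => MeasurableSet.iInter fun _ => MeasurableSet.inter ?_ ?_
  · exact measurableSet_le ((h1 k).sub measurable_const).abs measurable_const
  · exact measurableSet_le (h2 k).abs measurable_const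

theorem tendsto_measure_not_regular (p : unitInterval) {ε : ℝ} (hε : 0 < ε) :
    Tendsto (fun N => (pastLaw p).real {Z | ¬ Regular p ε N Z}) atTop (𝓝 0) := by
  have h : Tendsto (fun N => ∫ Z, ({Z | ¬ Regular p ε N Z}).indicator (1 : (ℕ → Symb) → ℝ) Z
      ∂(pastLaw p)) atTop (𝓝 (∫ _Z, (0 : ℝ) ∂(pastLaw p))) := by
    refine tendsto_integral_of_dominated_convergence (fun _ => 1)
      (fun N => ((measurable_one).indicator
        (measurableSet_regular p ε N).compl).aestronglyMeasurable)
      (integrable_const _) (fun N => Eventually.of_forall fun Z => ?_) ?_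
    · by_cases hZ : Regular p ε N Z <;> simp [Set.indicator, hZ]
    · filter_upwards [ae_tendsto_count_blockEnd p, ae_tendsto_disc_blockEnd p] with Z h1 h2
      have e1 := eventually_forall_abs_sub_le h1 hε
      have e2 := eventually_forall_abs_sub_le h2 hε
      refine tendsto_const_nhds.congr' ?_
      filter_upwards [e1, e2] with N hN1 hN2
      have : Regular p ε N Z := fun k hk => ⟨hN1 k hk, by simpa using hN2 k hk⟩
      simp [Set.indicator, this]
  simp only [integral_zero] at h
  refine h.congr fun N => ?_
  exact integral_indicator_one (measurableSet_regular p ε N).compl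

/-! ### The discrepancy is small when the blocks have positive drift -/

theorem blockEnd_lt_succ {Z : ℕ → Symb} (h : ∀ k, (topTimes (shift k Z)).Nonempty) (k : ℕ) :
    blockEnd Z k < blockEnd Z (k + 1) := by
  have := topTime_pos (h (blockEnd Z k))
  rw [blockEnd]; omega

theorem exists_block {Z : ℕ → Symb} (h : ∀ k, (topTimes (shift k Z)).Nonempty) (s : ℕ) :
    ∃ i, blockEnd Z i ≤ s ∧ s < blockEnd Z (i + 1) := by
  have hmono : StrictMono (blockEnd Z) := strictMono_nat_of_lt_succ (blockEnd_lt_succ h)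
  classical
  have hex : ∃ k, s < blockEnd Z k := ⟨s + 1, lt_of_lt_of_le (Nat.lt_succ_self s) (hmono.le_apply)⟩
  have h1 := Nat.find_spec hex
  have h0 : Nat.find hex ≠ 0 := by
    intro h0; rw [h0] at h1; simp [blockEnd] at h1
  refine ⟨Nat.find hex - 1, ?_, ?_⟩
  · have := Nat.find_min hex (m := Nat.find hex - 1) (by omega)
    omega
  · rwa [Nat.sub_add_cancel (by omega)]

theorem burgers_nil_in_block {Z : ℕ → Symb} (h : ∀ k, (topTimes (shift k Z)).Nonempty) {s i : ℕ}
    (h1 : blockEnd Z i ≤ s) (h2 : s < blockEnd Z (i + 1)) :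
    (pastRed (shift (blockEnd Z i) Z) (s - blockEnd Z i)).burgers = [] := by
  rw [burgers_eq_nil_iff (h _)]
  rw [blockEnd] at h2
  omega

/-- Inside a block the count never exceeds its value at the start of the block, so bounds at block
ends control the running maximum. -/
theorem pastCount_le_of_regular {p : unitInterval} {ε : ℝ} {L : ℕ} {Z : ℕ → Symb}
    (h : ∀ k, (topTimes (shift k Z)).Nonempty) (hR : Regular p ε L Z) {s : ℕ}
    (hs : s ≤ blockEnd Z L) :
    (pastCount Z s : ℝ) ≤ (2 - meanLength p) * L + ε * L := by
  have hκ : 0 ≤ 2 - meanLength p := by linarith [meanLength_le_two p]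
  have hmono : StrictMono (blockEnd Z) := strictMono_nat_of_lt_succ (blockEnd_lt_succ h)
  obtain ⟨i, h1, h2⟩ := exists_block h s
  have hi : i ≤ L := hmono.le_iff_le.mp (h1.trans hs)
  have h3 := pastCount_nonpos_of_burgers_nil (burgers_nil_in_block h h1 h2)
  have h4 := pastCount_add Z (blockEnd Z i) (s - blockEnd Z i)
  rw [Nat.add_sub_cancel' h1] at h4
  have h5 : (pastCount Z s : ℝ) ≤ pastCount Z (blockEnd Z i) := by exact_mod_cast (by linarith)
  have h6 := (abs_le.mp (hR i hi).1).2
  have h7 : (i : ℝ) ≤ L := by exact_mod_cast hi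
  have := mul_le_mul_of_nonneg_left h7 hκ
  linarith

/-- Compute `D_T` at the end `T ≥ n` of the `L`-th block in two ways: by the blocks counted from
`0`, and as `D_n` plus the blocks counted from `n` plus an incomplete block. All pieces but `D_n`
are small: at most `ε L`, `4 ε L` and `2 ε L`. -/
theorem abs_pastDisc_le_of_regular {p : unitInterval} {ε : ℝ} {L n : ℕ} {Z : ℕ → Symb}
    (h : ∀ k, (topTimes (shift k Z)).Nonempty) (hL : 0 < L) (hε : 0 < ε)
    (hεκ : 4 * ε ≤ 2 - meanLength p)
    (hR : Regular p ε L Z) (hR' : Regular p ε (4 * L) (shift n Z)) (hn : n ≤ blockEnd Z L)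
    (hc : |(pastCount Z n : ℝ)| ≤ (2 - meanLength p) * L) :
    |(pastDisc Z n : ℝ)| ≤ 7 * ε * L := by
  set κ := 2 - meanLength p
  have hL' : (0 : ℝ) < L := by exact_mod_cast hL
  have h' : ∀ k, (topTimes (shift k (shift n Z))).Nonempty := fun k => by
    rw [shift_shift]; exact h _
  have hmono : StrictMono (blockEnd (shift n Z)) :=
    strictMono_nat_of_lt_succ (blockEnd_lt_succ h')
  set T := blockEnd Z L with hT
  obtain ⟨K, hK1, hK2⟩ := exists_block h' (T - n)
  -- Otherwise `4 L` blocks counted from `n` would fit before `T` and lift the count to at least `-κ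
  -- L + 4 κ L - 4 ε L`, above the maximum `(κ + ε) L`.
  have hKL : K ≤ 4 * L := by
    by_contra hlt
    have hlt' : 4 * L ≤ K := by omega
    have h1 : blockEnd (shift n Z) (4 * L) ≤ T - n := (hmono.monotone hlt').trans hK1
    have h2 := pastCount_le_of_regular h hR (s := n + blockEnd (shift n Z) (4 * L)) (by omega)
    rw [pastCount_add] at h2
    have h3 := (abs_le.mp (hR' (4 * L) le_rfl).1).1
    have h4 := (abs_le.mp hc).1
    push_cast at h2 h3
    nlinarith
  have hd1 := (hR L le_rfl).2
  have hd2 := (hR' K hKL).2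
  have hnil := burgers_nil_in_block h' hK1 hK2
  have hd3 := abs_pastDisc_real_le_of_nil hnil
  set s := blockEnd (shift n Z) K
  have e1 : pastDisc Z T = pastDisc Z n + (pastDisc (shift n Z) s +
      pastDisc (shift s (shift n Z)) (T - n - s)) := by
    rw [← pastDisc_add, ← pastDisc_add]; congr 1; omega
  have e2 : pastCount Z T = pastCount Z (n + s) + pastCount (shift s (shift n Z)) (T - n - s) := by
    rw [shift_shift, add_comm s n, ← pastCount_add]; congr 1; omega
  have e1' : (pastDisc Z T : ℝ) = pastDisc Z n + (pastDisc (shift n Z) s +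
      pastDisc (shift s (shift n Z)) (T - n - s)) := by exact_mod_cast e1
  have e2' : (pastCount Z T : ℝ) = pastCount Z (n + s) +
      pastCount (shift s (shift n Z)) (T - n - s) := by exact_mod_cast e2
  -- The leftover lies inside a block, so its discrepancy is at most the drop of the count across
  -- it, which is at most `(κ + ε) L - (κ - ε) L = 2 ε L`.
  have h5 := pastCount_le_of_regular h hR (s := n + s) (by omega)
  have h6 := (abs_le.mp (hR L le_rfl).1).1
  rw [abs_le] at hd1 hd2 hd3 ⊢
  push_cast at hd2
  rw [← hT] at hd1 h6
  constructor <;> linarith [hd1.1, hd1.2, hd2.1, hd2.2, hd3.1, hd3.2]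

theorem measure_pastDisc_gt_le (p : unitInterval) {ε : ℝ} {L n : ℕ} (hL : 0 < L) (hε : 0 < ε)
    (hεκ : 4 * ε ≤ 2 - meanLength p) :
    (pastLaw p).real {Z | 7 * ε * L < |(pastDisc Z n : ℝ)|} ≤
      (pastLaw p).real {Z | ¬ Regular p ε L Z} + (pastLaw p).real {Z | ¬ Regular p ε (4 * L) Z} +
      17 * n / ((2 - meanLength p) * L) ^ 2 := by
  set κ := 2 - meanLength p with hκdef
  have hκ : 0 < κ := by linarith
  have hL' : (0 : ℝ) < L := by exact_mod_cast hL
  have hsub : {Z | 7 * ε * L < |(pastDisc Z n : ℝ)|} ≤ᵐ[pastLaw p]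
      ({Z | ¬ Regular p ε L Z} ∪ (shift n) ⁻¹' {Z | ¬ Regular p ε (4 * L) Z} ∪
        ({Z | ∃ j ≤ n, κ * L / 2 ≤ pastCount Z j} ∪ {Z | κ * L ≤ |(pastCount Z n : ℝ)|}) :
        Set (ℕ → Symb)) := by
    filter_upwards [ae_forall_topTimes_nonempty p] with Z hZ hD
    by_contra hcon
    have hcon' : Z ∉ {Z | ¬ Regular p ε L Z} ∪ (shift n) ⁻¹' {Z | ¬ Regular p ε (4 * L) Z} ∪
        ({Z | ∃ j ≤ n, κ * L / 2 ≤ pastCount Z j} ∪ {Z | κ * L ≤ |(pastCount Z n : ℝ)|}) := hcon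
    simp only [Set.mem_union, not_or] at hcon'
    obtain ⟨⟨h1, h2⟩, h3, h4⟩ := hcon'
    have h1' : Regular p ε L Z := not_not.mp h1
    have h2' : Regular p ε (4 * L) (shift n Z) := not_not.mp h2
    have h3' : ¬ ∃ j ≤ n, κ * L / 2 ≤ pastCount Z j := h3
    have h4' : ¬ κ * L ≤ |(pastCount Z n : ℝ)| := h4
    -- If `L` blocks took fewer than `n` letters, the walk would have reached `(κ - ε) L ≥ κ L / 2`
    -- before time `n`.
    have hn : n ≤ blockEnd Z L := by
      by_contra hn
      refine h3' ⟨blockEnd Z L, by omega, ?_⟩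
      have := (abs_le.mp (h1' L le_rfl).1).1
      rw [← hκdef] at this
      nlinarith
    have := abs_pastDisc_le_of_regular hZ hL hε hεκ h1' h2' hn (not_le.mp h4').le
    exact absurd hD (not_lt.mpr this)
  have hle : (pastLaw p).real {Z | 7 * ε * L < |(pastDisc Z n : ℝ)|} ≤ (pastLaw p).real
      ({Z | ¬ Regular p ε L Z} ∪ (shift n) ⁻¹' {Z | ¬ Regular p ε (4 * L) Z} ∪
        ({Z | ∃ j ≤ n, κ * L / 2 ≤ pastCount Z j} ∪ {Z | κ * L ≤ |(pastCount Z n : ℝ)|})) :=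
    ENNReal.toReal_mono (measure_ne_top _ _) (measure_mono_ae hsub)
  refine hle.trans ((measureReal_union_le _ _).trans ?_)
  have hs := (measurePreserving_shift p n).measureReal_preimage
    (measurableSet_regular p ε (4 * L)).compl.nullMeasurableSet
  have hs' : (pastLaw p).real ((shift n) ⁻¹' {Z | ¬ Regular p ε (4 * L) Z})
      = (pastLaw p).real {Z | ¬ Regular p ε (4 * L) Z} := hs
  have h1 := measureReal_union_le (μ := pastLaw p) {Z | ¬ Regular p ε L Z}
    ((shift n) ⁻¹' {Z | ¬ Regular p ε (4 * L) Z})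
  have h2 := measureReal_union_le (μ := pastLaw p) {Z | ∃ j ≤ n, κ * L / 2 ≤ pastCount Z j}
    {Z | κ * L ≤ |(pastCount Z n : ℝ)|}
  have h3 := measure_max_ge_le p n (a := κ * L / 2) (by positivity)
  have h4 := measure_count_ge_le p n (a := κ * L) (by positivity)
  have e : 17 * (n : ℝ) / (κ * L) ^ 2 = 4 * n / (κ * L / 2) ^ 2 + n / (κ * L) ^ 2 := by
    field_simp; ring
  rw [e]
  linarith

/-- Beyond the level `a` use `D ^ 2 ≤ δ D ^ 4 / (2 n) + n / (2 δ)`; the fourth moment bound `9 n ^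
2` turns the first term into `9 / 2 * δ * n`. -/
theorem discMoment_two_le_of_measure (p : unitInterval) {n : ℕ} (hn : 0 < n) {a δ : ℝ}
    (hδ : 0 < δ) :
    discMoment p 2 n ≤ a ^ 2 + 9 / 2 * δ * n +
      n / (2 * δ) * (pastLaw p).real {Z | a < |(pastDisc Z n : ℝ)|} := by
  have hn' : (0 : ℝ) < n := by exact_mod_cast hn
  have hm : MeasurableSet {Z | a < |(pastDisc Z n : ℝ)|} :=
    measurableSet_lt measurable_const (measurable_pastDisc_real n).abs
  have i1 : Integrable (fun Z => δ / (2 * n) * (pastDisc Z n : ℝ) ^ 4) (pastLaw p) :=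
    (integrable_pastDisc_pow p n 4).const_mul _
  have i2 : Integrable (fun Z => n / (2 * δ) * ({Z | a < |(pastDisc Z n : ℝ)|}).indicator
      (1 : (ℕ → Symb) → ℝ) Z) (pastLaw p) :=
    ((integrable_const (1 : ℝ)).indicator hm).const_mul _
  have i3 : Integrable (fun _ : ℕ → Symb => a ^ 2) (pastLaw p) := integrable_const _
  have i12 : Integrable (fun Z => δ / (2 * n) * (pastDisc Z n : ℝ) ^ 4 +
      n / (2 * δ) * ({Z | a < |(pastDisc Z n : ℝ)|}).indicator (1 : (ℕ → Symb) → ℝ) Z)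
      (pastLaw p) := i1.add i2
  have h := integral_mono (integrable_pastDisc_pow p n 2) (i3.add i12) fun Z => by
    simp only [Pi.add_apply]
    have h4 : 0 ≤ δ / (2 * n) * (pastDisc Z n : ℝ) ^ 4 := by positivity
    by_cases hZ : a < |(pastDisc Z n : ℝ)|
    · have e1 : ({Z | a < |(pastDisc Z n : ℝ)|}).indicator (1 : (ℕ → Symb) → ℝ) Z = 1 := by
        simp [Set.indicator, hZ]
      rw [e1]
      set D := (pastDisc Z n : ℝ)
      have e2 : δ / (2 * n) * D ^ 4 + n / (2 * δ) * 1 - D ^ 2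
          = (δ * D ^ 2 - n) ^ 2 / (2 * n * δ) := by
        field_simp; ring
      have e3 : 0 ≤ (δ * D ^ 2 - n) ^ 2 / (2 * n * δ) := by positivity
      nlinarith [sq_nonneg a]
    · have e1 : ({Z | a < |(pastDisc Z n : ℝ)|}).indicator (1 : (ℕ → Symb) → ℝ) Z = 0 := by
        simp [Set.indicator, hZ]
      rw [e1, ← sq_abs (pastDisc Z n : ℝ)]
      have := pow_le_pow_left₀ (abs_nonneg _) (not_lt.mp hZ) 2
      linarith
  simp only [Pi.add_apply] at h
  rw [integral_add i3 i12, integral_add i1 i2, integral_const_mul, integral_const_mul,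
    integral_indicator_one hm] at h
  have h4 := discMoment_four_le p n
  have h5 : δ / (2 * n) * ∫ Z, (pastDisc Z n : ℝ) ^ 4 ∂(pastLaw p) ≤ 9 / 2 * δ * n := by
    calc _ ≤ δ / (2 * n) * (9 * (n : ℝ) ^ 2) := mul_le_mul_of_nonneg_left h4 (by positivity)
      _ = _ := by field_simp
  simp only [integral_const, probReal_univ, smul_eq_mul, one_mul] at h
  refine h.trans ?_
  linarith

/-- If the blocks have positive drift, the second moment of the discrepancy is sublinear. -/
theorem tendsto_discMoment_two_div (p : unitInterval) (hχ : meanLength p < 2) :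
    Tendsto (fun n : ℕ => discMoment p 2 n / n) atTop (𝓝 0) := by
  have hnonneg : ∀ n : ℕ, 0 ≤ discMoment p 2 n / n := fun n =>
    div_nonneg (integral_nonneg fun Z => sq_nonneg _) (Nat.cast_nonneg _)
  rw [Metric.tendsto_atTop']
  intro η hη
  set κ := 2 - meanLength p with hκdef
  have hκ : 0 < κ := by linarith
  -- The target is `η / 2 * n`. This `δ` makes the fourth moment term `η / 8 * n`; `A` then makes
  -- the random walk estimates with `L ≈ A √n` cost at most `δ * η / 4`; `ε` makes `(7 ε L) ^ 2 ≤ η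
  -- / 8 * n`, where `196 = 49 * 4` comes from `L ≤ 2 A √n`.
  set δ := η / 36 with hδdef
  have hδ : 0 < δ := by positivity
  obtain ⟨A, hA1, hA2⟩ : ∃ A : ℝ, 1 ≤ A ∧ 17 / (κ ^ 2 * A ^ 2) ≤ δ * η / 4 := by
    refine ⟨max 1 (17 * 4 / (κ ^ 2 * (δ * η))), le_max_left _ _, ?_⟩
    set A := max 1 (17 * 4 / (κ ^ 2 * (δ * η)))
    have h1 : 1 ≤ A := le_max_left _ _
    have h2 : 17 * 4 / (κ ^ 2 * (δ * η)) ≤ A := le_max_right _ _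
    rw [div_le_iff₀ (by positivity)] at h2 ⊢
    have h3 : A * (κ ^ 2 * (δ * η)) ≤ A ^ 2 * (κ ^ 2 * (δ * η)) :=
      mul_le_mul_of_nonneg_right (by nlinarith) (by positivity)
    nlinarith
  have hA : 0 < A := by linarith
  obtain ⟨ε, hε, hε1, hε2⟩ : ∃ ε : ℝ, 0 < ε ∧ 4 * ε ≤ κ ∧ 196 * ε ^ 2 * A ^ 2 ≤ η / 8 := by
    refine ⟨min (κ / 4) (min 1 (η / (8 * 196 * A ^ 2))), by positivity, ?_, ?_⟩
    · have := min_le_left (κ / 4) (min 1 (η / (8 * 196 * A ^ 2)))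
      linarith
    · set ε := min (κ / 4) (min 1 (η / (8 * 196 * A ^ 2)))
      have h0 : 0 < ε := by positivity
      have h1 : ε ≤ 1 := (min_le_right _ _).trans (min_le_left _ _)
      have h2 : ε ≤ η / (8 * 196 * A ^ 2) := (min_le_right _ _).trans (min_le_right _ _)
      rw [le_div_iff₀ (by positivity)] at h2
      have h3 : ε ^ 2 ≤ ε := by nlinarith
      have h4 : 0 < A ^ 2 := by positivity
      nlinarith [mul_le_mul_of_nonneg_right h3 h4.le]
  have hb1 := tendsto_measure_not_regular p hε
  have hb2 : Tendsto (fun N => (pastLaw p).real {Z | ¬ Regular p ε (4 * N) Z}) atTop (𝓝 0) :=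
    hb1.comp (tendsto_id.const_mul_atTop' (by norm_num : 0 < 4))
  have hb := hb1.add hb2
  rw [add_zero] at hb
  have hLt : Tendsto (fun n : ℕ => ⌈A * Real.sqrt n⌉₊) atTop atTop :=
    tendsto_nat_ceil_atTop.comp
      ((Real.tendsto_sqrt_atTop.comp tendsto_natCast_atTop_atTop).const_mul_atTop hA)
  have hev := (hb.comp hLt).eventually (gt_mem_nhds (by positivity : 0 < δ * η / 4))
  obtain ⟨n₀, hn₀⟩ := eventually_atTop.mp hev
  refine ⟨n₀ + 1, fun n hn => ?_⟩
  have hn' := hn₀ n (by omega)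
  have hnpos : 0 < n := by omega
  have hnR : (0 : ℝ) < n := by exact_mod_cast hnpos
  have hn1 : (1 : ℝ) ≤ n := by exact_mod_cast hnpos
  have hr1 : 1 ≤ Real.sqrt n := Real.one_le_sqrt.mpr hn1
  have hrr : Real.sqrt n * Real.sqrt n = n := Real.mul_self_sqrt hnR.le
  simp only [Function.comp_apply] at hn'
  set L := ⌈A * Real.sqrt n⌉₊ with hLdef
  set r := Real.sqrt n
  have hL1 : A * r ≤ L := Nat.le_ceil _
  have hAr : 1 ≤ A * r := by nlinarith
  have hL2 : (L : ℝ) ≤ 2 * (A * r) := by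
    have := Nat.ceil_lt_add_one (by positivity : 0 ≤ A * r)
    linarith
  have hL0 : 0 < L := by
    have : (0 : ℝ) < L := by linarith
    exact_mod_cast this
  have hm := measure_pastDisc_gt_le p (n := n) hL0 hε hε1
  rw [← hκdef] at hm
  have hm2 : 17 * (n : ℝ) / (κ * L) ^ 2 ≤ δ * η / 4 := by
    refine le_trans ?_ hA2
    rw [div_le_div_iff₀ (by positivity) (by positivity)]
    have h1 : (A * r) ^ 2 ≤ (L : ℝ) ^ 2 := pow_le_pow_left₀ (by positivity) hL1 2
    have h2 : (A * r) ^ 2 = A ^ 2 * n := by rw [mul_pow, sq r, hrr]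
    rw [h2] at h1
    have h3 := mul_le_mul_of_nonneg_left h1 (by positivity : 0 ≤ κ ^ 2)
    nlinarith
  have hv := discMoment_two_le_of_measure p hnpos (a := 7 * ε * L) hδ
  have hm3 : (pastLaw p).real {Z | 7 * ε * L < |(pastDisc Z n : ℝ)|} ≤ δ * η / 2 := by linarith
  have h6 : (7 * ε * L) ^ 2 ≤ η / 8 * n := by
    have h1 : (L : ℝ) ^ 2 ≤ 4 * (A ^ 2 * n) := by
      have := pow_le_pow_left₀ (by positivity) hL2 2
      calc (L : ℝ) ^ 2 ≤ _ := this
        _ = 4 * (A ^ 2 * (r * r)) := by ring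
        _ = _ := by rw [hrr]
    calc (7 * ε * L) ^ 2 = 49 * ε ^ 2 * (L : ℝ) ^ 2 := by ring
      _ ≤ 49 * ε ^ 2 * (4 * (A ^ 2 * n)) := mul_le_mul_of_nonneg_left h1 (by positivity)
      _ = 196 * ε ^ 2 * A ^ 2 * n := by ring
      _ ≤ _ := mul_le_mul_of_nonneg_right hε2 hnR.le
  have h7 : n / (2 * δ) * (pastLaw p).real {Z | 7 * ε * L < |(pastDisc Z n : ℝ)|}
      ≤ η / 4 * n := by
    calc _ ≤ n / (2 * δ) * (δ * η / 2) := mul_le_mul_of_nonneg_left hm3 (by positivity)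
      _ = _ := by field_simp; ring
  rw [Real.dist_eq, sub_zero, abs_of_nonneg (hnonneg n), div_lt_iff₀ hnR]
  have h8 : 9 / 2 * δ * n = η / 8 * n := by rw [hδdef]; ring
  nlinarith

/-! ### Linear growth of the second moment -/

theorem integral_abs_pastDisc_le (p : unitInterval) (k : ℕ) {c : ℝ} (hc : 0 < c) :
    ∫ Z, |(pastDisc Z k : ℝ)| ∂(pastLaw p) ≤ discMoment p 2 k / (2 * c) + c / 2 := by
  have i1 : Integrable (fun Z => |(pastDisc Z k : ℝ)|) (pastLaw p) := by
    have := (integrable_pastDisc_pow p k 1).abs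
    simpa using this
  have h := integral_mono i1 (((integrable_pastDisc_pow p k 2).div_const (2 * c)).add
    (integrable_const (c / 2))) fun Z => by
      simp only [Pi.add_apply]
      rw [← sq_abs (pastDisc Z k : ℝ)]
      set x := |(pastDisc Z k : ℝ)|
      have e : x ^ 2 / (2 * c) + c / 2 - x = (x - c) ^ 2 / (2 * c) := by field_simp; ring
      have : 0 ≤ (x - c) ^ 2 / (2 * c) := by positivity
      linarith
  simp only [Pi.add_apply] at h
  rw [integral_add ((integrable_pastDisc_pow p k 2).div_const (2 * c)) (integrable_const _),
    integral_div] at h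
  simpa [discMoment] using h

/-- Split `D_N` at an intermediate time `i`. The older part is independent of `J > i`, which
contains `J > N`. The newer part is at most `-C_i`, and `-m ≤ b m ^ 2 / 2 + 1 / (2 b)` lets the
second moment be taken on `J > i` and the constant on `J > N`. -/
theorem absNil_le_split (p : unitInterval) {i N : ℕ} (hi : 0 < i) (hiN : i ≤ N) {c b : ℝ}
    (hc : 0 < c) (hb : 0 < b) :
    absNil p N ≤ (discMoment p 2 (N - i) / (2 * c) + c / 2) * (4 / Real.sqrt i) +
      (b / 2 * (5 / 2 * Real.sqrt i) + 1 / (2 * b) * (4 / Real.sqrt N)) := by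
  have i1 : Integrable (fun Z => (if (pastRed Z i).burgers = [] then (1 : ℝ) else 0) *
      |(pastDisc (shift i Z) (N - i) : ℝ)|) (pastLaw p) := by
    refine integrable_of_abs_le ((measurable_of_pastWord i fun w =>
      if (reduce w).burgers = [] then (1 : ℝ) else 0).mul
      ((measurable_pastDisc_real (N - i)).comp (measurable_shift i)).abs) ((N - i : ℕ) : ℝ)
      fun Z => ?_
    have h1 := abs_pastDisc_real_le (shift i Z) (N - i)
    rw [abs_mul, abs_abs]
    refine (mul_le_of_le_one_left (abs_nonneg _) ?_).trans h1
    split_ifs <;> simp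
  have i2 : Integrable (fun Z => b / 2 * (if (pastRed Z i).burgers = [] then
      (pastCount Z i : ℝ) ^ 2 else 0)) (pastLaw p) := by
    simp_rw [← wordCount_pastWord]
    exact (integrable_ite_burgers_nil p i fun w => (wordCount w : ℝ) ^ 2).const_mul _
  have i3 : Integrable (fun Z => 1 / (2 * b) * (if (pastRed Z N).burgers = [] then
      (1 : ℝ) else 0)) (pastLaw p) :=
    (integrable_ite_burgers_nil p N fun _ => 1).const_mul _
  have i23 : Integrable (fun Z => b / 2 * (if (pastRed Z i).burgers = [] then
      (pastCount Z i : ℝ) ^ 2 else 0) + 1 / (2 * b) * (if (pastRed Z N).burgers = [] then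
      (1 : ℝ) else 0)) (pastLaw p) := i2.add i3
  have h := integral_mono (integrable_absNil p N) (i1.add i23) fun Z => by
    simp only [Pi.add_apply]
    by_cases hN : (pastRed Z N).burgers = []
    · have hi' := burgers_nil_mono hiN hN
      have h1 := pastDisc_add Z i (N - i)
      rw [Nat.add_sub_cancel' hiN] at h1
      have h1' : (pastDisc Z N : ℝ) = pastDisc Z i + pastDisc (shift i Z) (N - i) := by
        exact_mod_cast h1
      have h2 := abs_pastDisc_real_le_of_nil hi'
      have h3 := abs_add_le (pastDisc Z i : ℝ) (pastDisc (shift i Z) (N - i))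
      simp only [hN, hi', if_true, one_mul, mul_one]
      rw [h1']
      set m := (pastCount Z i : ℝ)
      have e : b / 2 * m ^ 2 + 1 / (2 * b) - (-m) = (b * m + 1) ^ 2 / (2 * b) := by
        field_simp; ring
      have : 0 ≤ (b * m + 1) ^ 2 / (2 * b) := by positivity
      linarith
    · simp only [hN, if_false]
      split_ifs <;> positivity
  simp only [Pi.add_apply] at h
  rw [integral_add i1 i23, integral_add i2 i3, integral_const_mul, integral_const_mul] at h
  have e1 := integral_pastWord_mul_shift p i
    (fun w => if (reduce w).burgers = [] then (1 : ℝ) else 0)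
    (measurable_pastDisc_real (N - i)).abs
  have e1' : ∫ Z, (if (pastRed Z i).burgers = [] then (1 : ℝ) else 0) *
      |(pastDisc (shift i Z) (N - i) : ℝ)| ∂(pastLaw p)
      = probNil p i * ∫ Z, |(pastDisc Z (N - i) : ℝ)| ∂(pastLaw p) := e1
  rw [e1'] at h
  refine h.trans (add_le_add ?_ (add_le_add ?_ ?_))
  · rw [mul_comm]
    refine mul_le_mul (integral_abs_pastDisc_le p (N - i) hc) (probNil_le p hi)
      (probNil_nonneg p i) ?_
    exact add_nonneg (div_nonneg (integral_nonneg fun Z => sq_nonneg _) (by positivity))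
      (by positivity)
  · exact mul_le_mul_of_nonneg_left (integral_sq_nil_le p hi) (by positivity)
  · exact mul_le_mul_of_nonneg_left (probNil_le p (hi.trans_le hiN)) (by positivity)

theorem tendsto_absNil_of_sublinear (p : unitInterval)
    (hv : Tendsto (fun n : ℕ => discMoment p 2 n / n) atTop (𝓝 0)) :
    Tendsto (absNil p) atTop (𝓝 0) := by
  rw [Metric.tendsto_atTop']
  intro η hη
  -- With `i ≈ s ^ 2 N`, `c = ε √N` and `b = t / √N`, the three terms of the splitting are at most
  -- `4 ε / s`, `5 s t / 2` and `2 / t`. The choices of `t`, then `s`, then `ε` make each at most `η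
  -- / 4`.
  set t := 8 / η with ht
  have ht0 : 0 < t := by positivity
  set s := min (1 / 2) (η / (10 * t)) with hs
  have hs0 : 0 < s := by positivity
  have hs1 : s ≤ 1 / 2 := min_le_left _ _
  have hs2 : 5 * s * t / 2 ≤ η / 4 := by
    have : s ≤ η / (10 * t) := min_le_right _ _
    rw [le_div_iff₀ (by positivity)] at this
    linarith
  set ε := s * η / 16 with hε
  have hε0 : 0 < ε := by positivity
  have hev := eventually_forall_abs_sub_le hv (ε := ε ^ 2) (by positivity)
  obtain ⟨n₀, hn₀⟩ := eventually_atTop.mp hev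
  obtain ⟨n₁, hn₁⟩ := exists_nat_ge (1 / s ^ 2)
  refine ⟨n₀ + n₁ + 1, fun N hN => ?_⟩
  have hNpos : 0 < N := by omega
  have hNR : (0 : ℝ) < N := by exact_mod_cast hNpos
  have hN1 : 1 / s ^ 2 ≤ N := hn₁.trans (by exact_mod_cast (by omega : n₁ ≤ N))
  rw [div_le_iff₀ (by positivity)] at hN1
  set r := Real.sqrt N with hr
  have hr0 : 0 < r := Real.sqrt_pos.mpr hNR
  have hrr : r * r = N := Real.mul_self_sqrt hNR.le
  set i := ⌈s ^ 2 * N⌉₊ with hi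
  have hi1 : s ^ 2 * N ≤ i := Nat.le_ceil _
  have hi2 : (i : ℝ) ≤ 2 * (s ^ 2 * N) := by
    have := Nat.ceil_lt_add_one (by positivity : 0 ≤ s ^ 2 * N)
    linarith
  have hipos : 0 < i := by
    have : (0 : ℝ) < i := lt_of_lt_of_le (by positivity) hi1
    exact_mod_cast this
  have hiN : i ≤ N := by
    have hs4 : s ^ 2 ≤ 1 / 4 := by nlinarith
    have := mul_le_mul_of_nonneg_right hs4 hNR.le
    have : (i : ℝ) ≤ N := by linarith
    exact_mod_cast this
  have hsq1 : s * r ≤ Real.sqrt i := by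
    apply Real.le_sqrt_of_sq_le
    rw [mul_pow, sq r, hrr]; exact hi1
  have hsq2 : Real.sqrt i ≤ 2 * s * r := by
    apply Real.sqrt_le_iff.mpr
    refine ⟨by positivity, ?_⟩
    have : (2 * s * r) ^ 2 = 4 * s ^ 2 * (r * r) := by ring
    rw [this, hrr]; nlinarith [sq_nonneg s]
  have h := absNil_le_split p hipos hiN (c := ε * r) (b := t / r) (by positivity) (by positivity)
  have hv' : discMoment p 2 (N - i) ≤ ε ^ 2 * N := by
    have := hn₀ N (by omega) (N - i) (by omega)
    rw [zero_mul, sub_zero] at this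
    exact le_of_abs_le this
  have h1 : discMoment p 2 (N - i) / (2 * (ε * r)) + ε * r / 2 ≤ ε * r := by
    have : discMoment p 2 (N - i) / (2 * (ε * r)) ≤ ε * r / 2 := by
      rw [div_le_iff₀ (by positivity)]
      calc _ ≤ ε ^ 2 * N := hv'
        _ = ε * r / 2 * (2 * (ε * r)) := by rw [← hrr]; ring
    linarith
  have h2 : 4 / Real.sqrt i ≤ 4 / (s * r) :=
    div_le_div_of_nonneg_left (by norm_num) (by positivity) hsq1
  have h3 : (discMoment p 2 (N - i) / (2 * (ε * r)) + ε * r / 2) * (4 / Real.sqrt i)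
      ≤ η / 4 := by
    calc _ ≤ (ε * r) * (4 / (s * r)) := mul_le_mul h1 h2 (by positivity) (by positivity)
      _ = η / 4 := by rw [hε]; field_simp; ring
  have h4 : t / r / 2 * (5 / 2 * Real.sqrt i) ≤ η / 4 := by
    calc _ ≤ t / r / 2 * (5 / 2 * (2 * s * r)) :=
          mul_le_mul_of_nonneg_left (by linarith) (by positivity)
      _ = 5 * s * t / 2 := by field_simp
      _ ≤ _ := hs2
  have h5 : 1 / (2 * (t / r)) * (4 / r) = η / 4 := by
    rw [ht]; field_simp; ring
  rw [Real.dist_eq, sub_zero, abs_of_nonneg (absNil_nonneg p N)]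
  linarith

/-- The dichotomy on `χ`: for `χ = 2` the random walk bound already vanishes, for `χ < 2` the
sublinear second moment is used. -/
theorem tendsto_nilError (p : unitInterval) : Tendsto (fun n => nilError p n 1) atTop (𝓝 0) := by
  have h : Tendsto (absNil p) atTop (𝓝 0) := by
    rcases (meanLength_le_two p).lt_or_eq with hχ | hχ
    · exact tendsto_absNil_of_sublinear p (tendsto_discMoment_two_div p hχ)
    · have := tendsto_meanNil p
      rw [hχ, sub_self] at this
      exact squeeze_zero (absNil_nonneg p) (absNil_le_meanNil p) this
  exact squeeze_zero_norm (abs_nilError_one_le p) h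

/-- The increments of the second moment converge, so their Cesàro means do. -/
theorem tendsto_discMoment_two_div_linear (p : unitInterval) :
    Tendsto (fun n : ℕ => discMoment p 2 n / n) atTop (𝓝 (1 - p * meanLength p)) := by
  have h : Tendsto (fun n => 1 - p * truncLength p n + p * nilError p n 1) atTop
      (𝓝 (1 - p * meanLength p)) := by
    have := (((tendsto_truncLength p).const_mul (p : ℝ)).const_sub 1).add
      ((tendsto_nilError p).const_mul (p : ℝ))
    simpa using this
  have h2 := h.cesaro
  refine h2.congr fun n => ?_
  have : ∑ i ∈ Finset.range n, (1 - p * truncLength p i + p * nilError p i 1)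
      = discMoment p 2 n := by
    induction n with
    | zero => simp [discMoment, pastDisc]
    | succ n ih => rw [Finset.sum_range_succ, ih, discMoment_two_succ]; ring
  rw [this]; ring

/-! ### The value of `χ` in the two phases -/

theorem mul_meanLength_le_one (p : unitInterval) : p * meanLength p ≤ 1 := by
  have h : 0 ≤ 1 - p * meanLength p := ge_of_tendsto' (tendsto_discMoment_two_div_linear p)
    fun n => div_nonneg (integral_nonneg fun Z => sq_nonneg _) (Nat.cast_nonneg _)
  linarith

/-- Positive drift of the blocks forces the limit `1 - p χ` to be zero. -/
theorem mul_meanLength_eq_one (p : unitInterval) (hχ : meanLength p < 2) :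
    p * meanLength p = 1 := by
  have := tendsto_nhds_unique (tendsto_discMoment_two_div_linear p)
    (tendsto_discMoment_two_div p hχ)
  linarith

theorem meanLength_of_le_half (p : unitInterval) (hp : (p : ℝ) ≤ 1 / 2) : meanLength p = 2 := by
  by_contra hne
  have hlt := lt_of_le_of_ne (meanLength_le_two p) hne
  have h1 := mul_meanLength_eq_one p hlt
  have hp0 := p.2.1
  have h0 : 0 ≤ meanLength p := integral_nonneg fun Z => Nat.cast_nonneg _
  nlinarith

/-- If `χ = 2`, then `p χ ≤ 1` leaves only `p = 1 / 2`, where the two formulas agree. -/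
theorem meanLength_of_half_le (p : unitInterval) (hp : 1 / 2 ≤ (p : ℝ)) :
    p * meanLength p = 1 := by
  rcases (meanLength_le_two p).lt_or_eq with hlt | heq
  · exact mul_meanLength_eq_one p hlt
  · have := mul_meanLength_le_one p
    rw [heq] at this ⊢
    linarith

/-! ### Transfer to two-sided configurations -/

/-- The letters of `X` up to time `t`, read backwards. -/
def pastOf (X : Config) (t : ℤ) : ℕ → Symb := fun i => X (t - i)

theorem shift_pastOf (X : Config) (t : ℤ) (k : ℕ) : shift k (pastOf X t) = pastOf X (t - k) := by
  funext i
  simp only [shift, pastOf]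
  congr 1; push_cast; ring

theorem measurable_pastOf (t : ℤ) : Measurable (fun X => pastOf X t) :=
  measurable_pi_lambda _ fun i => measurable_pi_apply (t - i)

instance (p : unitInterval) : IsProbabilityMeasure (configLaw p) := by
  unfold configLaw; infer_instance

theorem measurePreserving_pastOf (p : unitInterval) (t : ℤ) :
    MeasurePreserving (fun X => pastOf X t) (configLaw p) (pastLaw p) := by
  refine ⟨measurable_pastOf t, ?_⟩
  exact Measure.map_infinitePi_infinitePi_of_inj (P := fun _ : ℤ => symbolLaw p)
    (f := fun i : ℕ => t - (i : ℤ)) (fun a b h => by simpa using h)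

theorem rawWord_eq_pastWord (X : Config) (b : ℤ) (n : ℕ) :
    rawWord X (b + 1 - n) b = pastWord (pastOf X b) n := by
  have hlen : (b + 1 - (b + 1 - (n : ℤ))).toNat = n := by
    rw [sub_sub_cancel]; simp
  rw [rawWord, hlen]
  clear hlen
  simp only [List.bind_eq_flatMap, List.pure_def, ← List.map_eq_flatMap, List.map_map]
  induction n with
  | zero => simp [pastWord]
  | succ n ih =>
    rw [List.range_succ_eq_map, List.map_cons, List.map_map, pastWord, ← ih]
    congr 1
    · simp only [pastOf, Function.comp_apply]; congr 1; push_cast; ring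
    · refine List.map_congr_left fun i _ => ?_
      simp only [Function.comp_apply]; congr 1; push_cast; ring

theorem reducedWord_eq_pastRed (X : Config) {a b : ℤ} {n : ℕ} (h : a = b + 1 - n) :
    reducedWord X a b = pastRed (pastOf X b) n := by
  rw [h, reducedWord, rawWord_eq_pastWord]; rfl

theorem burgerTimes_eq (X : Config) : burgerTimes X = topTimes (pastOf X (-1)) := by
  ext j
  change 0 < j ∧ (reducedWord X (-(j : ℤ)) (-1)).burgers ≠ [] ↔ _
  rw [reducedWord_eq_pastRed X (n := j) (by ring)]
  rfl

theorem lengthAtJ_eq (X : Config) : lengthAtJ X = topLength (pastOf X (-1)) := by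
  have h : firstBurgerTime X = topTime (pastOf X (-1)) := by
    rw [firstBurgerTime, burgerTimes_eq]; rfl
  rw [lengthAtJ, h, reducedWord_eq_pastRed X (n := topTime (pastOf X (-1))) (by ring)]
  rfl

/-! ### Flexible orders and the burgers they consume -/

theorem burgers_foldl_orders_subset (O : List Symb) (hO : ∀ o ∈ O, o.isBurger = false) (R : RWord) :
    (O.foldl RWord.push R).burgers ⊆ R.burgers := by
  induction O generalizing R with
  | nil => simp
  | cons o O ih =>
    rw [List.foldl_cons]
    refine List.Subset.trans (ih (fun x hx => hO x (by simp [hx])) _) ?_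
    have ho := hO o (by simp)
    cases ha : R.burgers.any o.fulfils with
    | true => rw [push_order_of_any ho ha]; exact List.eraseP_subset
    | false => rw [push_order_of_not_any ho ha]; exact List.Subset.refl _

/-- The letters after an intermediate time before `J` reduce to orders only, which cannot add
burgers. A burger present at the end was therefore present at that time. -/
theorem topBurger_mem_of_lt {Z : ℕ → Symb} (h : (topTimes Z).Nonempty) {j : ℕ}
    (hj : j < topTime Z) : topBurger Z ∈ (pastRed (shift j Z) (topTime Z - j)).burgers := by
  have h1 := (pastRed_topTime h).2.1
  have h2 : pastRed Z (topTime Z) = reduce (pastWord (shift j Z) (topTime Z - j) ++ pastWord Z j) := by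
    rw [← pastWord_add, Nat.add_sub_cancel' hj.le]; rfl
  rw [reduce_append] at h2
  have h3 : (reduce (pastWord Z j)).burgers = [] := (burgers_eq_nil_iff h j).mpr hj
  rw [h3, List.nil_append] at h2
  refine burgers_foldl_orders_subset _ (not_isBurger_of_mem_orders (pastWord Z j)) _ ?_
  have h4 := congrArg RWord.burgers (h2.symm.trans h1)
  have h5 : ((reduce (pastWord Z j)).orders.foldl RWord.push
    (reduce (pastWord (shift j Z) (topTime Z - j)))).burgers = [topBurger Z] := h4
  change _ ∈ (List.foldl RWord.push (reduce (pastWord (shift j Z) (topTime Z - j)))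
    (reduce (pastWord Z j)).orders).burgers
  rw [h5]; simp

theorem reducedWord_flex (X : Config) {n : ℤ} (hn : X n = Symb.flexOrder) (j : ℕ) :
    reducedWord X (n - j) n = (pastRed (pastOf X (n - 1)) j).push Symb.flexOrder := by
  rw [reducedWord_eq_pastRed X (n := j + 1) (by push_cast; ring), pastRed_succ', shift_pastOf]
  simp [pastOf, hn]

theorem push_flex {Z : ℕ → Symb} {j : ℕ} {B : List Symb}
    (h : (pastRed Z j).burgers = topBurger Z :: B) :
    ((pastRed Z j).push Symb.flexOrder).burgers = B := by
  have hne : (pastRed Z j).burgers ≠ [] := by rw [h]; simp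
  rw [push_order_of_any rfl (any_flex_iff.mpr hne)]
  have hb : (topBurger Z).isBurger = true :=
    isBurger_of_mem_burgers (pastWord Z j) _ (by
      change _ ∈ (pastRed Z j).burgers
      rw [h]; simp)
  rw [h, List.eraseP_cons_of_pos (isBurger_flex_fulfils hb)]

/-- A flexible order consumes the burger at the top of the stack. -/
theorem isMatch_top (X : Config) {n : ℤ} (hn : X n = Symb.flexOrder)
    (h : (topTimes (pastOf X (n - 1))).Nonempty) :
    ∃ m, IsMatch X m n ∧ X m = topBurger (pastOf X (n - 1)) := by
  set Z := pastOf X (n - 1) with hZ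
  have hpos := topTime_pos h
  have hX : X (n - topTime Z) = topBurger Z := by
    rw [topBurger, hZ, pastOf, ← hZ]; congr 1
    have : ((topTime Z - 1 : ℕ) : ℤ) = topTime Z - 1 := by omega
    rw [this]; ring
  refine ⟨n - topTime Z, ⟨?_, by omega, ?_, ?_⟩, hX⟩
  · rw [hX]; exact (pastRed_topTime h).1
  -- Just before `n` the word from the top burger on has that burger as its only one, so the
  -- flexible order leaves the stack empty.
  · rw [reducedWord_flex X hn, push_flex (B := []) (by rw [← hZ, (pastRed_topTime h).2.1])]
    simp
  · intro k hk1 hk2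
    rw [hX]
    obtain ⟨j, hj⟩ := Int.eq_ofNat_of_zero_le (by omega : 0 ≤ n - 1 - k)
    have hjlt : j < topTime Z := by omega
    have h1 := topBurger_mem_of_lt h hjlt
    rw [hZ, shift_pastOf, ← hZ, ← hj, sub_sub_cancel] at h1
    rw [reducedWord_eq_pastRed X (n := topTime Z - j) (by omega)]
    exact h1

/-- The type of the matched burger is on the stack before time `n` and gone after it, while the
flexible order removes only the head; so it is the type of the head. Only types are compared, which
is all that `resolved` needs. -/
theorem eq_topBurger_of_isMatch (X : Config) {m n : ℤ} (hn : X n = Symb.flexOrder)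
    (hm : IsMatch X m n) : X m = topBurger (pastOf X (n - 1)) := by
  obtain ⟨h1, h2, h3, h4⟩ := hm
  obtain ⟨j, hj⟩ := Int.eq_ofNat_of_zero_le (by omega : 0 ≤ n - m)
  have hmj : m = n - j := by omega
  have hmem : X m ∈ (pastRed (pastOf X (n - 1)) j).burgers := by
    rcases eq_or_lt_of_le (by omega : m ≤ n - 1) with h5 | h5
    · have hj1 : j = 1 := by omega
      have : pastRed (pastOf X (n - 1)) 1 = (RWord.mk [] []).push (X m) := by
        simp [pastRed, pastWord, pastOf, reduce, h5]
      rw [hj1, this, push_burger h1]; simp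
    · have := h4 (n - 1) h5 (by omega)
      rwa [reducedWord_eq_pastRed X (n := j) (by omega)] at this
  obtain ⟨B, hB⟩ := head_burgers (List.ne_nil_of_mem hmem)
  rw [hmj, reducedWord_flex X hn, push_flex hB, ← hmj] at h3
  rw [hB] at hmem
  rcases List.mem_cons.mp hmem with h | h
  · exact h
  · exact absurd h h3

theorem disc_resolved (X : Config) (n : ℤ) (h : (topTimes (pastOf X (n - 1))).Nonempty) :
    (resolved X n).disc = incr (pastOf X n) := by
  have h0 : pastOf X n 0 = X n := by simp [pastOf]
  have h1 : shift 1 (pastOf X n) = pastOf X (n - 1) := by rw [shift_pastOf]; simp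
  rw [resolved, incr, h0, h1]
  by_cases hn : X n = Symb.flexOrder
  · rw [if_pos hn, if_pos hn]
    obtain ⟨m, hm, hmt⟩ := isMatch_top X hn h
    have hb := (pastRed_topTime h).1
    have huniq : ∀ m', IsMatch X m' n → X m' = topBurger (pastOf X (n - 1)) := fun m' =>
      eq_topBurger_of_isMatch X hn
    generalize topBurger (pastOf X (n - 1)) = b at *
    cases b with
    | cheeseBurger => rw [if_pos ⟨m, hm, hmt⟩]; simp [Symb.disc]
    | hamBurger =>
      rw [if_neg, if_pos ⟨m, hm, hmt⟩]
      · simp [Symb.disc]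
      · rintro ⟨m', hm', h'⟩
        rw [huniq m' hm'] at h'
        exact Symb.noConfusion h'
    | cheeseOrder => simp [Symb.isBurger] at hb
    | hamOrder => simp [Symb.isBurger] at hb
    | flexOrder => simp [Symb.isBurger] at hb
  · rw [if_neg hn, if_neg hn]

theorem discrepancy_eq (X : Config) (h : ∀ n : ℤ, (topTimes (pastOf X n)).Nonempty) (n : ℕ) :
    discrepancy n X = pastDisc (pastOf X n) n := by
  induction n with
  | zero => simp [discrepancy, pastDisc]
  | succ n ih =>
    have h1 : discrepancy (n + 1) X = discrepancy n X + (resolved X ((n + 1 : ℕ) : ℤ)).disc := by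
      rw [discrepancy, discrepancy, Finset.sum_Icc_succ_top (by omega)]
    rw [h1, ih, pastDisc_succ', disc_resolved X _ (h _), shift_pastOf, add_comm]
    congr 3
    push_cast; ring

theorem ae_forall_topTimes_pastOf (p : unitInterval) :
    ∀ᵐ X ∂(configLaw p), ∀ n : ℤ, (topTimes (pastOf X n)).Nonempty :=
  ae_all_iff.mpr fun n =>
    (measurePreserving_pastOf p n).quasiMeasurePreserving.ae (ae_topTimes_nonempty p)

theorem integral_pastOf (p : unitInterval) (t : ℤ) {f : (ℕ → Symb) → ℝ} (hf : Measurable f) :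
    ∫ X, f (pastOf X t) ∂(configLaw p) = ∫ Z, f Z ∂(pastLaw p) := by
  have h := integral_map (μ := configLaw p) (measurable_pastOf t).aemeasurable
    (f := f) hf.aestronglyMeasurable
  rw [(measurePreserving_pastOf p t).map_eq] at h
  exact h.symm

theorem chi_eq (p : unitInterval) : chi p = meanLength p := by
  rw [chi, meanLength, ← integral_pastOf p (-1) measurable_topLength_real]
  simp_rw [lengthAtJ_eq]

theorem discrepancy_ae_eq (p : unitInterval) (n : ℕ) :
    (fun X => (discrepancy n X : ℝ)) =ᵐ[configLaw p] fun X => (pastDisc (pastOf X n) n : ℝ) := by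
  filter_upwards [ae_forall_topTimes_pastOf p] with X hX
  rw [discrepancy_eq X hX]

theorem memLp_pastDisc_pastOf (p : unitInterval) (n : ℕ) :
    MemLp (fun X => (pastDisc (pastOf X n) n : ℝ)) 2 (configLaw p) :=
  MemLp.of_bound ((measurable_pastDisc_real n).comp (measurable_pastOf n)).aestronglyMeasurable n
    (Eventually.of_forall fun _ => abs_pastDisc_real_le _ n)

/-- The mean vanishes by the symmetry between the two foods. -/
theorem varDisc_eq (p : unitInterval) (n : ℕ) : varDisc p n = discMoment p 2 n := by
  rw [varDisc, variance_congr (discrepancy_ae_eq p n), variance_eq_sub (memLp_pastDisc_pastOf p n)]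
  have h1 := integral_pastOf p n (measurable_pastDisc_real n)
  have h2 := integral_pastOf p n ((measurable_pastDisc_real n).pow_const 2)
  have h3 := integral_pastDisc_pow_odd p n odd_one
  simp only [pow_one] at h3
  simp only [Pi.pow_apply]
  rw [h1, h2, h3]
  simp [discMoment]

theorem isLittleO_of_tendsto_div {v : ℕ → ℝ} {l : ℝ}
    (h : Tendsto (fun n : ℕ => v n / n) atTop (𝓝 l)) :
    (fun n : ℕ => v n - l * (n : ℝ)) =o[atTop] fun n : ℕ => (n : ℝ) := by
  refine (Asymptotics.isLittleO_iff_tendsto' ?_).mpr ?_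
  · filter_upwards [eventually_gt_atTop 0] with n hn h0
    exact absurd h0 (by exact_mod_cast hn.ne')
  · have h1 := h.sub_const l
    rw [sub_self] at h1
    refine h1.congr' ?_
    filter_upwards [eventually_gt_atTop 0] with n hn
    have : (n : ℝ) ≠ 0 := by exact_mod_cast hn.ne'
    field_simp

end Burger

theorem lemmal (p : ℝ) (hp0 : 0 ≤ p) (hp1 : p ≤ 1) :
    -- the objects are well defined: `J` is a.s. finite, a.s. every flexible order is filled, the
    -- length of `X(-J,-1)` has finite expectation, and each `D_n` has finite variance
    (∀ᵐ X ∂(Burger.configLaw p), (Burger.burgerTimes X).Nonempty) ∧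
    (∀ᵐ X ∂(Burger.configLaw p), ∀ n : ℤ, X n = Burger.Symb.flexOrder →
      ∃ m : ℤ, Burger.IsMatch X m n) ∧
    MeasureTheory.Integrable (fun X => (Burger.lengthAtJ X : ℝ)) (Burger.configLaw p) ∧
    (∀ n : ℕ, MeasureTheory.MemLp (fun X => (Burger.discrepancy n X : ℝ)) 2
      (Burger.configLaw p)) ∧
    -- the two phases
    (p ≤ 1 / 2 → Burger.chi p = 2 ∧
      (fun n : ℕ => Burger.varDisc p n - (1 - 2 * p) * (n : ℝ))
        =o[Filter.atTop] (fun n : ℕ => (n : ℝ))) ∧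
    (1 / 2 ≤ p → Burger.chi p = 1 / p ∧
      (fun n : ℕ => Burger.varDisc p n) =o[Filter.atTop] (fun n : ℕ => (n : ℝ))) := by
  lift p to unitInterval using ⟨hp0, hp1⟩
  have hv := Burger.tendsto_discMoment_two_div_linear p
  simp_rw [← Burger.varDisc_eq] at hv
  have hl := Burger.isLittleO_of_tendsto_div hv
  refine ⟨?_, ?_, ?_, ?_, ?_, ?_⟩
  · filter_upwards [Burger.ae_forall_topTimes_pastOf p] with X hX
    rw [Burger.burgerTimes_eq]; exact hX _
  · filter_upwards [Burger.ae_forall_topTimes_pastOf p] with X hX n hn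
    obtain ⟨m, hm, -⟩ := Burger.isMatch_top X hn (hX _)
    exact ⟨m, hm⟩
  · simp_rw [Burger.lengthAtJ_eq]
    exact (Burger.measurePreserving_pastOf p (-1)).integrable_comp_of_integrable
      (Burger.integrable_topLength p)
  · intro n
    exact (memLp_congr_ae (Burger.discrepancy_ae_eq p n)).mpr (Burger.memLp_pastDisc_pastOf p n)
  · intro hp
    have hχ := Burger.meanLength_of_le_half p hp
    refine ⟨by rw [Burger.chi_eq, hχ], ?_⟩
    rw [hχ] at hl
    refine hl.congr_left fun n => ?_
    ring
  · intro hp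
    have hχ := Burger.meanLength_of_half_le p hp
    have hpos : (p : ℝ) ≠ 0 := by linarith
    refine ⟨?_, ?_⟩
    · rw [Burger.chi_eq, eq_div_iff hpos, mul_comm, hχ]
    · rw [hχ] at hl
      refine hl.congr_left fun n => ?_
      ring
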